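/- Let $\mathbb E^5_2$ be $\mathbb R^5$ with $\langle v,w\rangle=-v_1w_1-v_2w_2+v_3w_3+v_4w_4+v_5w_5$, and let $\mathbb S^4_2(1)=\{v\in\mathbb E^5_2:\langle v,v\rangle=1\}$. Let $M$ be a connected smooth surface (2-manifold) and let $x:M\to\mathbb E^5_2$ be a smooth map with values in $\mathbb S^4_2(1)$ such that the induced metric on $M$ is Lorentzian (of signature $(1,1)$). Suppose that $M$ lies fully in $\mathbb S^4_2(1)$, i.e. $x(M)$ is contained in no hyperplane of $\mathbb E^5_2$ through the origin. The normal curvature of $M$ in $\mathbb S^4_2(1)$ is $K^D=-\langle R^{D}(f_1,f_2)f_3,f_4\rangle$, where $R^{D}$ is the curvature tensor of the normal connection of $M$ in $\mathbb S^4_2(1)$, $f_1,f_2$ are tangent and $f_3,f_4$ are normal to $M$ in $\mathbb S^4_2(1)$ and form a pseudo-orthonormal frame ($\langle f_1,f_2\rangle=\langle f_3,f_4\rangle=-1$, all other products $0$), ordered so that $(f_1,f_2,f_3,f_4,x)$ is a positively oriented basis of $\mathbb E^5_2$. Then the following are equivalent. (i) $M$ is minimal in $\mathbb S^4_2(1)$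 (its mean curvature vector in $\mathbb S^4_2(1)$ vanishes identically), its Gaussian curvature $K$ is constant, and its normal curvature $K^D$ is a nonzero constant. (ii) $M$ is locally congruent to a surface of the form $$x(s,t)=\Big(\tfrac12 s^2+\tfrac{27}{40}\langle\alpha'''(t),\alpha'''(t)\rangle\Big)\alpha(t)+\tfrac32\,s\,\alpha'(t)+\tfrac32\,\alpha''(t),$$ where $\alpha:I\to\mathbb E^5_2$ is a smooth null curve on an open interval $I$ ($\alpha'\neq0$, $\langle\alpha',\alpha'\rangle=0$) in the light cone ($\langle\alpha,\alpha\rangle=0$) with $\langle\alpha'',\alpha''\rangle=\tfrac49$. That is, for every $p\in M$ there are such a curve $\alpha$, a linear isometry $A$ of $\mathbb E^5_2$, and smooth local coordinates $(s,t)$ of $M$ on an open neighbourhood of $p$, with values in $\mathbb R\times I$, in which the immersion of $M$ is $A\circ x(s,t)$. -/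

import Mathlib

open Set
open scoped Manifold ContDiff

noncomputable section

namespace LorentzSurface

/-- The vector space underlying the pseudo-Euclidean space `𝔼⁵₂`. -/
abbrev E52 : Type := Fin 5 → ℝ

/-- The canonical pseudo-Euclidean metric of index `2` on `𝔼⁵₂`. -/
def sp (v w : E52) : ℝ :=
  -(v 0 * w 0) - v 1 * w 1 + v 2 * w 2 + v 3 * w 3 + v 4 * w 4

/-- The coordinate plane, model space of surfaces. -/
abbrev Plane : Type := EuclideanSpace ℝ (Fin 2)

/-- The partial derivative `∂ᵢ f`. -/
def pd {F : Type*} [NormedAddCommGroup F] [NormedSpace ℝ F]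
    (i : Fin 2) (f : Plane → F) (q : Plane) : F :=
  fderiv ℝ f q (EuclideanSpace.single i 1)

/-! ### Geometry of a local parametrization `y` of a surface in `𝕊⁴₂(1) ⊂ 𝔼⁵₂` -/

/-- The matrix `gᵢⱼ = ⟨∂ᵢ y, ∂ⱼ y⟩` of the induced metric. -/
def metric (y : Plane → E52) (q : Plane) : Matrix (Fin 2) (Fin 2) ℝ :=
  Matrix.of fun i j => sp (pd i y q) (pd j y q)

/-- The Christoffel symbols `Γᵏᵢⱼ` of the Levi-Civita connection `∇` of the induced metric. -/
def christoffel (y : Plane → E52) (k i j : Fin 2) (q : Plane) : ℝ :=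
  1 / 2 * ∑ l, (metric y q)⁻¹ k l *
    (pd i (fun p => metric y p j l) q + pd j (fun p => metric y p i l) q
      - pd l (fun p => metric y p i j) q)

/-- The coefficient of `∂ₗ` in
`R(∂ᵢ, ∂ⱼ) ∂ₖ = ∇_{∂ᵢ} ∇_{∂ⱼ} ∂ₖ - ∇_{∂ⱼ} ∇_{∂ᵢ} ∂ₖ`. -/
def curvatureCoeff (y : Plane → E52) (i j k l : Fin 2) (q : Plane) : ℝ :=
  pd i (christoffel y l j k) q - pd j (christoffel y l i k) q
    + ∑ m, (christoffel y m j k q * christoffel y l i m q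
      - christoffel y m i k q * christoffel y l j m q)

/-- The Gaussian curvature
`K = ⟨R(X, Y) Y, X⟩ / (⟨X, X⟩ ⟨Y, Y⟩ - ⟨X, Y⟩²)` with `X = ∂₀`, `Y = ∂₁`. -/
def gaussCurvature (y : Plane → E52) (q : Plane) : ℝ :=
  (∑ l, curvatureCoeff y 0 1 1 l q * metric y q l 0) / (metric y q).det

/-- The second fundamental form `ĥ(∂ᵢ, ∂ⱼ)` of the surface in `𝕊⁴₂(1)`, by the Gauss formula:
the covariant derivative of the sphere is `∂ᵢ ∂ⱼ y + gᵢⱼ y`, and its tangential part is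
`∇_{∂ᵢ} ∂ⱼ = ∑ₖ Γᵏᵢⱼ ∂ₖ y`. -/
def secondForm (y : Plane → E52) (i j : Fin 2) (q : Plane) : E52 :=
  pd i (pd j y) q + metric y q i j • y q - ∑ k, christoffel y k i j q • pd k y q

/-- The mean curvature vector `(1/2) tr ĥ` of the surface in `𝕊⁴₂(1)`. -/
def meanCurvature (y : Plane → E52) (q : Plane) : E52 :=
  (1 / 2 : ℝ) • ∑ i, ∑ j, (metric y q)⁻¹ i j • secondForm y i j q

/-- The orthogonal projection of `w` to the normal plane of the surface in `𝕊⁴₂(1)`, that is,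
to the orthogonal complement of the span of `∂₀ y`, `∂₁ y` and `y`. -/
def normalPart (y : Plane → E52) (q : Plane) (w : E52) : E52 :=
  w - (∑ k, ∑ l, ((metric y q)⁻¹ k l * sp w (pd k y q)) • pd l y q) - sp w (y q) • y q

/-- The normal connection `D_{∂ᵢ} ξ` of the surface in `𝕊⁴₂(1)`. -/
def normalDeriv (y : Plane → E52) (i : Fin 2) (ξ : Plane → E52) (q : Plane) : E52 :=
  normalPart y q (pd i ξ q)

/-- The curvature tensor of the normal connection,
`R^D(∂ᵢ, ∂ⱼ) w = D_{∂ᵢ} D_{∂ⱼ} ξ - D_{∂ⱼ} D_{∂ᵢ} ξ` at `q`. Being tensorial, it is computed for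
the normal vector field `ξ` that extends the normal vector `w` at `q` by projection. -/
def normalCurvatureTensor (y : Plane → E52) (i j : Fin 2) (w : E52) (q : Plane) : E52 :=
  normalDeriv y i (normalDeriv y j fun p => normalPart y p w) q
    - normalDeriv y j (normalDeriv y i fun p => normalPart y p w) q

/-- The vector tangent to the surface with coordinates `a`. -/
def tangentVec (y : Plane → E52) (q : Plane) (a : Fin 2 → ℝ) : E52 :=
  ∑ i, a i • pd i y q

/-- `{f₁, f₂; f₃, f₄}` with `f₁, f₂` the tangent vectors of coordinates `a`, `b` is a
pseudo-orthonormal frame at `q`, adapted to the surface in `𝕊⁴₂(1)` and such that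
`(f₁, f₂, f₃, f₄, y)` is a positive basis of `𝔼⁵₂`. -/
structure IsFrame (y : Plane → E52) (q : Plane) (a b : Fin 2 → ℝ) (f₃ f₄ : E52) : Prop where
  h11 : sp (tangentVec y q a) (tangentVec y q a) = 0
  h22 : sp (tangentVec y q b) (tangentVec y q b) = 0
  h12 : sp (tangentVec y q a) (tangentVec y q b) = -1
  h33 : sp f₃ f₃ = 0
  h44 : sp f₄ f₄ = 0
  h34 : sp f₃ f₄ = -1
  normal₃ : (∀ i, sp f₃ (pd i y q) = 0) ∧ sp f₃ (y q) = 0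
  normal₄ : (∀ i, sp f₄ (pd i y q) = 0) ∧ sp f₄ (y q) = 0
  positive : 0 < (Matrix.of ![tangentVec y q a, tangentVec y q b, f₃, f₄, y q]).det

/-- `-⟨R^D(f₁, f₂) f₃, f₄⟩`, with `f₁, f₂` the tangent vectors of coordinates `a`, `b`: the normal
curvature computed in the frame `{f₁, f₂; f₃, f₄}`. -/
def normalCurvature (y : Plane → E52) (q : Plane) (a b : Fin 2 → ℝ) (f₃ f₄ : E52) : ℝ :=
  -sp (∑ i, ∑ j, (a i * b j) • normalCurvatureTensor y i j f₃ q) f₄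

/-! ### Surfaces -/

section Surface

variable {M : Type*} [TopologicalSpace M] [ChartedSpace Plane M]

/-- The map `x : M → 𝔼⁵₂` makes the smooth `2`-manifold `M` a Lorentzian surface in `𝕊⁴₂(1)`:
it is smooth with values in `𝕊⁴₂(1)` and induces a metric of signature `(1, 1)`, which for a
symmetric `2 × 2` matrix means a negative determinant (in particular `x` is an immersion). -/
structure IsLorentzianSurface (x : M → E52) : Prop where
  smooth : ContMDiff (𝓡 2) 𝓘(ℝ, E52) ∞ x
  mem_sphere : ∀ p, sp (x p) (x p) = 1
  lorentzian : ∀ e ∈ IsManifold.maximalAtlas (𝓡 2) ∞ M, ∀ p ∈ e.source,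
    (metric (x ∘ e.symm) (e p)).det < 0

/-- The surface lies fully in `𝕊⁴₂(1)`: it is not contained in a hyperplane of `𝔼⁵₂` through the
origin, that is, in a totally geodesic hypersurface of `𝕊⁴₂(1)`. -/
def LiesFully (x : M → E52) : Prop :=
  Submodule.span ℝ (range x) = ⊤

/-- The surface is minimal in `𝕊⁴₂(1)`. -/
def IsMinimal (x : M → E52) : Prop :=
  ∀ e ∈ IsManifold.maximalAtlas (𝓡 2) ∞ M, ∀ p ∈ e.source,
    meanCurvature (x ∘ e.symm) (e p) = 0

/-- The Gaussian curvature of the surface is constant, equal to `K`. -/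
def HasGaussCurvature (x : M → E52) (K : ℝ) : Prop :=
  ∀ e ∈ IsManifold.maximalAtlas (𝓡 2) ∞ M, ∀ p ∈ e.source,
    gaussCurvature (x ∘ e.symm) (e p) = K

/-- The normal curvature of the surface in `𝕊⁴₂(1)` is constant, equal to `K`. -/
def HasNormalCurvature (x : M → E52) (K : ℝ) : Prop :=
  ∀ e ∈ IsManifold.maximalAtlas (𝓡 2) ∞ M, ∀ p ∈ e.source, ∀ (a b : Fin 2 → ℝ) (f₃ f₄ : E52),
    IsFrame (x ∘ e.symm) (e p) a b f₃ f₄ →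
      normalCurvature (x ∘ e.symm) (e p) a b f₃ f₄ = K

/-- `α : I → 𝔼⁵₂` is a smooth null curve in the light cone, defined on an open interval. -/
structure IsNullCurveInLightCone (I : Set ℝ) (α : ℝ → E52) : Prop where
  isOpen : IsOpen I
  ordConnected : I.OrdConnected
  smooth : ContDiffOn ℝ ∞ α I
  lightCone : ∀ t ∈ I, sp (α t) (α t) = 0
  regular : ∀ t ∈ I, deriv α t ≠ 0
  null : ∀ t ∈ I, sp (deriv α t) (deriv α t) = 0

/-- The parametrization
`(s, t) ↦ (s²/2 + (27/40) ⟨α''', α'''⟩) α + (3/2) s α' + (3/2) α''`. -/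
def model (α : ℝ → E52) (s t : ℝ) : E52 :=
  (1 / 2 * s ^ 2 + 27 / 40 * sp (iteratedDeriv 3 α t) (iteratedDeriv 3 α t)) • α t
    + (3 / 2 * s) • deriv α t + (3 / 2 : ℝ) • iteratedDeriv 2 α t

/-- Each point of the surface has a neighbourhood which, in suitable local coordinates `(s, t)` of
`M` and up to a linear isometry of `𝔼⁵₂`, is an open part of a surface `model α`, for a null curve
`α` in the light cone with `⟨α'', α''⟩ = 4/9`. -/
def IsCongruentToModel (x : M → E52) : Prop :=
  ∀ p : M, ∃ (I : Set ℝ) (α : ℝ → E52),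
    IsNullCurveInLightCone I α ∧
    (∀ t ∈ I, sp (iteratedDeriv 2 α t) (iteratedDeriv 2 α t) = 4 / 9) ∧
    ∃ A : E52 ≃ₗ[ℝ] E52, (∀ v w, sp (A v) (A w) = sp v w) ∧
    ∃ e ∈ IsManifold.maximalAtlas (𝓡 2) ∞ M, p ∈ e.source ∧
      ∀ q ∈ e.source, e q 1 ∈ I ∧ x q = A (model α (e q 0) (e q 1))

end Surface

end LorentzSurface

end

open LorentzSurface

/-!
The local invariants of the surface are read off from a smooth null frame `X₁`, `X₂` of the tangent
planes with scalar product `-1`. A surface is minimal exactly when the second fundamental form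
vanishes on `(X₁, X₂)`, so that it is given by its values `P` on `(X₁, X₁)` and `Q` on `(X₂, X₂)`.
The Gauss equation then says `K = 1 - ⟨P, Q⟩`, and the Ricci equation identifies the normal
curvature with the determinant of `(X₁ y, X₂ y, P, Q, y)`, whose square is
`⟨P, Q⟩² - ⟨P, P⟩ ⟨Q, Q⟩`
(`IsLorentzPatch.gaussCurvature_eq_nullFrame`, `IsLorentzPatch.normalCurvature_eq_frameDet`,
`IsLorentzPatch.frameDet_sq`).

For a surface `model α` everything follows from the scalar products of the derivatives of `α` up to
the third one: in the null frame `∂₀`, `∂₁ + (g₁₁ / 2) ∂₀` one finds `⟨P, P⟩ = 0` and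
`⟨P, Q⟩ = 2 / 3` (`IsNormalizedNullCurve.nullFrame_model`). Hence `K = 1 / 3` and the normal
curvature is `2 / 3` or `-2 / 3` at each point. It is continuous and independent of the chart and of
the frame, and so it is constant because `M` is connected (`IsCongruentToModel.curvatures`).

Conversely, let `y` be minimal, with `k = ⟨P, Q⟩` constant and `⟨P, Q⟩² - ⟨P, P⟩ ⟨Q, Q⟩` a nonzero
constant, so that `m = ⟨P, P⟩ ⟨Q, Q⟩` is constant too. The Codazzi equations show that `⟨P, P⟩`
satisfies a homogeneous linear equation along `X₂`, and `⟨Q, Q⟩` one along `X₁`. If `m` were not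
zero, then both functions would satisfy such equations in all directions, and the integrability
conditions for `⟨P, P⟩` and for `P` would force the normal curvature to vanish
(`IsMovingFrame.m_eq_zero`). So the product of `⟨P, P⟩` and `⟨Q, Q⟩` is zero. As each factor is
either zero everywhere or zero nowhere on an integral curve of one of two transverse vector fields,
one of the two vanishes near any given point (`exists_nhds_eq_zero_or_eq_zero`); after exchanging
the null directions it is `⟨Q, Q⟩`.

Now the direction of `Q` is constant along `X₂`, the integrability condition for `Q` gives
`k = 2 / 3` (`IsMovingFrame.k_eq_of_null`), and a quotient of two components of `Q` is a function
`t` with `X₂ t = 0` and `X₁ t ≠ 0` (`IsMovingFrame.exists_dirDeriv_eq_zero`). With `τ = X₁ t` the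
null vector `τ² Q` is constant along `X₂`, hence a function of `t` alone: this is the curve `α`.
Differentiating twice with respect to `t` recovers first `X₂ y` and then `y` itself as
combinations of `α`, `α'`, `α''` (`IsMovingFrame.exists_isModelData`), with the required scalar
products and with coefficients given by a function `s` such that `(s, t)` are coordinates
(`IsModelData.exists_chart`). The isometry can be taken to be the identity.
-/

noncomputable section

namespace LorentzSurface

/-! ### The pseudo-Euclidean scalar product -/

lemma sp_comm (v w : E52) : sp v w = sp w v := by simp only [sp]; ring
lemma sp_add_left (u v w : E52) : sp (u + v) w = sp u w + sp v w := by
  simp only [sp, Pi.add_apply]; ring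
lemma sp_add_right (u v w : E52) : sp u (v + w) = sp u v + sp u w := by
  simp only [sp, Pi.add_apply]; ring
lemma sp_sub_left (u v w : E52) : sp (u - v) w = sp u w - sp v w := by
  simp only [sp, Pi.sub_apply]; ring
lemma sp_sub_right (u v w : E52) : sp u (v - w) = sp u v - sp u w := by
  simp only [sp, Pi.sub_apply]; ring
lemma sp_smul_left (c : ℝ) (v w : E52) : sp (c • v) w = c * sp v w := by
  simp only [sp, Pi.smul_apply, smul_eq_mul]; ring
lemma sp_smul_right (c : ℝ) (v w : E52) : sp v (c • w) = c * sp v w := by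
  simp only [sp, Pi.smul_apply, smul_eq_mul]; ring
lemma sp_zero_left (w : E52) : sp 0 w = 0 := by simp [sp]
lemma sp_zero_right (w : E52) : sp w 0 = 0 := by simp [sp]

lemma sp_sum_left {ι : Type*} (s : Finset ι) (f : ι → E52) (w : E52) :
    sp (∑ i ∈ s, f i) w = ∑ i ∈ s, sp (f i) w := by
  induction s using Finset.cons_induction with
  | empty => simp [sp_zero_left]
  | cons a s ha ih => simp [Finset.sum_cons, sp_add_left, ih]

/-- The scalar product as a continuous bilinear map. -/
def spL : E52 →L[ℝ] E52 →L[ℝ] ℝ :=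
  (LinearMap.mk₂ ℝ sp sp_add_left (fun c v w => by simp [sp_smul_left]) sp_add_right
    (fun c v w => by simp [sp_smul_right])).toContinuousBilinearMap

lemma spL_apply (v w : E52) : spL v w = sp v w := rfl

section Calculus

variable {E : Type*} [NormedAddCommGroup E] [NormedSpace ℝ E]

lemma fderiv_sp {f g : E → E52} {q : E} (hf : DifferentiableAt ℝ f q)
    (hg : DifferentiableAt ℝ g q) (v : E) :
    fderiv ℝ (fun p => sp (f p) (g p)) q v =
      sp (fderiv ℝ f q v) (g q) + sp (f q) (fderiv ℝ g q v) := by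
  have := (spL.hasFDerivAt_of_bilinear hf.hasFDerivAt hg.hasFDerivAt).fderiv
  have h2 := congrArg (fun L => L v) this
  simp only [spL_apply] at h2
  rw [h2]
  simp [spL_apply, add_comm]

lemma _root_.ContDiffOn.sp {n : WithTop ℕ∞} {f g : E → E52} {s : Set E} (hf : ContDiffOn ℝ n f s)
    (hg : ContDiffOn ℝ n g s) : ContDiffOn ℝ n (fun p => LorentzSurface.sp (f p) (g p)) s := by
  have hf' := contDiffOn_pi.1 hf
  have hg' := contDiffOn_pi.1 hg
  simp only [LorentzSurface.sp]
  exact (((((hf' 0).mul (hg' 0)).neg.sub ((hf' 1).mul (hg' 1))).add ((hf' 2).mul (hg' 2))).add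
    ((hf' 3).mul (hg' 3))).add ((hf' 4).mul (hg' 4))

lemma _root_.DifferentiableAt.sp {f g : E → E52} {q : E} (hf : DifferentiableAt ℝ f q)
    (hg : DifferentiableAt ℝ g q) : DifferentiableAt ℝ (fun p => LorentzSurface.sp (f p) (g p)) q :=
  (spL.hasFDerivAt_of_bilinear hf.hasFDerivAt hg.hasFDerivAt).differentiableAt

end Calculus

/-! ### Gram determinants -/

/-- The matrix of the scalar product in the standard basis. -/
def spMatrix : Matrix (Fin 5) (Fin 5) ℝ := Matrix.diagonal ![-1, -1, 1, 1, 1]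

lemma det_spMatrix : spMatrix.det = 1 := by
  simp [spMatrix, Matrix.det_diagonal, Fin.prod_univ_succ]

lemma mul_spMatrix_mul_transpose (A B : Fin 5 → E52) (i j : Fin 5) :
    (Matrix.of A * spMatrix * (Matrix.of B).transpose) i j = sp (A i) (B j) := by
  simp [spMatrix, Matrix.mul_apply, Fin.sum_univ_succ, Matrix.diagonal, sp]
  ring

/-- The product of two determinants is the determinant of the mutual scalar products. -/
lemma det_mul_det (A B : Fin 5 → E52) :
    (Matrix.of A).det * (Matrix.of B).det = (Matrix.of fun i j => sp (A i) (B j)).det := by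
  have : (Matrix.of fun i j => sp (A i) (B j)) =
      Matrix.of A * spMatrix * (Matrix.of B).transpose := by
    ext i j; rw [mul_spMatrix_mul_transpose]; rfl
  rw [this, Matrix.det_mul, Matrix.det_mul, det_spMatrix, Matrix.det_transpose]; ring

/-- A vector orthogonal to the rows of a nonsingular matrix vanishes. -/
lemma eq_zero_of_sp_eq_zero {A : Fin 5 → E52} (hA : (Matrix.of A).det ≠ 0) {w : E52}
    (hw : ∀ i, sp (A i) w = 0) : w = 0 := by
  have h1 : (Matrix.of A * spMatrix).mulVec w = 0 := by
    ext i
    rw [← Matrix.mulVec_mulVec, Pi.zero_apply, ← hw i]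
    simp [Matrix.mulVec, dotProduct, spMatrix, Fin.sum_univ_succ, Matrix.diagonal, sp]
    ring
  have h2 : (Matrix.of A * spMatrix).det ≠ 0 := by
    rw [Matrix.det_mul, det_spMatrix, mul_one]; exact hA
  exact Matrix.eq_zero_of_mulVec_eq_zero h2 h1

/-- The determinant of the matrix of mutual scalar products for two bases adapted to the same
splitting into a Lorentzian plane, a second plane and a unit vector. -/
lemma det_mul_det_of_adapted {E₁ E₂ u v u' v' y : E52} (h11 : sp E₁ E₁ = 0) (h22 : sp E₂ E₂ = 0)
    (h12 : sp E₁ E₂ = -1) (hy : sp y y = 1) (hy1 : sp E₁ y = 0) (hy2 : sp E₂ y = 0)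
    (hu1 : sp u E₁ = 0) (hu2 : sp u E₂ = 0) (huy : sp u y = 0)
    (hv1 : sp v E₁ = 0) (hv2 : sp v E₂ = 0) (hvy : sp v y = 0)
    (hu1' : sp u' E₁ = 0) (hu2' : sp u' E₂ = 0) (huy' : sp u' y = 0)
    (hv1' : sp v' E₁ = 0) (hv2' : sp v' E₂ = 0) (hvy' : sp v' y = 0) :
    (Matrix.of ![E₁, E₂, u, v, y]).det * (Matrix.of ![E₁, E₂, u', v', y]).det =
      sp u v' * sp v u' - sp u u' * sp v v' := by
  rw [det_mul_det]
  have : (Matrix.of fun i j => sp (![E₁, E₂, u, v, y] i) (![E₁, E₂, u', v', y] j)) =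
      !![0, -1, 0, 0, 0; -1, 0, 0, 0, 0; 0, 0, sp u u', sp u v', 0; 0, 0, sp v u', sp v v', 0;
        0, 0, 0, 0, 1] := by
    ext i j
    fin_cases i <;> fin_cases j <;>
      simp [*, sp_comm E₂ E₁, sp_comm y E₁, sp_comm y E₂, sp_comm E₁ u', sp_comm E₂ u',
        sp_comm y u', sp_comm E₁ v', sp_comm E₂ v', sp_comm y v']
  rw [this]
  simp [Matrix.det_succ_row_zero, Fin.sum_univ_succ, Fin.succAbove]
  ring

/-! ### Smooth functions on an open set of the plane -/

section Calculus

variable {E : Type*} [NormedAddCommGroup E] [NormedSpace ℝ E]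
  {F : Type*} [NormedAddCommGroup F] [NormedSpace ℝ F]

lemma differentiableAt_of_contDiffOn {f : E → F} {U : Set E} (hU : IsOpen U)
    (hf : ContDiffOn ℝ ∞ f U) {q : E} (hq : q ∈ U) : DifferentiableAt ℝ f q :=
  (hf.contDiffAt (hU.mem_nhds hq)).differentiableAt (by simp)

lemma fderiv_congr_of_isOpen {f g : E → F} {U : Set E} (hU : IsOpen U)
    (h : ∀ q ∈ U, f q = g q) {q : E} (hq : q ∈ U) : fderiv ℝ f q = fderiv ℝ g q :=
  Filter.EventuallyEq.fderiv_eq (Filter.eventuallyEq_of_mem (hU.mem_nhds hq) h)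

/-- The derivative `X f` of a function along a vector field. -/
def dirDeriv (X : E → E) (f : E → F) (q : E) : F := fderiv ℝ f q (X q)

lemma contDiffOn_dirDeriv {X : E → E} {f : E → F} {U : Set E} (hU : IsOpen U)
    (hf : ContDiffOn ℝ ∞ f U) (hX : ContDiffOn ℝ ∞ X U) : ContDiffOn ℝ ∞ (dirDeriv X f) U :=
  (hf.fderiv_of_isOpen hU (m := ∞) (by simp)).clm_apply hX

lemma dirDeriv_congr {X : E → E} {f g : E → F} {U : Set E} (hU : IsOpen U)
    (h : ∀ q ∈ U, f q = g q) {q : E} (hq : q ∈ U) : dirDeriv X f q = dirDeriv X g q := by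
  rw [dirDeriv, dirDeriv, fderiv_congr_of_isOpen hU h hq]

lemma dirDeriv_add {X : E → E} {f g : E → F} {q : E} (hf : DifferentiableAt ℝ f q)
    (hg : DifferentiableAt ℝ g q) :
    dirDeriv X (fun p => f p + g p) q = dirDeriv X f q + dirDeriv X g q := by
  simp [dirDeriv, fderiv_fun_add hf hg]

lemma dirDeriv_smul {X : E → E} {c : E → ℝ} {f : E → F} {q : E} (hc : DifferentiableAt ℝ c q)
    (hf : DifferentiableAt ℝ f q) :
    dirDeriv X (fun p => c p • f p) q = dirDeriv X c q • f q + c q • dirDeriv X f q := by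
  simp [dirDeriv, fderiv_fun_smul hc hf, add_comm]

lemma dirDeriv_mul {X : E → E} {f g : E → ℝ} {q : E} (hf : DifferentiableAt ℝ f q)
    (hg : DifferentiableAt ℝ g q) :
    dirDeriv X (fun p => f p * g p) q = dirDeriv X f q * g q + f q * dirDeriv X g q := by
  simp [dirDeriv, fderiv_fun_mul hf hg]; ring

lemma dirDeriv_sp {X : E → E} {f g : E → E52} {q : E} (hf : DifferentiableAt ℝ f q)
    (hg : DifferentiableAt ℝ g q) :
    dirDeriv X (fun p => sp (f p) (g p)) q =
      sp (dirDeriv X f q) (g q) + sp (f q) (dirDeriv X g q) :=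
  fderiv_sp hf hg _

lemma dirDeriv_const {X : E → E} (c : F) (q : E) : dirDeriv X (fun _ => c) q = 0 := by
  simp [dirDeriv]

end Calculus

lemma pd_eq_dirDeriv {F : Type*} [NormedAddCommGroup F] [NormedSpace ℝ F] (i : Fin 2)
    (f : Plane → F) : pd i f = dirDeriv (fun _ => EuclideanSpace.single i 1) f := rfl

lemma pd_congr {F : Type*} [NormedAddCommGroup F] [NormedSpace ℝ F] (i : Fin 2)
    {f g : Plane → F} {U : Set Plane} (hU : IsOpen U) (h : ∀ q ∈ U, f q = g q) {q : Plane}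
    (hq : q ∈ U) : pd i f q = pd i g q := by
  rw [pd, pd, fderiv_congr_of_isOpen hU h hq]

lemma contDiffOn_pd {F : Type*} [NormedAddCommGroup F] [NormedSpace ℝ F] (i : Fin 2)
    {f : Plane → F} {U : Set Plane} (hU : IsOpen U) (hf : ContDiffOn ℝ ∞ f U) :
    ContDiffOn ℝ ∞ (pd i f) U := contDiffOn_dirDeriv hU hf contDiffOn_const

lemma pd_comm {F : Type*} [NormedAddCommGroup F] [NormedSpace ℝ F] (i j : Fin 2)
    {f : Plane → F} {U : Set Plane} (hU : IsOpen U) (hf : ContDiffOn ℝ ∞ f U) {q : Plane}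
    (hq : q ∈ U) : pd i (pd j f) q = pd j (pd i f) q := by
  have h := VectorField.fderiv_apply_lieBracket (𝕜 := ℝ) (hf.contDiffAt (hU.mem_nhds hq))
    (by rw [minSmoothness_of_isRCLikeNormedField]; exact WithTop.coe_le_coe.2 le_top)
    (W := fun _ => EuclideanSpace.single j (1 : ℝ)) (V := fun _ => EuclideanSpace.single i (1 : ℝ))
    (differentiableAt_const _) (differentiableAt_const _)
  simp only [VectorField.lieBracket, fderiv_fun_const, Pi.zero_apply,
    zero_apply, sub_zero, map_zero] at h
  exact sub_eq_zero.1 h.symm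

/-! ### Local parametrizations of Lorentzian surfaces -/

/-- `y` is a local parametrization, defined on the open set `U` of the plane, of a Lorentzian
surface in `𝕊⁴₂(1)`. -/
structure IsLorentzPatch (U : Set Plane) (y : Plane → E52) : Prop where
  isOpen : IsOpen U
  smooth : ContDiffOn ℝ ∞ y U
  unit : ∀ q ∈ U, sp (y q) (y q) = 1
  lorentz : ∀ q ∈ U, (metric y q).det < 0

lemma metric_apply (y : Plane → E52) (q : Plane) (i j : Fin 2) :
    metric y q i j = sp (pd i y q) (pd j y q) := rfl

lemma metric_symm (y : Plane → E52) (q : Plane) (i j : Fin 2) :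
    metric y q i j = metric y q j i := sp_comm _ _

lemma metric_inv_symm (y : Plane → E52) (q : Plane) (i j : Fin 2) :
    (metric y q)⁻¹ i j = (metric y q)⁻¹ j i := by
  have : (metric y q).transpose = metric y q := by ext i j; exact metric_symm y q j i
  conv_lhs => rw [← this, ← Matrix.transpose_nonsing_inv, Matrix.transpose_apply]

/-- The Gauss formula. -/
lemma pd_pd_eq (y : Plane → E52) (i j : Fin 2) (q : Plane) :
    pd i (pd j y) q = secondForm y i j q - metric y q i j • y q
      + ∑ k, christoffel y k i j q • pd k y q := by
  rw [secondForm]; abel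

lemma normalPart_eq_self {y : Plane → E52} {q : Plane} {w : E52} (hw : ∀ i, sp w (pd i y q) = 0)
    (hw' : sp w (y q) = 0) : normalPart y q w = w := by
  simp [normalPart, hw, hw']

lemma normalPart_add (y : Plane → E52) (q : Plane) (v w : E52) :
    normalPart y q (v + w) = normalPart y q v + normalPart y q w := by
  simp only [normalPart, sp_add_left, Fin.sum_univ_two]; module

lemma normalPart_sub (y : Plane → E52) (q : Plane) (v w : E52) :
    normalPart y q (v - w) = normalPart y q v - normalPart y q w := by
  simp only [normalPart, sp_sub_left, Fin.sum_univ_two]; module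

lemma normalPart_smul (y : Plane → E52) (q : Plane) (c : ℝ) (w : E52) :
    normalPart y q (c • w) = c • normalPart y q w := by
  simp only [normalPart, sp_smul_left, Fin.sum_univ_two]; module

namespace IsLorentzPatch

variable {U : Set Plane} {y : Plane → E52} (hy : IsLorentzPatch U y)
include hy

lemma contDiffOn_pd (i : Fin 2) : ContDiffOn ℝ ∞ (pd i y) U :=
  LorentzSurface.contDiffOn_pd i hy.isOpen hy.smooth

lemma contDiffOn_metric (i j : Fin 2) : ContDiffOn ℝ ∞ (fun q => metric y q i j) U :=
  (hy.contDiffOn_pd i).sp (hy.contDiffOn_pd j)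

lemma contDiffOn_det : ContDiffOn ℝ ∞ (fun q => (metric y q).det) U := by
  simp only [Matrix.det_fin_two]
  exact ((hy.contDiffOn_metric 0 0).mul (hy.contDiffOn_metric 1 1)).sub
    ((hy.contDiffOn_metric 0 1).mul (hy.contDiffOn_metric 1 0))

lemma contDiffOn_metric_inv (i j : Fin 2) : ContDiffOn ℝ ∞ (fun q => (metric y q)⁻¹ i j) U := by
  have h : ∀ i j, ContDiffOn ℝ ∞ (fun q => (metric y q).adjugate i j) U := by
    intro i j
    simp only [Matrix.adjugate_fin_two]
    fin_cases i <;> fin_cases j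
    · exact hy.contDiffOn_metric 1 1
    · exact (hy.contDiffOn_metric 0 1).neg
    · exact (hy.contDiffOn_metric 1 0).neg
    · exact hy.contDiffOn_metric 0 0
  simp only [Matrix.inv_def, Ring.inverse_eq_inv', Matrix.smul_apply, smul_eq_mul]
  exact (hy.contDiffOn_det.inv fun q hq => (hy.lorentz q hq).ne).mul (h i j)

lemma contDiffOn_christoffel (k i j : Fin 2) : ContDiffOn ℝ ∞ (christoffel y k i j) U := by
  have h : ∀ i j l, ContDiffOn ℝ ∞ (pd i fun p => metric y p j l) U := fun i j l =>
    LorentzSurface.contDiffOn_pd i hy.isOpen (hy.contDiffOn_metric j l)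
  refine contDiffOn_const.mul (ContDiffOn.sum fun l _ => (hy.contDiffOn_metric_inv k l).mul ?_)
  exact ((h i j l).add (h j i l)).sub (h l i j)

lemma contDiffOn_secondForm (i j : Fin 2) : ContDiffOn ℝ ∞ (secondForm y i j) U := by
  refine ((LorentzSurface.contDiffOn_pd i hy.isOpen (hy.contDiffOn_pd j)).add
    ((hy.contDiffOn_metric i j).smul hy.smooth)).sub (ContDiffOn.sum fun k _ => ?_)
  exact (hy.contDiffOn_christoffel k i j).smul (hy.contDiffOn_pd k)

lemma inv_mul {q : Plane} (hq : q ∈ U) : (metric y q)⁻¹ * metric y q = 1 :=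
  Matrix.nonsing_inv_mul _ (hy.lorentz q hq).ne.isUnit

lemma differentiableAt {q : Plane} (hq : q ∈ U) : DifferentiableAt ℝ y q :=
  differentiableAt_of_contDiffOn hy.isOpen hy.smooth hq

lemma differentiableAt_pd (i : Fin 2) {q : Plane} (hq : q ∈ U) : DifferentiableAt ℝ (pd i y) q :=
  differentiableAt_of_contDiffOn hy.isOpen (hy.contDiffOn_pd i) hq

lemma pd_pd_comm (i j : Fin 2) {q : Plane} (hq : q ∈ U) : pd i (pd j y) q = pd j (pd i y) q :=
  pd_comm i j hy.isOpen hy.smooth hq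

lemma sp_pd_self (i : Fin 2) {q : Plane} (hq : q ∈ U) : sp (pd i y q) (y q) = 0 := by
  have h := fderiv_congr_of_isOpen hy.isOpen (g := fun _ => (1 : ℝ)) hy.unit hq
  have h2 := fderiv_sp (hy.differentiableAt hq) (hy.differentiableAt hq)
    (EuclideanSpace.single i 1)
  rw [h, sp_comm (y q)] at h2
  simp only [fderiv_fun_const, Pi.zero_apply, zero_apply] at h2
  change 0 = sp (pd i y q) (y q) + sp (pd i y q) (y q) at h2
  linarith

lemma sp_pd_pd_self (i j : Fin 2) {q : Plane} (hq : q ∈ U) :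
    sp (pd i (pd j y) q) (y q) = -metric y q i j := by
  have h := fderiv_congr_of_isOpen hy.isOpen (g := fun _ => (0 : ℝ))
    (fun q hq => hy.sp_pd_self j hq) hq
  have h2 := fderiv_sp (hy.differentiableAt_pd j hq) (hy.differentiableAt hq)
    (EuclideanSpace.single i 1)
  rw [h, sp_comm (pd j y q)] at h2
  simp only [fderiv_fun_const, Pi.zero_apply, zero_apply] at h2
  change 0 = sp (pd i (pd j y) q) (y q) + metric y q i j at h2
  linarith

lemma pd_metric (l i j : Fin 2) {q : Plane} (hq : q ∈ U) :
    pd l (fun p => metric y p i j) q =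
      sp (pd l (pd i y) q) (pd j y q) + sp (pd i y q) (pd l (pd j y) q) :=
  fderiv_sp (hy.differentiableAt_pd i hq) (hy.differentiableAt_pd j hq) _

lemma christoffel_eq (k i j : Fin 2) {q : Plane} (hq : q ∈ U) :
    christoffel y k i j q = ∑ l, (metric y q)⁻¹ k l * sp (pd i (pd j y) q) (pd l y q) := by
  rw [christoffel, Finset.mul_sum]
  refine Finset.sum_congr rfl fun l _ => ?_
  rw [hy.pd_metric _ _ _ hq, hy.pd_metric _ _ _ hq, hy.pd_metric _ _ _ hq,
    hy.pd_pd_comm j i hq, hy.pd_pd_comm l i hq, hy.pd_pd_comm l j hq,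
    sp_comm (pd j y q), sp_comm (pd i y q)]
  ring

lemma sp_pd_pd_pd (i j l : Fin 2) {q : Plane} (hq : q ∈ U) :
    sp (pd i (pd j y) q) (pd l y q) = ∑ k, christoffel y k i j q * metric y q k l := by
  have h := hy.inv_mul hq
  have e : ∀ m, ∑ k, (metric y q)⁻¹ m k * metric y q k l = (1 : Matrix (Fin 2) (Fin 2) ℝ) m l :=
    fun m => by rw [← h, Matrix.mul_apply]
  simp only [hy.christoffel_eq _ _ _ hq, Finset.sum_mul]
  rw [Finset.sum_comm]
  have : ∀ m, ∑ k, (metric y q)⁻¹ k m * sp (pd i (pd j y) q) (pd m y q) * metric y q k l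
      = sp (pd i (pd j y) q) (pd m y q) * (1 : Matrix (Fin 2) (Fin 2) ℝ) m l := by
    intro m
    rw [← e m, Finset.mul_sum]
    refine Finset.sum_congr rfl fun k _ => ?_
    rw [metric_inv_symm y q k m]; ring
  simp [this, Matrix.one_apply]

lemma sp_secondForm_pd (i j l : Fin 2) {q : Plane} (hq : q ∈ U) :
    sp (secondForm y i j q) (pd l y q) = 0 := by
  rw [secondForm, sp_sub_left, sp_add_left, sp_smul_left, sp_comm (y q), hy.sp_pd_self l hq,
    sp_sum_left, hy.sp_pd_pd_pd i j l hq]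
  simp [sp_smul_left, metric_apply]

lemma sp_secondForm_self (i j : Fin 2) {q : Plane} (hq : q ∈ U) :
    sp (secondForm y i j q) (y q) = 0 := by
  rw [secondForm, sp_sub_left, sp_add_left, sp_smul_left, hy.unit q hq,
    sp_sum_left, hy.sp_pd_pd_self i j hq]
  simp [sp_smul_left, hy.sp_pd_self _ hq]

lemma secondForm_symm (i j : Fin 2) {q : Plane} (hq : q ∈ U) :
    secondForm y i j q = secondForm y j i q := by
  have : ∀ k, christoffel y k i j q = christoffel y k j i q := fun k => by
    simp only [hy.christoffel_eq _ _ _ hq, hy.pd_pd_comm i j hq]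
  simp only [secondForm, this, hy.pd_pd_comm i j hq, metric_symm y q i j]

/-- The Gauss equation. -/
lemma gaussCurvature_eq {q : Plane} (hq : q ∈ U) :
    gaussCurvature y q = 1 + (sp (secondForm y 0 0 q) (secondForm y 1 1 q)
      - sp (secondForm y 0 1 q) (secondForm y 0 1 q)) / (metric y q).det := by
  have hΓ : ∀ k i j, DifferentiableAt ℝ (christoffel y k i j) q := fun k i j =>
    differentiableAt_of_contDiffOn hy.isOpen (hy.contDiffOn_christoffel k i j) hq
  have hg : ∀ i j, DifferentiableAt ℝ (fun q => metric y q i j) q := fun i j =>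
    differentiableAt_of_contDiffOn hy.isOpen (hy.contDiffOn_metric i j) hq
  have hpp : ∀ i j, DifferentiableAt ℝ (pd i (pd j y)) q := fun i j =>
    differentiableAt_of_contDiffOn hy.isOpen
      (LorentzSurface.contDiffOn_pd i hy.isOpen (hy.contDiffOn_pd j)) hq
  -- the derivative `∂ᵢ ⟨∂ⱼ ∂ₖ y, ∂ₘ y⟩` computed in two ways
  have key : ∀ i j k m, sp (pd i (pd j (pd k y)) q) (pd m y q)
      + sp (pd j (pd k y) q) (pd i (pd m y) q) =
      ∑ l, (pd i (christoffel y l j k) q * metric y q l m + christoffel y l j k q *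
        (sp (pd i (pd l y) q) (pd m y q) + sp (pd l y q) (pd i (pd m y) q))) := by
    intro i j k m
    have h1 := fderiv_sp (hpp j k) (hy.differentiableAt_pd m hq) (EuclideanSpace.single i 1)
    rw [fderiv_congr_of_isOpen hy.isOpen (fun q hq => hy.sp_pd_pd_pd j k m hq) hq] at h1
    refine h1.symm.trans ?_
    change pd i (fun q => ∑ l, christoffel y l j k q * metric y q l m) q = _
    simp only [Fin.sum_univ_two]
    rw [pd_eq_dirDeriv, dirDeriv_add ((hΓ _ _ _).fun_mul (hg _ _)) ((hΓ _ _ _).fun_mul (hg _ _)),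
      dirDeriv_mul (hΓ _ _ _) (hg _ _), dirDeriv_mul (hΓ _ _ _) (hg _ _)]
    simp only [← pd_eq_dirDeriv, hy.pd_metric _ _ _ hq]
  have h3 : pd 0 (pd 1 (pd 1 y)) q = pd 1 (pd 0 (pd 1 y)) q :=
    pd_comm 0 1 hy.isOpen (hy.contDiffOn_pd 1) hq
  have k1 := key 0 1 1 0
  have k2 := key 1 0 1 0
  rw [h3] at k1
  -- scalar products of second derivatives, through the Gauss formula
  have hh : ∀ i j k l, sp (pd i (pd j y) q) (pd k (pd l y) q) =
      sp (secondForm y i j q) (secondForm y k l q) + metric y q i j * metric y q k l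
      + ∑ m, christoffel y m k l q * ∑ n, christoffel y n i j q * metric y q n m := by
    intro i j k l
    conv_lhs => rw [pd_pd_eq y k l q]
    simp only [Fin.sum_univ_two, sp_add_right, sp_sub_right, sp_smul_right, hy.sp_pd_pd_self i j hq,
      hy.sp_pd_pd_pd i j _ hq]
    conv_lhs => rw [pd_pd_eq y i j q]
    simp only [Fin.sum_univ_two, sp_add_left, sp_sub_left, sp_smul_left,
      sp_comm (y q), hy.sp_secondForm_self k l hq, sp_comm (pd _ y q), hy.sp_secondForm_pd k l _ hq]
    ring
  have hd := (hy.lorentz q hq).ne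
  rw [gaussCurvature, div_eq_iff hd, add_mul, div_mul_cancel₀ _ hd]
  simp only [sp_comm (pd _ y q) (pd _ (pd _ y) q)] at k1 k2
  simp only [hh, hy.sp_pd_pd_pd _ _ _ hq, Fin.sum_univ_two] at k1 k2
  simp only [Fin.sum_univ_two, curvatureCoeff, Matrix.det_fin_two, hy.secondForm_symm 1 0 hq,
    metric_symm y q 1 0] at k1 k2 ⊢
  rw [sp_comm (secondForm y 0 0 q)]
  linear_combination k2 - k1

/-! ### The normal connection -/

lemma normalPart_pd {q : Plane} (hq : q ∈ U) (i : Fin 2) : normalPart y q (pd i y q) = 0 := by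
  have h := hy.inv_mul hq
  have e : ∀ l, ∑ k, (metric y q)⁻¹ k l * sp (pd i y q) (pd k y q) =
      (1 : Matrix (Fin 2) (Fin 2) ℝ) l i := by
    intro l
    rw [← h, Matrix.mul_apply]
    refine Finset.sum_congr rfl fun k _ => ?_
    rw [metric_inv_symm y q k l, metric_apply, sp_comm]
  rw [normalPart, hy.sp_pd_self i hq, Finset.sum_comm]
  simp only [← Finset.sum_smul, e]
  simp [Matrix.one_apply]

lemma normalPart_self {q : Plane} (hq : q ∈ U) : normalPart y q (y q) = 0 := by
  simp [normalPart, hy.unit q hq, sp_comm (y q) (pd _ y q), hy.sp_pd_self _ hq]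

lemma normalPart_pd_pd {q : Plane} (hq : q ∈ U) (i j : Fin 2) :
    normalPart y q (pd i (pd j y) q) = secondForm y i j q := by
  rw [pd_pd_eq, normalPart_add, normalPart_sub, normalPart_smul,
    hy.normalPart_self hq, normalPart_eq_self (fun l => hy.sp_secondForm_pd i j l hq)
    (hy.sp_secondForm_self i j hq), Fin.sum_univ_two, normalPart_add, normalPart_smul,
    normalPart_smul, hy.normalPart_pd hq, hy.normalPart_pd hq]
  simp

lemma sp_normalPart_self {q : Plane} (hq : q ∈ U) (w : E52) : sp (normalPart y q w) (y q) = 0 := by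
  simp only [normalPart, sp_sub_left, sp_sum_left, sp_smul_left, hy.unit q hq, hy.sp_pd_self _ hq]
  simp

lemma sp_normalPart_pd {q : Plane} (hq : q ∈ U) (w : E52) (i : Fin 2) :
    sp (normalPart y q w) (pd i y q) = 0 := by
  have h := hy.inv_mul hq
  have e : ∀ k, ∑ l, (metric y q)⁻¹ k l * sp (pd l y q) (pd i y q) =
      (1 : Matrix (Fin 2) (Fin 2) ℝ) k i := fun k => by rw [← h, Matrix.mul_apply]; rfl
  have e2 : ∀ k, ∑ l, (metric y q)⁻¹ k l * sp w (pd k y q) * sp (pd l y q) (pd i y q) =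
      sp w (pd k y q) * (1 : Matrix (Fin 2) (Fin 2) ℝ) k i := fun k => by
    rw [← e, Finset.mul_sum]; exact Finset.sum_congr rfl fun l _ => by ring
  simp only [normalPart, sp_sub_left, sp_sum_left, sp_smul_left, sp_comm (y q),
    hy.sp_pd_self _ hq, e2]
  simp [Matrix.one_apply]

lemma contDiffOn_normalPart {η : Plane → E52} (hη : ContDiffOn ℝ ∞ η U) :
    ContDiffOn ℝ ∞ (fun q => normalPart y q (η q)) U := by
  refine (hη.sub (ContDiffOn.sum fun k _ => ContDiffOn.sum fun l _ => ?_)).sub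
    ((hη.sp hy.smooth).smul hy.smooth)
  exact ((hy.contDiffOn_metric_inv k l).mul (hη.sp (hy.contDiffOn_pd k))).smul (hy.contDiffOn_pd l)

/-- The Weingarten formula for a normal vector field. -/
lemma normalDeriv_eq {ξ : Plane → E52} (hξ : ContDiffOn ℝ ∞ ξ U)
    (h1 : ∀ q ∈ U, ∀ i, sp (ξ q) (pd i y q) = 0) (h2 : ∀ q ∈ U, sp (ξ q) (y q) = 0) (j : Fin 2)
    {q : Plane} (hq : q ∈ U) :
    normalDeriv y j ξ q = pd j ξ q + ∑ l, (∑ k, (metric y q)⁻¹ k l *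
      sp (ξ q) (secondForm y j k q)) • pd l y q := by
  have d := differentiableAt_of_contDiffOn hy.isOpen hξ hq
  have e1 : ∀ k, sp (pd j ξ q) (pd k y q) = -sp (ξ q) (secondForm y j k q) := by
    intro k
    have h := fderiv_congr_of_isOpen hy.isOpen (g := fun _ => (0 : ℝ)) (fun q hq => h1 q hq k) hq
    have h' := fderiv_sp d (hy.differentiableAt_pd k hq) (EuclideanSpace.single j 1)
    rw [h] at h'
    simp only [fderiv_fun_const, Pi.zero_apply, zero_apply] at h'
    change 0 = sp (pd j ξ q) (pd k y q) + sp (ξ q) (pd j (pd k y) q) at h'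
    rw [pd_pd_eq y j k q, Fin.sum_univ_two] at h'
    simp only [sp_add_right, sp_sub_right, sp_smul_right, h1 q hq, h2 q hq] at h'
    linarith
  have e2 : sp (pd j ξ q) (y q) = 0 := by
    have h := fderiv_congr_of_isOpen hy.isOpen (g := fun _ => (0 : ℝ)) (fun q hq => h2 q hq) hq
    have h' := fderiv_sp d (hy.differentiableAt hq) (EuclideanSpace.single j 1)
    rw [h] at h'
    simp only [fderiv_fun_const, Pi.zero_apply, zero_apply] at h'
    change 0 = sp (pd j ξ q) (y q) + sp (ξ q) (pd j y q) at h'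
    rw [h1 q hq] at h'
    linarith
  simp only [normalDeriv, normalPart, e1, e2, Fin.sum_univ_two]
  module

/-- The Ricci equation. -/
lemma normalCurvatureTensor_eq (i j : Fin 2) {q : Plane} (hq : q ∈ U) {w : E52}
    (h1 : ∀ i, sp w (pd i y q) = 0) (h2 : sp w (y q) = 0) :
    normalCurvatureTensor y i j w q = ∑ k, ∑ l, (metric y q)⁻¹ k l •
      (sp w (secondForm y j k q) • secondForm y i l q
        - sp w (secondForm y i k q) • secondForm y j l q) := by
  set ξ : Plane → E52 := fun p => normalPart y p w
  have hξ : ContDiffOn ℝ ∞ ξ U := hy.contDiffOn_normalPart contDiffOn_const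
  have hξq : ξ q = w := normalPart_eq_self h1 h2
  have hc : ∀ j l, ContDiffOn ℝ ∞ (fun q => ∑ k, (metric y q)⁻¹ k l *
      sp (ξ q) (secondForm y j k q)) U := fun j l => ContDiffOn.sum fun k _ =>
    (hy.contDiffOn_metric_inv k l).mul (hξ.sp (hy.contDiffOn_secondForm j k))
  have main : ∀ i j, normalDeriv y i (normalDeriv y j ξ) q =
      normalPart y q (pd i (pd j ξ) q) + ∑ l, (∑ k, (metric y q)⁻¹ k l *
      sp w (secondForm y j k q)) • secondForm y i l q := by
    intro i j
    have dd : ∀ l, DifferentiableAt ℝ (fun q : Plane => ∑ k, (metric y q)⁻¹ k l *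
      sp (ξ q) (secondForm y j k q)) q := fun l =>
        differentiableAt_of_contDiffOn hy.isOpen (hc j l) hq
    have ds : ∀ l, DifferentiableAt ℝ (fun q : Plane => (∑ k, (metric y q)⁻¹ k l *
      sp (ξ q) (secondForm y j k q)) • pd l y q) q := fun l =>
        (dd l).fun_smul (hy.differentiableAt_pd l hq)
    have e : pd i (normalDeriv y j ξ) q = dirDeriv (fun _ => EuclideanSpace.single i 1)
        (fun q => pd j ξ q + ((∑ k, (metric y q)⁻¹ k 0 *
      sp (ξ q) (secondForm y j k q)) • pd 0 y q + (∑ k, (metric y q)⁻¹ k 1 *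
      sp (ξ q) (secondForm y j k q)) • pd 1 y q)) q := by
      rw [pd_eq_dirDeriv]
      refine dirDeriv_congr (F := E52) hy.isOpen (fun p hp => ?_) hq
      rw [hy.normalDeriv_eq hξ (fun q hq => hy.sp_normalPart_pd hq w)
        (fun q hq => hy.sp_normalPart_self hq w) j hp]
      congr 1
      exact Fin.sum_univ_two _
    rw [normalDeriv, e, dirDeriv_add
      (differentiableAt_of_contDiffOn hy.isOpen (LorentzSurface.contDiffOn_pd j hy.isOpen hξ) hq)
      ((ds 0).fun_add (ds 1)), dirDeriv_add (ds 0) (ds 1), dirDeriv_smul (dd 0)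
        (hy.differentiableAt_pd 0 hq), dirDeriv_smul (dd 1) (hy.differentiableAt_pd 1 hq),
        Fin.sum_univ_two (f := fun l => (∑ k, (metric y q)⁻¹ k l *
          sp w (secondForm y j k q)) • secondForm y i l q)]
    simp only [← pd_eq_dirDeriv, normalPart_add, normalPart_smul, hy.normalPart_pd hq,
      hy.normalPart_pd_pd hq, hξq]
    simp
  rw [normalCurvatureTensor, main, main, pd_comm i j hy.isOpen hξ hq]
  simp only [Fin.sum_univ_two]
  module

end IsLorentzPatch

/-! ### Null frames at a point -/

/-- The second fundamental form evaluated on the tangent vectors with coordinates `a`, `b`. -/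
def secondFormVec (y : Plane → E52) (q : Plane) (a b : Fin 2 → ℝ) : E52 :=
  ∑ i, ∑ j, (a i * b j) • secondForm y i j q

/-- The tangent vectors with coordinates `a`, `b` are null, with scalar product `-1`. -/
structure IsNullFrame (y : Plane → E52) (q : Plane) (a b : Fin 2 → ℝ) : Prop where
  h11 : sp (tangentVec y q a) (tangentVec y q a) = 0
  h22 : sp (tangentVec y q b) (tangentVec y q b) = 0
  h12 : sp (tangentVec y q a) (tangentVec y q b) = -1

/-- For a null frame, this is the normal curvature; see
`IsLorentzPatch.normalCurvature_eq_frameDet`. -/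
def frameDet (y : Plane → E52) (q : Plane) (a b : Fin 2 → ℝ) : ℝ :=
  (Matrix.of ![tangentVec y q a, tangentVec y q b, secondFormVec y q a a, secondFormVec y q b b,
    y q]).det

lemma sp_tangentVec (y : Plane → E52) (q : Plane) (a b : Fin 2 → ℝ) :
    sp (tangentVec y q a) (tangentVec y q b) = a 0 * b 0 * metric y q 0 0
      + a 0 * b 1 * metric y q 0 1 + a 1 * b 0 * metric y q 1 0 + a 1 * b 1 * metric y q 1 1 := by
  simp only [tangentVec, Fin.sum_univ_two, sp_add_left, sp_add_right, sp_smul_left, sp_smul_right,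
    metric_apply]
  ring

lemma IsNullFrame.swap {y : Plane → E52} {q : Plane} {a b : Fin 2 → ℝ} (h : IsNullFrame y q a b) :
    IsNullFrame y q b a := ⟨h.h22, h.h11, by rw [sp_comm, h.h12]⟩

lemma IsNullFrame.inv_metric {y : Plane → E52} {q : Plane} {a b : Fin 2 → ℝ}
    (h : IsNullFrame y q a b) (i j : Fin 2) :
    (metric y q)⁻¹ i j = -(a i * b j + b i * a j) := by
  have h11 := h.h11
  have h12 := h.h12
  have h22 := h.h22
  have h21 := h.swap.h12
  rw [sp_tangentVec] at h11 h12 h22 h21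
  set C : Matrix (Fin 2) (Fin 2) ℝ := !![a 0, a 1; b 0, b 1]
  set J : Matrix (Fin 2) (Fin 2) ℝ := !![0, -1; -1, 0]
  have e1 : C * metric y q * C.transpose = J := by
    ext i j
    fin_cases i <;> fin_cases j <;>
      simp [C, J, Matrix.mul_apply, Fin.sum_univ_two, Matrix.vecMul, dotProduct]
    · linear_combination h11
    · linear_combination h12
    · linear_combination h21
    · linear_combination h22
  have e2 : J * J = 1 := by
    ext i j; fin_cases i <;> fin_cases j <;> simp [J, Matrix.mul_apply, Fin.sum_univ_two]
  have e3 : (J * C * metric y q) * C.transpose = 1 := by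
    rw [← e2]; nth_rewrite 3 [← e1]; simp only [Matrix.mul_assoc]
  have e4 : (C.transpose * J * C) * metric y q = 1 := by
    rw [← mul_eq_one_comm.1 e3]; simp only [Matrix.mul_assoc]
  rw [Matrix.inv_eq_left_inv e4]
  fin_cases i <;> fin_cases j <;>
    simp [C, J, Matrix.mul_apply, Fin.sum_univ_two]

lemma IsNullFrame.det_metric {y : Plane → E52} {q : Plane} {a b : Fin 2 → ℝ}
    (h : IsNullFrame y q a b) : (metric y q).det * (a 0 * b 1 - a 1 * b 0) ^ 2 = -1 := by
  have h11 := h.h11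
  have h12 := h.h12
  have h22 := h.h22
  have h21 := h.swap.h12
  rw [sp_tangentVec] at h11 h12 h22 h21
  rw [Matrix.det_fin_two]
  have : (metric y q 0 0 * metric y q 1 1 - metric y q 0 1 * metric y q 1 0)
      * (a 0 * b 1 - a 1 * b 0) ^ 2 =
    (a 0 * a 0 * metric y q 0 0 + a 0 * a 1 * metric y q 0 1 + a 1 * a 0 * metric y q 1 0
      + a 1 * a 1 * metric y q 1 1) * (b 0 * b 0 * metric y q 0 0 + b 0 * b 1 * metric y q 0 1
      + b 1 * b 0 * metric y q 1 0 + b 1 * b 1 * metric y q 1 1)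
    - (a 0 * b 0 * metric y q 0 0 + a 0 * b 1 * metric y q 0 1 + a 1 * b 0 * metric y q 1 0
      + a 1 * b 1 * metric y q 1 1) * (b 0 * a 0 * metric y q 0 0 + b 0 * a 1 * metric y q 0 1
      + b 1 * a 0 * metric y q 1 0 + b 1 * a 1 * metric y q 1 1) := by ring
  rw [this, h11, h12, h21]; ring

/-- The coefficients of a pair of null vectors with scalar product `-1` in a Lorentzian plane whose
metric has the matrix entries `p`, `r`, `s` and determinant `-δ²`. -/
lemma nullPair_identities {p r s δ : ℝ} (hδ : δ ^ 2 = r ^ 2 - p * s) (h0 : δ ≠ 0)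
    (h1 : δ - r ≠ 0) :
    (δ - r) * (δ - r) * p + 2 * ((δ - r) * p) * r + p * p * s = 0 ∧
    s / (2 * (δ - r) * δ ^ 2) * (s / (2 * (δ - r) * δ ^ 2)) * p
      + 2 * (s / (2 * (δ - r) * δ ^ 2) * ((δ - r) / (2 * (δ - r) * δ ^ 2))) * r
      + (δ - r) / (2 * (δ - r) * δ ^ 2) * ((δ - r) / (2 * (δ - r) * δ ^ 2)) * s = 0 ∧
    (δ - r) * (s / (2 * (δ - r) * δ ^ 2)) * p
      + ((δ - r) * ((δ - r) / (2 * (δ - r) * δ ^ 2)) + p * (s / (2 * (δ - r) * δ ^ 2))) * r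
      + p * ((δ - r) / (2 * (δ - r) * δ ^ 2)) * s = -1 := by
  refine ⟨by linear_combination p * hδ, ?_, ?_⟩
  · field_simp
    linear_combination s * hδ
  · field_simp
    linear_combination (2 * δ - r) * hδ

lemma exists_root {p r s : ℝ} (h : p * s - r ^ 2 < 0) :
    ∃ ε : ℝ, ε ^ 2 = 1 ∧ ε * √(r ^ 2 - p * s) - r ≠ 0 := by
  have hs : 0 < √(r ^ 2 - p * s) := Real.sqrt_pos.2 (by linarith)
  rcases le_or_gt r 0 with hr | hr
  · exact ⟨1, by norm_num, by nlinarith⟩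
  · exact ⟨-1, by norm_num, by nlinarith⟩

namespace IsLorentzPatch

variable {U : Set Plane} {y : Plane → E52} (hy : IsLorentzPatch U y) {q : Plane} (hq : q ∈ U)
  {a b : Fin 2 → ℝ}
include hy hq

lemma sp_tangentVec_self (a : Fin 2 → ℝ) : sp (tangentVec y q a) (y q) = 0 := by
  simp [tangentVec, sp_add_left, sp_smul_left, hy.sp_pd_self _ hq]

lemma sp_secondFormVec_self (a b : Fin 2 → ℝ) : sp (secondFormVec y q a b) (y q) = 0 := by
  simp [secondFormVec, sp_add_left, sp_smul_left, hy.sp_secondForm_self _ _ hq]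

lemma sp_secondFormVec_pd (a b : Fin 2 → ℝ) (i : Fin 2) :
    sp (secondFormVec y q a b) (pd i y q) = 0 := by
  simp [secondFormVec, sp_add_left, sp_smul_left, hy.sp_secondForm_pd _ _ _ hq]

lemma sp_secondFormVec_tangentVec (a b c : Fin 2 → ℝ) :
    sp (secondFormVec y q a b) (tangentVec y q c) = 0 := by
  simp [tangentVec, sp_add_right, sp_smul_right, hy.sp_secondFormVec_pd hq]

lemma meanCurvature_eq (h : IsNullFrame y q a b) :
    meanCurvature y q = -secondFormVec y q a b := by
  simp only [meanCurvature, secondFormVec, h.inv_metric, Fin.sum_univ_two,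
    hy.secondForm_symm 1 0 hq]
  module

lemma gaussCurvature_eq_nullFrame (h : IsNullFrame y q a b) :
    gaussCurvature y q = 1 - sp (secondFormVec y q a a) (secondFormVec y q b b)
      + sp (secondFormVec y q a b) (secondFormVec y q a b) := by
  have hd := h.det_metric
  have hd0 := (hy.lorentz q hq).ne
  rw [hy.gaussCurvature_eq hq]
  have : (1 : ℝ) / (metric y q).det = -(a 0 * b 1 - a 1 * b 0) ^ 2 := by
    field_simp; linarith
  rw [div_eq_mul_one_div, this]
  simp only [secondFormVec, Fin.sum_univ_two, hy.secondForm_symm 1 0 hq, sp_add_left, sp_add_right,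
    sp_smul_left, sp_smul_right, sp_comm (secondForm y 1 1 q) (secondForm y 0 0 q),
    sp_comm (secondForm y 1 1 q) (secondForm y 0 1 q),
    sp_comm (secondForm y 0 1 q) (secondForm y 0 0 q)]
  ring

lemma normalCurvature_eq_frameDet {f₃ f₄ : E52} (h : IsFrame y q a b f₃ f₄) :
    normalCurvature y q a b f₃ f₄ = frameDet y q a b := by
  have hn : IsNullFrame y q a b := ⟨h.h11, h.h22, h.h12⟩
  have n3 : ∀ c, sp f₃ (tangentVec y q c) = 0 := fun c => by
    simp [tangentVec, sp_add_right, sp_smul_right, h.normal₃.1]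
  have n4 : ∀ c, sp f₄ (tangentVec y q c) = 0 := fun c => by
    simp [tangentVec, sp_add_right, sp_smul_right, h.normal₄.1]
  have hyy := hy.unit q hq
  have ht := hy.sp_tangentVec_self hq
  have hs := hy.sp_secondFormVec_self hq
  have hst := hy.sp_secondFormVec_tangentVec hq
  -- the determinant of the frame is `1`, since its square is
  have e1 := det_mul_det_of_adapted h.h11 h.h22 h.h12 hyy (ht a) (ht b) (n3 a) (n3 b) h.normal₃.2
    (n4 a) (n4 b) h.normal₄.2 (n3 a) (n3 b) h.normal₃.2 (n4 a) (n4 b) h.normal₄.2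
  rw [h.h33, h.h44, sp_comm f₄, h.h34] at e1
  have e2 : (Matrix.of ![tangentVec y q a, tangentVec y q b, f₃, f₄, y q]).det = 1 := by
    nlinarith [h.positive]
  have e3 := det_mul_det_of_adapted h.h11 h.h22 h.h12 hyy (ht a) (ht b) (hst a a a) (hst a a b)
    (hs a a) (hst b b a) (hst b b b) (hs b b) (n3 a) (n3 b) h.normal₃.2 (n4 a) (n4 b) h.normal₄.2
  rw [e2, mul_one] at e3
  rw [frameDet, e3]
  simp only [normalCurvature, Fin.sum_univ_two, sp_add_left, sp_smul_left, sp_sub_left,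
    hy.normalCurvatureTensor_eq _ _ hq h.normal₃.1 h.normal₃.2, hn.inv_metric, secondFormVec,
    hy.secondForm_symm 1 0 hq, sp_comm (secondForm y _ _ q) f₃, sp_comm (secondForm y _ _ q) f₄]
  ring

lemma frameDet_sq (h : IsNullFrame y q a b) : frameDet y q a b ^ 2 =
    sp (secondFormVec y q a a) (secondFormVec y q b b) ^ 2
      - sp (secondFormVec y q a a) (secondFormVec y q a a)
        * sp (secondFormVec y q b b) (secondFormVec y q b b) := by
  have ht := hy.sp_tangentVec_self hq
  have hs := hy.sp_secondFormVec_self hq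
  have hst := hy.sp_secondFormVec_tangentVec hq
  have e3 := det_mul_det_of_adapted h.h11 h.h22 h.h12 (hy.unit q hq) (ht a) (ht b) (hst a a a)
    (hst a a b) (hs a a) (hst b b a) (hst b b b) (hs b b) (hst a a a) (hst a a b) (hs a a)
    (hst b b a) (hst b b b) (hs b b)
  rw [frameDet, sq, e3, sp_comm (secondFormVec y q b b) (secondFormVec y q a a)]
  ring

/-- A null frame of the tangent plane can be completed to an adapted positive frame. -/
lemma exists_isFrame (h : IsNullFrame y q a b) : ∃ f₃ f₄, IsFrame y q a b f₃ f₄ := by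
  set E₁ := tangentVec y q a with hE₁
  set E₂ := tangentVec y q b with hE₂
  have h11 : sp E₁ E₁ = 0 := h.h11
  have h22 : sp E₂ E₂ = 0 := h.h22
  have h12 : sp E₁ E₂ = -1 := h.h12
  have h21 : sp E₂ E₁ = -1 := h.swap.h12
  have t1 : sp E₁ (y q) = 0 := hy.sp_tangentVec_self hq a
  have t2 : sp E₂ (y q) = 0 := hy.sp_tangentVec_self hq b
  have hyy := hy.unit q hq
  let L : E52 →ₗ[ℝ] (Fin 3 → ℝ) := LinearMap.pi ![(spL.flip E₁).toLinearMap,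
    (spL.flip E₂).toLinearMap, (spL.flip (y q)).toLinearMap]
  have hL : 2 ≤ Module.finrank ℝ (LinearMap.ker L) := by
    have h1 := L.finrank_range_add_finrank_ker
    have h2 := (LinearMap.range L).finrank_le
    simp only [Module.finrank_fintype_fun_eq_card, Fintype.card_fin] at h1 h2
    omega
  obtain ⟨n, hn⟩ := exists_linearIndependent_of_le_finrank hL
  have hnL : ∀ i, sp (n i : E52) E₁ = 0 ∧ sp (n i : E52) E₂ = 0 ∧ sp (n i : E52) (y q) = 0 := by
    intro i
    have := (n i).2
    rw [LinearMap.mem_ker] at this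
    exact ⟨congrFun this 0, congrFun this 1, congrFun this 2⟩
  set u : E52 := (n 0).1 with hu
  set v : E52 := (n 1).1 with hv
  obtain ⟨u1, u2, u3⟩ := hnL 0
  obtain ⟨v1, v2, v3⟩ := hnL 1
  rw [← hu] at u1 u2 u3
  rw [← hv] at v1 v2 v3
  have hdet : (Matrix.of ![E₁, E₂, u, v, y q]).det ≠ 0 := by
    intro h0
    obtain ⟨c, hc, hc'⟩ := Matrix.exists_vecMul_eq_zero_iff.2 h0
    have hc' : c 0 • E₁ + c 1 • E₂ + c 2 • u + c 3 • v + c 4 • y q = 0 := by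
      rw [← hc']
      ext j
      simp [Matrix.vecMul, dotProduct, Fin.sum_univ_succ]; ring
    have c1 := congrArg (fun w => sp w E₁) hc'
    have c0 := congrArg (fun w => sp w E₂) hc'
    have c4 := congrArg (fun w => sp w (y q)) hc'
    simp only [sp_add_left, sp_smul_left, sp_zero_left, h11, h21, h12, h22, u1, v1, u2, v2, u3, v3,
      sp_comm (y q), t1, t2, hyy] at c1 c0 c4
    have c0 : c 0 = 0 := by linarith
    have c1 : c 1 = 0 := by linarith
    have c4 : c 4 = 0 := by linarith
    rw [c0, c1, c4] at hc'
    have hi := LinearIndependent.pair_iff.1 ((LinearIndependent.pair_iff (x := n 0) (y := n 1)).2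
      (by
        intro s t hst
        have := Fintype.linearIndependent_iff.1 hn ![s, t] (by simpa [Fin.sum_univ_two] using hst)
        exact ⟨this 0, this 1⟩)) (c 2) (c 3) (by
          ext1
          simpa using hc')
    apply hc
    ext i; fin_cases i <;> simp [c0, c1, c4, hi.1, hi.2]
  have e1 := det_mul_det_of_adapted h11 h22 h12 hyy t1 t2 u1 u2 u3 v1 v2 v3 u1 u2 u3 v1 v2 v3
  have hneg : sp u u * sp v v - sp u v ^ 2 < 0 := by
    have : 0 < (Matrix.of ![E₁, E₂, u, v, y q]).det ^ 2 := by positivity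
    rw [sp_comm v u] at e1
    nlinarith
  obtain ⟨ε, hε, hε'⟩ := exists_root hneg
  set δ := ε * √(sp u v ^ 2 - sp u u * sp v v) with hδ
  have hδ2 : δ ^ 2 = sp u v ^ 2 - sp u u * sp v v := by
    rw [hδ, mul_pow, hε, Real.sq_sqrt (by linarith), one_mul]
  have hδ0 : δ ≠ 0 := by
    intro h0; rw [h0] at hδ2; linarith
  obtain ⟨i1, i2, i3⟩ := nullPair_identities hδ2 hδ0 hε'
  set a0 := δ - sp u v
  set b0 := sp v v / (2 * a0 * δ ^ 2)
  set b1 := a0 / (2 * a0 * δ ^ 2)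
  set f := a0 • u + sp u u • v with hf
  set g := b0 • u + b1 • v with hg
  have ff : sp f f = 0 := by
    simp only [hf, sp_add_left, sp_add_right, sp_smul_left, sp_smul_right, sp_comm v u]
    linear_combination i1
  have gg : sp g g = 0 := by
    simp only [hg, sp_add_left, sp_add_right, sp_smul_left, sp_smul_right, sp_comm v u]
    linear_combination i2
  have fg : sp f g = -1 := by
    simp only [hf, hg, sp_add_left, sp_add_right, sp_smul_left, sp_smul_right, sp_comm v u]
    linear_combination i3
  have perp : ∀ w, sp u w = 0 → sp v w = 0 → sp f w = 0 ∧ sp g w = 0 := fun w h1 h2 => by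
    simp [hf, hg, sp_add_left, sp_smul_left, h1, h2]
  have f1 := perp _ u1 v1
  have f2 := perp _ u2 v2
  have f3 := perp _ u3 v3
  -- a vector orthogonal to the null frame is orthogonal to the tangent plane
  have tang : ∀ w, sp w E₁ = 0 → sp w E₂ = 0 → ∀ i, sp w (pd i y q) = 0 := by
    intro w h1 h2 i
    have hd := h.det_metric
    have hd' : a 0 * b 1 - a 1 * b 0 ≠ 0 := by
      intro h0; rw [h0] at hd; norm_num at hd
    simp only [hE₁, hE₂, tangentVec, Fin.sum_univ_two, sp_add_right, sp_smul_right] at h1 h2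
    fin_cases i
    · apply mul_left_cancel₀ hd'
      simp only [Fin.zero_eta, mul_zero]
      linear_combination b 1 * h1 - a 1 * h2
    · apply mul_left_cancel₀ hd'
      simp only [Fin.mk_one, mul_zero]
      linear_combination a 0 * h2 - b 0 * h1
  have e2 := det_mul_det_of_adapted h11 h22 h12 hyy t1 t2 f1.1 f2.1 f3.1 f1.2 f2.2 f3.2
    f1.2 f2.2 f3.2 f1.1 f2.1 f3.1
  rw [ff, gg, sp_comm g f, fg] at e2
  rcases lt_or_ge 0 (Matrix.of ![E₁, E₂, f, g, y q]).det with hp | hp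
  · exact ⟨f, g, h11, h22, h12, ff, gg, fg, ⟨tang f f1.1 f2.1, f3.1⟩, ⟨tang g f1.2 f2.2, f3.2⟩, hp⟩
  · refine ⟨g, f, h11, h22, h12, gg, ff, by rw [sp_comm, fg], ⟨tang g f1.2 f2.2, f3.2⟩,
      ⟨tang f f1.1 f2.1, f3.1⟩, ?_⟩
    change 0 < (Matrix.of ![E₁, E₂, g, f, y q]).det
    nlinarith

end IsLorentzPatch

lemma tangentVec_smul_add_smul (y : Plane → E52) (q : Plane) (s t : ℝ) (u v : Fin 2 → ℝ) :
    tangentVec y q (s • u + t • v) = s • tangentVec y q u + t • tangentVec y q v := by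
  simp only [tangentVec, Fin.sum_univ_two, Pi.add_apply, Pi.smul_apply, smul_eq_mul]
  module

/-- The expansion of a tangent vector in a null frame. -/
lemma IsNullFrame.eq_add {y : Plane → E52} {q : Plane} {a b : Fin 2 → ℝ}
    (hg : (metric y q).det ≠ 0) (h : IsNullFrame y q a b) (w : Fin 2 → ℝ) :
    w = (-sp (tangentVec y q w) (tangentVec y q b)) • a
      + (-sp (tangentVec y q w) (tangentVec y q a)) • b := by
  have e : metric y q * (metric y q)⁻¹ = 1 := Matrix.mul_nonsing_inv _ hg.isUnit
  have e' : ∀ i j, metric y q i 0 * (metric y q)⁻¹ 0 j + metric y q i 1 * (metric y q)⁻¹ 1 j =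
      (1 : Matrix (Fin 2) (Fin 2) ℝ) i j := fun i j => by
    rw [← e, Matrix.mul_apply, Fin.sum_univ_two]
  have e00 := e' 0 0
  have e01 := e' 0 1
  have e10 := e' 1 0
  have e11 := e' 1 1
  simp only [h.inv_metric, Matrix.one_apply] at e00 e01 e10 e11
  norm_num at e00 e01 e10 e11
  ext i
  simp only [sp_tangentVec, Pi.add_apply, Pi.smul_apply, smul_eq_mul]
  fin_cases i
  · simp only [Fin.zero_eta]
    linear_combination -w 0 * e00 - w 1 * e10
  · simp only [Fin.mk_one]
    linear_combination -w 0 * e01 - w 1 * e11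

/-- Two null frames of a Lorentzian plane differ by a boost, possibly after exchanging the two null
directions. -/
lemma IsNullFrame.eq_boost {y : Plane → E52} {q : Plane} {a b a' b' : Fin 2 → ℝ}
    (hg : (metric y q).det ≠ 0) (h : IsNullFrame y q a b) (h' : IsNullFrame y q a' b') :
    ∃ c : ℝ, c ≠ 0 ∧ ((a' = c • a ∧ b' = c⁻¹ • b) ∨ (a' = c • b ∧ b' = c⁻¹ • a)) := by
  obtain ⟨s, t, ha'⟩ : ∃ s t : ℝ, a' = s • a + t • b := ⟨_, _, h.eq_add hg a'⟩
  obtain ⟨s', t', hb'⟩ : ∃ s t : ℝ, b' = s • a + t • b := ⟨_, _, h.eq_add hg b'⟩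
  have k11 := h'.h11
  have k22 := h'.h22
  have k12 := h'.h12
  rw [ha', tangentVec_smul_add_smul] at k11 k12
  rw [hb', tangentVec_smul_add_smul] at k22 k12
  simp only [sp_add_left, sp_add_right, sp_smul_left, sp_smul_right, h.h11, h.h22, h.h12,
    h.swap.h12] at k11 k22 k12
  have m1 : s * t = 0 := by linarith
  have m2 : s' * t' = 0 := by linarith
  have m3 : s * t' + t * s' = 1 := by linarith
  rcases mul_eq_zero.1 m1 with h0 | h0
  · rw [h0] at m3 ha'
    have ht : t ≠ 0 := by rintro rfl; norm_num at m3
    have hs' : s' = t⁻¹ := by field_simp; linarith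
    have ht' : t' = 0 := by
      rcases mul_eq_zero.1 m2 with h1 | h1
      · rw [h1] at m3; norm_num at m3
      · exact h1
    refine ⟨t, ht, Or.inr ⟨by rw [ha']; simp, by rw [hb', hs', ht']; simp⟩⟩
  · rw [h0] at m3 ha'
    have hs : s ≠ 0 := by rintro rfl; norm_num at m3
    have ht' : t' = s⁻¹ := by field_simp; linarith
    have hs' : s' = 0 := by
      rcases mul_eq_zero.1 m2 with h1 | h1
      · exact h1
      · rw [h1] at m3; norm_num at m3
    refine ⟨s, hs, Or.inl ⟨by rw [ha']; simp, by rw [hb', ht', hs']; simp⟩⟩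

/-- The determinant `frameDet` does not depend on the null frame. -/
lemma IsNullFrame.frameDet_eq {y : Plane → E52} {q : Plane} {a b a' b' : Fin 2 → ℝ}
    (hg : (metric y q).det ≠ 0) (h : IsNullFrame y q a b) (h' : IsNullFrame y q a' b') :
    frameDet y q a' b' = frameDet y q a b := by
  have tv : ∀ (s : ℝ) (u : Fin 2 → ℝ), tangentVec y q (s • u) = s • tangentVec y q u := by
    intro s u
    simp only [tangentVec, Fin.sum_univ_two, Pi.smul_apply, smul_eq_mul]
    module
  have sv : ∀ (s : ℝ) (u : Fin 2 → ℝ), secondFormVec y q (s • u) (s • u) =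
      s ^ 2 • secondFormVec y q u u := by
    intro s u
    simp only [secondFormVec, Fin.sum_univ_two, Pi.smul_apply, smul_eq_mul]
    module
  obtain ⟨c, hc, ⟨rfl, rfl⟩ | ⟨rfl, rfl⟩⟩ := h.eq_boost hg h'
  · rw [frameDet, frameDet, tv, tv, sv, sv]
    generalize tangentVec y q a = e₁
    generalize tangentVec y q b = e₂
    generalize secondFormVec y q a a = p
    generalize secondFormVec y q b b = r
    have : Matrix.of ![c • e₁, c⁻¹ • e₂, c ^ 2 • p, c⁻¹ ^ 2 • r, y q] =
        Matrix.diagonal ![c, c⁻¹, c ^ 2, c⁻¹ ^ 2, 1] * Matrix.of ![e₁, e₂, p, r, y q] := by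
      ext i j
      rw [Matrix.diagonal_mul]
      fin_cases i <;> simp
    rw [this, Matrix.det_mul, Matrix.det_diagonal]
    simp [Fin.prod_univ_succ]
    field_simp
  · rw [frameDet, frameDet, tv, tv, sv, sv]
    generalize tangentVec y q a = e₁
    generalize tangentVec y q b = e₂
    generalize secondFormVec y q a a = p
    generalize secondFormVec y q b b = r
    have : Matrix.of ![c • e₂, c⁻¹ • e₁, c ^ 2 • r, c⁻¹ ^ 2 • p, y q] =
        !![0, c, 0, 0, 0; c⁻¹, 0, 0, 0, 0; 0, 0, 0, c ^ 2, 0; 0, 0, c⁻¹ ^ 2, 0, 0; 0, 0, 0, 0, 1]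
          * Matrix.of ![e₁, e₂, p, r, y q] := by
      ext i j
      fin_cases i <;> simp [Matrix.mul_apply, Fin.sum_univ_succ]
    rw [this, Matrix.det_mul]
    simp [Matrix.det_succ_row_zero, Fin.sum_univ_succ, Fin.succAbove]
    field_simp

/-! ### Changes of coordinates -/

section ChainRule

variable {F : Type*} [NormedAddCommGroup F] [NormedSpace ℝ F]

lemma plane_eq_sum (v : Plane) :
    v = v 0 • EuclideanSpace.single 0 (1 : ℝ) + v 1 • EuclideanSpace.single 1 (1 : ℝ) := by
  ext i; fin_cases i <;> simp

lemma fderiv_eq_sum_pd (g : Plane → F) (p v : Plane) :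
    fderiv ℝ g p v = v 0 • pd 0 g p + v 1 • pd 1 g p := by
  conv_lhs => rw [plane_eq_sum v]
  simp [pd]

lemma pd_comp (i : Fin 2) {g : Plane → F} {φ : Plane → Plane} {q : Plane}
    (hg : DifferentiableAt ℝ g (φ q)) (hφ : DifferentiableAt ℝ φ q) :
    pd i (fun p => g (φ p)) q = (pd i φ q) 0 • pd 0 g (φ q) + (pd i φ q) 1 • pd 1 g (φ q) := by
  rw [pd, fderiv_fun_comp q hg hφ, ContinuousLinearMap.comp_apply, fderiv_eq_sum_pd]
  rfl

end ChainRule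

lemma tangentVec_eq_fderiv (y : Plane → E52) (q v : Plane) :
    tangentVec y q v.ofLp = fderiv ℝ y q v := by
  rw [fderiv_eq_sum_pd, tangentVec, Fin.sum_univ_two]

/-- The coordinates of the image of a tangent vector under the change of coordinates `φ`. -/
def pushVec (φ : Plane → Plane) (q : Plane) (a : Fin 2 → ℝ) (k : Fin 2) : ℝ :=
  a 0 * (pd 0 φ q) k + a 1 * (pd 1 φ q) k

section ChangeOfCoordinates

variable {U V W : Set Plane} {y z : Plane → E52} {φ : Plane → Plane}

lemma tangentVec_eq_pushVec (hz : IsLorentzPatch W z) (hV : IsOpen V) (hφ : ContDiffOn ℝ ∞ φ V)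
    (hVW : ∀ q ∈ V, φ q ∈ W) (hyz : ∀ q ∈ V, y q = z (φ q)) {q : Plane} (hq : q ∈ V)
    (a : Fin 2 → ℝ) : tangentVec y q a = tangentVec z (φ q) (pushVec φ q a) := by
  have h : ∀ i, pd i y q = (pd i φ q) 0 • pd 0 z (φ q) + (pd i φ q) 1 • pd 1 z (φ q) := by
    intro i
    rw [← pd_comp i (hz.differentiableAt (hVW q hq)) (differentiableAt_of_contDiffOn hV hφ hq)]
    exact pd_congr i hV hyz hq
  simp only [tangentVec, Fin.sum_univ_two, h, pushVec]
  module

/-- The second fundamental form is tensorial. -/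
lemma secondFormVec_eq_pushVec (hy : IsLorentzPatch U y) (hz : IsLorentzPatch W z) (hV : IsOpen V)
    (hVU : V ⊆ U) (hφ : ContDiffOn ℝ ∞ φ V)
    (hVW : ∀ q ∈ V, φ q ∈ W) (hyz : ∀ q ∈ V, y q = z (φ q)) {q : Plane} (hq : q ∈ V)
    (a b : Fin 2 → ℝ) :
    secondFormVec y q a b = secondFormVec z (φ q) (pushVec φ q a) (pushVec φ q b) := by
  have hqU := hVU hq
  have hqW := hVW q hq
  have dφ : ∀ q ∈ V, DifferentiableAt ℝ φ q := fun q hq => differentiableAt_of_contDiffOn hV hφ hq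
  have h : ∀ q ∈ V, ∀ i, pd i y q =
      (pd i φ q) 0 • pd 0 z (φ q) + (pd i φ q) 1 • pd 1 z (φ q) := by
    intro q hq i
    rw [← pd_comp i (hz.differentiableAt (hVW q hq)) (dφ q hq)]
    exact pd_congr i hV hyz hq
  -- the differential of `φ` is invertible, so both parametrizations have the same tangent plane
  set J : Matrix (Fin 2) (Fin 2) ℝ := Matrix.of fun i k => (pd i φ q) k with hJ
  have hJdet : J.det ≠ 0 := by
    have e : metric y q = J * metric z (φ q) * J.transpose := by
      ext i j
      simp only [metric_apply, h q hq, sp_add_left, sp_add_right, sp_smul_left, sp_smul_right,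
        Matrix.mul_apply, Fin.sum_univ_two, Matrix.transpose_apply, hJ, Matrix.of_apply]
      ring
    intro h0
    have := (hy.lorentz q hqU).ne
    rw [e, Matrix.det_mul, Matrix.det_mul, h0] at this
    simp at this
  have hz0 : ∀ k, normalPart y q (pd k z (φ q)) = 0 := by
    have h0 := h q hq 0
    have h1 := h q hq 1
    have n0 := hy.normalPart_pd hqU 0
    have n1 := hy.normalPart_pd hqU 1
    rw [h0, normalPart_add, normalPart_smul, normalPart_smul] at n0
    rw [h1, normalPart_add, normalPart_smul, normalPart_smul] at n1
    rw [Matrix.det_fin_two] at hJdet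
    simp only [hJ, Matrix.of_apply] at hJdet
    intro k
    refine (smul_eq_zero.1 (?_ : ((pd 0 φ q) 0 * (pd 1 φ q) 1 - (pd 0 φ q) 1 * (pd 1 φ q) 0) •
      normalPart y q (pd k z (φ q)) = 0)).resolve_left hJdet
    fin_cases k
    · simp only [Fin.zero_eta]
      linear_combination (norm := module) (pd 1 φ q) 1 • n0 - (pd 0 φ q) 1 • n1
    · simp only [Fin.mk_one]
      linear_combination (norm := module) (pd 0 φ q) 0 • n1 - (pd 1 φ q) 0 • n0
  have hN : ∀ i j, normalPart y q (secondForm z i j (φ q)) = secondForm z i j (φ q) := by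
    intro i j
    refine normalPart_eq_self (fun l => ?_) ?_
    · rw [h q hq, sp_add_right, sp_smul_right, sp_smul_right, hz.sp_secondForm_pd _ _ _ hqW,
        hz.sp_secondForm_pd _ _ _ hqW]
      simp
    · rw [hyz q hq, hz.sp_secondForm_self _ _ hqW]
  have hNd : ∀ i j, normalPart y q (pd i (pd j z) (φ q)) = secondForm z i j (φ q) := by
    intro i j
    rw [pd_pd_eq, Fin.sum_univ_two, normalPart_add, normalPart_sub, normalPart_add,
      normalPart_smul, normalPart_smul, normalPart_smul, hz0, hz0, hN, ← hyz q hq,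
      hy.normalPart_self hqU]
    simp
  have key : ∀ i j, secondForm y i j q =
      ((pd j φ q) 0 * (pd i φ q) 0) • secondForm z 0 0 (φ q)
      + ((pd j φ q) 0 * (pd i φ q) 1) • secondForm z 1 0 (φ q)
      + ((pd j φ q) 1 * (pd i φ q) 0) • secondForm z 0 1 (φ q)
      + ((pd j φ q) 1 * (pd i φ q) 1) • secondForm z 1 1 (φ q) := by
    intro i j
    have dc : ∀ k, DifferentiableAt ℝ (fun p => (pd j φ p) k) q := fun k => by
      have := differentiableAt_of_contDiffOn hV (contDiffOn_pd j hV hφ) hq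
      exact (EuclideanSpace.proj (𝕜 := ℝ) k).differentiableAt.comp q this
    have dz : ∀ k, DifferentiableAt ℝ (fun p => pd k z (φ p)) q := fun k =>
      (hz.differentiableAt_pd k hqW).fun_comp' q (dφ q hq)
    have ds : ∀ k, DifferentiableAt ℝ (fun p => (pd j φ p) k • pd k z (φ p)) q := fun k =>
      (dc k).fun_smul (dz k)
    have e : pd i (pd j y) q = dirDeriv (fun _ => EuclideanSpace.single i 1) (fun q =>
        (pd j φ q) 0 • pd 0 z (φ q) + (pd j φ q) 1 • pd 1 z (φ q)) q := by
      rw [pd_eq_dirDeriv]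
      exact dirDeriv_congr (F := E52) hV (fun p hp => h p hp j) hq
    rw [← hy.normalPart_pd_pd hqU, e, dirDeriv_add (ds 0) (ds 1), dirDeriv_smul (dc 0) (dz 0),
      dirDeriv_smul (dc 1) (dz 1)]
    simp only [← pd_eq_dirDeriv, pd_comp i (hz.differentiableAt_pd _ hqW) (dφ q hq),
      normalPart_add, normalPart_smul, hz0, hNd]
    module
  simp only [secondFormVec, Fin.sum_univ_two, key, pushVec]
  module

end ChangeOfCoordinates

section Manifold

variable {M : Type*} [TopologicalSpace M] [ChartedSpace Plane M]
  {x : M → E52}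

lemma IsLorentzianSurface.isLorentzPatch (hx : IsLorentzianSurface x)
    {e : OpenPartialHomeomorph M Plane} (he : e ∈ IsManifold.maximalAtlas (𝓡 2) ∞ M) :
    IsLorentzPatch e.target (x ∘ e.symm) where
  isOpen := e.open_target
  smooth := contMDiffOn_iff_contDiffOn.1
    (hx.smooth.comp_contMDiffOn (contMDiffOn_symm_of_mem_maximalAtlas he))
  unit q _ := hx.mem_sphere _
  lorentz q hq := by
    have := hx.lorentzian e he (e.symm q) (e.map_target hq)
    rwa [e.right_inv hq] at this

/-- First and second order data of the surface in two charts around a point correspond to each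
other under a map of the coordinates of tangent vectors. -/
lemma IsLorentzianSurface.exists_pushVec (hx : IsLorentzianSurface x)
    {e e' : OpenPartialHomeomorph M Plane} (he : e ∈ IsManifold.maximalAtlas (𝓡 2) ∞ M)
    (he' : e' ∈ IsManifold.maximalAtlas (𝓡 2) ∞ M) {p : M} (hp : p ∈ e.source)
    (hp' : p ∈ e'.source) :
    ∃ J : (Fin 2 → ℝ) → (Fin 2 → ℝ),
      (∀ a, tangentVec (x ∘ e.symm) (e p) a = tangentVec (x ∘ e'.symm) (e' p) (J a)) ∧
      ∀ a b, secondFormVec (x ∘ e.symm) (e p) a b =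
        secondFormVec (x ∘ e'.symm) (e' p) (J a) (J b) := by
  set V := (e.symm.trans e').source with hVdef
  have hVs : V = e.target ∩ e.symm ⁻¹' e'.source := by
    rw [hVdef, OpenPartialHomeomorph.trans_source]; rfl
  have hV : IsOpen V := (e.symm.trans e').open_source
  have hφ : ContDiffOn ℝ ∞ (fun q => e' (e.symm q)) V := by
    rw [hVs]
    exact contMDiffOn_iff_contDiffOn.1 ((contMDiffOn_of_mem_maximalAtlas he').comp
      ((contMDiffOn_symm_of_mem_maximalAtlas he).mono inter_subset_left) inter_subset_right)
  have hVW : ∀ q ∈ V, e' (e.symm q) ∈ e'.target := fun q hq => e'.map_source (by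
    rw [hVs] at hq; exact hq.2)
  have hyz : ∀ q ∈ V, (x ∘ e.symm) q = (x ∘ e'.symm) (e' (e.symm q)) := fun q hq => by
    rw [hVs] at hq
    simp only [Function.comp_apply]
    rw [e'.left_inv hq.2]
  have hpV : e p ∈ V := by
    rw [hVs]
    exact ⟨e.map_source hp, by rw [mem_preimage, e.left_inv hp]; exact hp'⟩
  have h1 := fun a => tangentVec_eq_pushVec (hx.isLorentzPatch he') hV hφ hVW hyz hpV a
  have h2 := fun a b => secondFormVec_eq_pushVec (hx.isLorentzPatch he) (hx.isLorentzPatch he') hV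
    (by rw [hVs]; exact inter_subset_left) hφ hVW hyz hpV a b
  simp only [e.left_inv hp] at h1 h2
  exact ⟨_, h1, h2⟩

end Manifold

/-! ### Null curves in the light cone and the surfaces they generate -/

section Curve

variable {I : Set ℝ} {α : ℝ → E52}

lemma hasDerivAt_iteratedDeriv (hI : IsOpen I) (hα : ContDiffOn ℝ ∞ α I) (n : ℕ) {t : ℝ}
    (ht : t ∈ I) : HasDerivAt (iteratedDeriv n α) (iteratedDeriv (n + 1) α t) t := by
  have h : ∀ n, ContDiffOn ℝ ∞ (iteratedDeriv n α) I := by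
    intro n
    induction n with
    | zero => simpa using hα
    | succ n ih => rw [iteratedDeriv_succ]; exact ih.deriv_of_isOpen hI (by simp)
  rw [iteratedDeriv_succ]
  exact (differentiableAt_of_contDiffOn hI (h n) ht).hasDerivAt

lemma sp_iteratedDeriv_add (hI : IsOpen I) (hα : ContDiffOn ℝ ∞ α I) (m n : ℕ) {c : ℝ}
    (h : ∀ t ∈ I, sp (iteratedDeriv m α t) (iteratedDeriv n α t) = c) {t : ℝ} (ht : t ∈ I) :
    sp (iteratedDeriv (m + 1) α t) (iteratedDeriv n α t)
      + sp (iteratedDeriv m α t) (iteratedDeriv (n + 1) α t) = 0 := by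
  have hm := hasDerivAt_iteratedDeriv hI hα m ht
  have hn := hasDerivAt_iteratedDeriv hI hα n ht
  have h1 := fderiv_sp hm.differentiableAt hn.differentiableAt 1
  rw [fderiv_congr_of_isOpen hI (g := fun _ => c) h ht] at h1
  simp only [fderiv_apply_one_eq_deriv, hm.deriv, hn.deriv] at h1
  rw [← h1]
  simp

lemma iteratedDeriv_linear_comp (hI : IsOpen I) (hα : ContDiffOn ℝ ∞ α I) (A : E52 →L[ℝ] E52)
    (n : ℕ) : ∀ t ∈ I, iteratedDeriv n (fun t => A (α t)) t = A (iteratedDeriv n α t) := by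
  induction n with
  | zero => simp
  | succ n ih =>
    intro t ht
    rw [iteratedDeriv_succ, Filter.EventuallyEq.deriv_eq
      (Filter.eventuallyEq_of_mem (hI.mem_nhds ht) ih)]
    exact (A.hasFDerivAt.comp_hasDerivAt t (hasDerivAt_iteratedDeriv hI hα n ht)).deriv

/-- A null curve in the light cone whose second derivative has constant length `2/3`. -/
structure IsNormalizedNullCurve (I : Set ℝ) (α : ℝ → E52) : Prop where
  isOpen : IsOpen I
  smooth : ContDiffOn ℝ ∞ α I
  sp00 : ∀ t ∈ I, sp (iteratedDeriv 0 α t) (iteratedDeriv 0 α t) = 0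
  sp11 : ∀ t ∈ I, sp (iteratedDeriv 1 α t) (iteratedDeriv 1 α t) = 0
  sp22 : ∀ t ∈ I, sp (iteratedDeriv 2 α t) (iteratedDeriv 2 α t) = 4 / 9

namespace IsNormalizedNullCurve

variable (h : IsNormalizedNullCurve I α)
include h

lemma sp01 : ∀ t ∈ I, sp (iteratedDeriv 0 α t) (iteratedDeriv 1 α t) = 0 := fun t ht => by
  have := sp_iteratedDeriv_add h.isOpen h.smooth 0 0 h.sp00 ht
  rw [sp_comm (iteratedDeriv (0 + 1) α t)] at this
  simp only [zero_add] at this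
  linarith

lemma sp02 : ∀ t ∈ I, sp (iteratedDeriv 0 α t) (iteratedDeriv 2 α t) = 0 := fun t ht => by
  have := sp_iteratedDeriv_add h.isOpen h.smooth 0 1 h.sp01 ht
  simp only [zero_add] at this
  rw [h.sp11 t ht] at this
  simpa using this

lemma sp12 : ∀ t ∈ I, sp (iteratedDeriv 1 α t) (iteratedDeriv 2 α t) = 0 := fun t ht => by
  have := sp_iteratedDeriv_add h.isOpen h.smooth 1 1 h.sp11 ht
  rw [sp_comm (iteratedDeriv (1 + 1) α t)] at this
  simp only [Nat.reduceAdd] at this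
  linarith

lemma sp03 : ∀ t ∈ I, sp (iteratedDeriv 0 α t) (iteratedDeriv 3 α t) = 0 := fun t ht => by
  have := sp_iteratedDeriv_add h.isOpen h.smooth 0 2 h.sp02 ht
  simp only [zero_add, Nat.reduceAdd] at this
  rw [h.sp12 t ht] at this
  simpa using this

lemma sp13 : ∀ t ∈ I, sp (iteratedDeriv 1 α t) (iteratedDeriv 3 α t) = -(4 / 9) := fun t ht => by
  have := sp_iteratedDeriv_add h.isOpen h.smooth 1 2 h.sp12 ht
  simp only [Nat.reduceAdd] at this
  rw [h.sp22 t ht] at this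
  linarith

lemma sp23 : ∀ t ∈ I, sp (iteratedDeriv 2 α t) (iteratedDeriv 3 α t) = 0 := fun t ht => by
  have := sp_iteratedDeriv_add h.isOpen h.smooth 2 2 h.sp22 ht
  rw [sp_comm (iteratedDeriv (2 + 1) α t)] at this
  simp only [Nat.reduceAdd] at this
  linarith

end IsNormalizedNullCurve

/-- The image of a surface `model α` under a linear isometry is the surface of the image curve. -/
lemma model_linear_comp (hI : IsOpen I) (hα : ContDiffOn ℝ ∞ α I) (A : E52 →L[ℝ] E52)
    (hA : ∀ v w, sp (A v) (A w) = sp v w) (s : ℝ) {t : ℝ} (ht : t ∈ I) :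
    A (model α s t) = model (fun t => A (α t)) s t := by
  have h1 := iteratedDeriv_linear_comp hI hα A 1 t ht
  rw [iteratedDeriv_one, iteratedDeriv_one] at h1
  simp only [model, iteratedDeriv_linear_comp hI hα A _ t ht, hA, h1, map_add, map_smul]

end Curve

section Partial

variable {F : Type*} [NormedAddCommGroup F] [NormedSpace ℝ F]

lemma pd_zero_eq {f : Plane → F} {g : ℝ → ℝ → F} {z : Plane} {g' : F}
    (hf : DifferentiableAt ℝ f z) (hfg : ∀ᶠ w in nhds z, f w = g (w 0) (w 1))
    (h : HasDerivAt (fun s => g s (z 1)) g' (z 0)) : pd 0 f z = g' := by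
  let γ : ℝ → Plane := fun s => z + (s - z 0) • EuclideanSpace.single 0 (1 : ℝ)
  have hγ : HasDerivAt γ (EuclideanSpace.single 0 (1 : ℝ)) (z 0) := by
    exact ((((hasDerivAt_id (z 0)).sub_const (z 0)).smul_const
      (EuclideanSpace.single (0 : Fin 2) (1 : ℝ))).const_add z).congr_deriv (one_smul _ _)
  have hγz : γ (z 0) = z := by simp [γ]
  have h1 : HasDerivAt (fun s => f (γ s)) (pd 0 f z) (z 0) := by
    have := hf.hasFDerivAt
    rw [← hγz] at this
    have h2 := this.comp_hasDerivAt (z 0) hγ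
    rwa [hγz] at h2
  have h2 : (fun s => f (γ s)) =ᶠ[nhds (z 0)] fun s => g s (z 1) := by
    have hc : Filter.Tendsto γ (nhds (z 0)) (nhds z) := by
      have := hγ.continuousAt.tendsto
      rwa [hγz] at this
    filter_upwards [hc.eventually hfg] with s hs
    rw [hs]
    simp [γ]
  exact (h1.congr_of_eventuallyEq h2.symm).unique h

lemma pd_one_eq {f : Plane → F} {g : ℝ → ℝ → F} {z : Plane} {g' : F}
    (hf : DifferentiableAt ℝ f z) (hfg : ∀ᶠ w in nhds z, f w = g (w 0) (w 1))
    (h : HasDerivAt (fun t => g (z 0) t) g' (z 1)) : pd 1 f z = g' := by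
  let γ : ℝ → Plane := fun s => z + (s - z 1) • EuclideanSpace.single 1 (1 : ℝ)
  have hγ : HasDerivAt γ (EuclideanSpace.single 1 (1 : ℝ)) (z 1) := by
    exact ((((hasDerivAt_id (z 1)).sub_const (z 1)).smul_const
      (EuclideanSpace.single (1 : Fin 2) (1 : ℝ))).const_add z).congr_deriv (one_smul _ _)
  have hγz : γ (z 1) = z := by simp [γ]
  have h1 : HasDerivAt (fun s => f (γ s)) (pd 1 f z) (z 1) := by
    have := hf.hasFDerivAt
    rw [← hγz] at this
    have h2 := this.comp_hasDerivAt (z 1) hγ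
    rwa [hγz] at h2
  have h2 : (fun s => f (γ s)) =ᶠ[nhds (z 1)] fun s => g (z 0) s := by
    have hc : Filter.Tendsto γ (nhds (z 1)) (nhds z) := by
      have := hγ.continuousAt.tendsto
      rwa [hγz] at this
    filter_upwards [hc.eventually hfg] with s hs
    rw [hs]
    simp [γ]
  exact (h1.congr_of_eventuallyEq h2.symm).unique h

end Partial

lemma IsLorentzPatch.continuousOn_frameDet {U : Set Plane} {y : Plane → E52}
    (hy : IsLorentzPatch U y) {a b : Plane → Fin 2 → ℝ} (ha : ContinuousOn a U)
    (hb : ContinuousOn b U) : ContinuousOn (fun q => frameDet y q (a q) (b q)) U := by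
  have ha' := continuousOn_pi.1 ha
  have hb' := continuousOn_pi.1 hb
  have ht : ∀ c : Plane → Fin 2 → ℝ, (∀ i, ContinuousOn (fun q => c q i) U) →
      ContinuousOn (fun q => tangentVec y q (c q)) U := fun c hc =>
    continuousOn_finsetSum _ fun i _ => (hc i).smul (hy.contDiffOn_pd i).continuousOn
  have hs : ∀ c : Plane → Fin 2 → ℝ, (∀ i, ContinuousOn (fun q => c q i) U) →
      ContinuousOn (fun q => secondFormVec y q (c q) (c q)) U := fun c hc =>
    continuousOn_finsetSum _ fun i _ => continuousOn_finsetSum _ fun j _ =>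
      ((hc i).mul (hc j)).smul (hy.contDiffOn_secondForm i j).continuousOn
  set m : Plane → Matrix (Fin 5) (Fin 5) ℝ := fun q => Matrix.of ![tangentVec y q (a q),
      tangentVec y q (b q), secondFormVec y q (a q) (a q), secondFormVec y q (b q) (b q), y q]
    with hm
  have hM : ContinuousOn m U := by
    refine continuousOn_pi.2 fun i => ?_
    fin_cases i
    exacts [ht a ha', ht b hb', hs a ha', hs b hb', hy.smooth.continuousOn]
  have hdet : Continuous fun A : Matrix (Fin 5) (Fin 5) ℝ => A.det := continuous_id.matrix_det
  refine (Continuous.comp_continuousOn (f := m) hdet hM).congr fun q _ => ?_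
  rw [Function.comp_apply, hm, frameDet]

/-- The first and second order data of a surface `model α`, in the null frame
`∂₀`, `∂₁ + (g₁₁ / 2) ∂₀`. -/
lemma IsNormalizedNullCurve.nullFrame_model {I : Set ℝ} {α : ℝ → E52}
    (h : IsNormalizedNullCurve I α) {U : Set Plane} {y : Plane → E52} (hy : IsLorentzPatch U y)
    (hU : ∀ z ∈ U, z 1 ∈ I ∧ y z = model α (z 0) (z 1)) {z : Plane} (hz : z ∈ U) :
    IsNullFrame y z ![1, 0] ![metric y z 1 1 / 2, 1] ∧
    secondFormVec y z ![1, 0] ![metric y z 1 1 / 2, 1] = 0 ∧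
    sp (secondFormVec y z ![1, 0] ![1, 0]) (secondFormVec y z ![1, 0] ![1, 0]) = 0 ∧
    sp (secondFormVec y z ![1, 0] ![1, 0])
      (secondFormVec y z ![metric y z 1 1 / 2, 1] ![metric y z 1 1 / 2, 1]) = 2 / 3 := by
  set a : ℕ → ℝ → E52 := fun n => iteratedDeriv n α with ha
  have hd : ∀ n, ∀ t ∈ I, HasDerivAt (a n) (a (n + 1) t) t := fun n t ht =>
    hasDerivAt_iteratedDeriv h.isOpen h.smooth n ht
  set c : ℝ → ℝ := fun t => 27 / 40 * sp (a 3 t) (a 3 t) with hc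
  obtain ⟨c', hc'⟩ : ∃ c' : ℝ → ℝ, ∀ t ∈ I, HasDerivAt c (c' t) t :=
    ⟨deriv c, fun t ht => (((hd 3 t ht).differentiableAt.sp
      (hd 3 t ht).differentiableAt).const_mul _).hasDerivAt⟩
  have hnhds : ∀ z ∈ U, U ∈ nhds z := fun z hz => hy.isOpen.mem_nhds hz
  have hyU : ∀ z ∈ U, y z = (1 / 2 * (z 0) ^ 2 + c (z 1)) • a 0 (z 1) + (3 / 2 * z 0) • a 1 (z 1)
      + (3 / 2 : ℝ) • a 2 (z 1) := fun z hz => by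
    rw [(hU z hz).2, model]
    simp [ha, hc, iteratedDeriv_one]
  have y0 : ∀ z ∈ U, pd 0 y z = z 0 • a 0 (z 1) + (3 / 2 : ℝ) • a 1 (z 1) := by
    intro z hz
    refine pd_zero_eq (g := fun s t => (1 / 2 * s ^ 2 + c t) • a 0 t + (3 / 2 * s) • a 1 t
      + (3 / 2 : ℝ) • a 2 t) (hy.differentiableAt hz)
      (Filter.eventually_of_mem (hnhds z hz) hyU) ?_
    have e1 : HasDerivAt (fun s : ℝ => 1 / 2 * s ^ 2 + c (z 1)) (z 0) (z 0) := by
      have := ((hasDerivAt_pow 2 (z 0)).const_mul (1 / 2 : ℝ)).add_const (c (z 1))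
      refine this.congr_deriv ?_
      norm_num
      ring
    have e2 : HasDerivAt (fun s : ℝ => 3 / 2 * s) (3 / 2) (z 0) := by
      simpa using (hasDerivAt_id (z 0)).const_mul (3 / 2 : ℝ)
    exact ((e1.smul_const _).add (e2.smul_const _)).add_const _
  have y1 : ∀ z ∈ U, pd 1 y z = (1 / 2 * (z 0) ^ 2 + c (z 1)) • a 1 (z 1) + c' (z 1) • a 0 (z 1)
      + (3 / 2 * z 0) • a 2 (z 1) + (3 / 2 : ℝ) • a 3 (z 1) := by
    intro z hz
    have ht := (hU z hz).1
    refine pd_one_eq (g := fun s t => (1 / 2 * s ^ 2 + c t) • a 0 t + (3 / 2 * s) • a 1 t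
      + (3 / 2 : ℝ) • a 2 t) (hy.differentiableAt hz)
      (Filter.eventually_of_mem (hnhds z hz) hyU) ?_
    exact ((((hc' _ ht).const_add (1 / 2 * (z 0) ^ 2)).smul (hd 0 _ ht)).add
      ((hd 1 _ ht).const_smul (3 / 2 * z 0))).add ((hd 2 _ ht).const_smul (3 / 2 : ℝ))
  have y00 : pd 0 (pd 0 y) z = a 0 (z 1) := by
    refine pd_zero_eq (g := fun s t => s • a 0 t + (3 / 2 : ℝ) • a 1 t)
      (hy.differentiableAt_pd 0 hz) (Filter.eventually_of_mem (hnhds z hz) y0) ?_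
    simpa using ((hasDerivAt_id (z 0)).smul_const (a 0 (z 1))).add_const ((3 / 2 : ℝ) • a 1 (z 1))
  have y10 : pd 1 (pd 0 y) z = z 0 • a 1 (z 1) + (3 / 2 : ℝ) • a 2 (z 1) := by
    refine pd_one_eq (g := fun s t => s • a 0 t + (3 / 2 : ℝ) • a 1 t)
      (hy.differentiableAt_pd 0 hz) (Filter.eventually_of_mem (hnhds z hz) y0) ?_
    exact ((hd 0 _ (hU z hz).1).const_smul (z 0)).add ((hd 1 _ (hU z hz).1).const_smul (3 / 2 : ℝ))
  have s00 : ∀ t ∈ I, sp (a 0 t) (a 0 t) = 0 := h.sp00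
  have s01 : ∀ t ∈ I, sp (a 0 t) (a 1 t) = 0 := h.sp01
  have s02 : ∀ t ∈ I, sp (a 0 t) (a 2 t) = 0 := h.sp02
  have s03 : ∀ t ∈ I, sp (a 0 t) (a 3 t) = 0 := h.sp03
  have s11 : ∀ t ∈ I, sp (a 1 t) (a 1 t) = 0 := h.sp11
  have s12 : ∀ t ∈ I, sp (a 1 t) (a 2 t) = 0 := h.sp12
  have s13 : ∀ t ∈ I, sp (a 1 t) (a 3 t) = -(4 / 9) := h.sp13
  have s22 : ∀ t ∈ I, sp (a 2 t) (a 2 t) = 4 / 9 := h.sp22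
  have s23 : ∀ t ∈ I, sp (a 2 t) (a 3 t) = 0 := h.sp23
  -- `α` is a normal vector field
  have o0 : ∀ z ∈ U, sp (a 0 (z 1)) (pd 0 y z) = 0 := fun z hz => by
    have ht := (hU z hz).1
    simp [y0 z hz, sp_add_right, sp_smul_right, s00 _ ht, s01 _ ht]
  have o1 : ∀ z ∈ U, sp (a 0 (z 1)) (pd 1 y z) = 0 := fun z hz => by
    have ht := (hU z hz).1
    simp [y1 z hz, sp_add_right, sp_smul_right, s00 _ ht, s01 _ ht, s02 _ ht, s03 _ ht]
  have oy : sp (a 0 (z 1)) (y z) = 0 := by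
    have ht := (hU z hz).1
    simp [hyU z hz, sp_add_right, sp_smul_right, s00 _ ht, s01 _ ht, s02 _ ht]
  have hN : normalPart y z (a 0 (z 1)) = a 0 (z 1) := normalPart_eq_self (fun i => by
    fin_cases i
    exacts [o0 z hz, o1 z hz]) oy
  have h00 : secondForm y 0 0 z = a 0 (z 1) := by
    rw [← hy.normalPart_pd_pd hz, y00, hN]
  have ht := (hU z hz).1
  have h10 : secondForm y 1 0 z = (-(1 / 6) * (z 0) ^ 2 - c (z 1)) • a 0 (z 1) := by
    have e : pd 1 (pd 0 y) z = y z + (-(1 / 3) * z 0) • pd 0 y z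
        + (-(1 / 6) * (z 0) ^ 2 - c (z 1)) • a 0 (z 1) := by
      rw [y10, hyU z hz, y0 z hz]; module
    rw [← hy.normalPart_pd_pd hz, e, normalPart_add, normalPart_add, normalPart_smul,
      normalPart_smul, hy.normalPart_self hz, hy.normalPart_pd hz, hN]
    simp
  have g00 : metric y z 0 0 = 0 := by
    simp only [metric_apply, y0 z hz, sp_add_left, sp_add_right, sp_smul_left, sp_smul_right,
      s00 _ ht, s01 _ ht, s11 _ ht, sp_comm (a 1 (z 1)) (a 0 (z 1))]
    ring
  have g01 : metric y z 0 1 = -1 := by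
    simp only [metric_apply, y0 z hz, y1 z hz, sp_add_left, sp_add_right, sp_smul_left,
      sp_smul_right, s00 _ ht, s01 _ ht, s02 _ ht, s03 _ ht, s11 _ ht, s12 _ ht, s13 _ ht,
      sp_comm (a 1 (z 1)) (a 0 (z 1))]
    ring
  have g11 : metric y z 1 1 = 1 / 3 * (z 0) ^ 2 + 2 * c (z 1) := by
    simp only [metric_apply, y1 z hz, sp_add_left, sp_add_right, sp_smul_left,
      sp_smul_right, s00 _ ht, s01 _ ht, s02 _ ht, s03 _ ht, s11 _ ht, s12 _ ht, s13 _ ht,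
      s22 _ ht, s23 _ ht, sp_comm (a 1 (z 1)) (a 0 (z 1)), sp_comm (a 2 (z 1)) (a 0 (z 1)),
      sp_comm (a 3 (z 1)) (a 0 (z 1)), sp_comm (a 2 (z 1)) (a 1 (z 1)),
      sp_comm (a 3 (z 1)) (a 1 (z 1)), sp_comm (a 3 (z 1)) (a 2 (z 1)), hc]
    ring
  have h11 : sp (a 0 (z 1)) (secondForm y 1 1 z) = 2 / 3 := by
    have dA : DifferentiableAt ℝ (fun z : Plane => a 0 (z 1)) z :=
      (hd 0 _ ht).differentiableAt.fun_comp' z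
        (EuclideanSpace.proj (𝕜 := ℝ) (1 : Fin 2)).differentiableAt
    have pA : pd 1 (fun z : Plane => a 0 (z 1)) z = a 1 (z 1) :=
      pd_one_eq (g := fun _ t => a 0 t) dA (Filter.Eventually.of_forall fun _ => rfl) (hd 0 _ ht)
    have e1 := fderiv_sp dA (hy.differentiableAt_pd 1 hz) (EuclideanSpace.single 1 1)
    rw [fderiv_congr_of_isOpen hy.isOpen (g := fun _ => (0 : ℝ)) o1 hz] at e1
    simp only [fderiv_fun_const, Pi.zero_apply, zero_apply] at e1
    change 0 = sp (pd 1 (fun z : Plane => a 0 (z 1)) z) (pd 1 y z)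
      + sp (a 0 (z 1)) (pd 1 (pd 1 y) z) at e1
    rw [pA, pd_pd_eq, Fin.sum_univ_two] at e1
    simp only [sp_add_right, sp_sub_right, sp_smul_right, o0 z hz, o1 z hz, oy] at e1
    have e2 : sp (a 1 (z 1)) (pd 1 y z) = -(2 / 3) := by
      simp only [y1 z hz, sp_add_right, sp_smul_right, s01 _ ht, s11 _ ht, s12 _ ht, s13 _ ht,
        sp_comm (a 1 (z 1)) (a 0 (z 1))]
      ring
    rw [e2] at e1
    linarith
  have h01 := hy.secondForm_symm 0 1 hz
  have hP : secondFormVec y z ![1, 0] ![1, 0] = a 0 (z 1) := by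
    simp [secondFormVec, Fin.sum_univ_two, h00]
  refine ⟨⟨?_, ?_, ?_⟩, ?_, ?_, ?_⟩
  · rw [sp_tangentVec]; simp [g00]
  · rw [sp_tangentVec, metric_symm y z 1 0, g00, g01]; simp; ring
  · rw [sp_tangentVec]; simp [g00, g01]
  · simp only [secondFormVec, Fin.sum_univ_two, h00, h01, h10, g11]
    simp only [Matrix.cons_val_zero, Matrix.cons_val_one]
    module
  · rw [hP, s00 _ ht]
  · rw [hP]
    simp only [secondFormVec, Fin.sum_univ_two, h00, h01, h10, sp_add_right, sp_smul_right,
      s00 _ ht, h11]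
    simp

/-! ### Curvature of the model surfaces -/

section Converse

variable {M : Type*} [TopologicalSpace M] [ChartedSpace Plane M] {x : M → E52}

lemma IsCongruentToModel.exists_nullFrame (hx : IsLorentzianSurface x)
    (h : IsCongruentToModel x) (p : M) :
    ∃ e ∈ IsManifold.maximalAtlas (𝓡 2) ∞ M, p ∈ e.source ∧ ∃ a b : Plane → Fin 2 → ℝ,
      ContinuousOn a e.target ∧ ContinuousOn b e.target ∧ ∀ z ∈ e.target,
        IsNullFrame (x ∘ e.symm) z (a z) (b z) ∧
        secondFormVec (x ∘ e.symm) z (a z) (b z) = 0 ∧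
        sp (secondFormVec (x ∘ e.symm) z (a z) (a z))
          (secondFormVec (x ∘ e.symm) z (a z) (a z)) = 0 ∧
        sp (secondFormVec (x ∘ e.symm) z (a z) (a z))
          (secondFormVec (x ∘ e.symm) z (b z) (b z)) = 2 / 3 := by
  obtain ⟨I, α, hα, hα2, A, hA, e, he, hpe, hxe⟩ := h p
  have hy := hx.isLorentzPatch he
  set L : E52 →L[ℝ] E52 := A.toLinearMap.toContinuousLinearMap with hL
  have hLA : ∀ v, L v = A v := fun v => rfl
  have hβ : IsNormalizedNullCurve I (fun t => L (α t)) := by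
    refine ⟨hα.isOpen, L.contDiff.comp_contDiffOn hα.smooth, fun t ht => ?_, fun t ht => ?_,
      fun t ht => ?_⟩
    all_goals rw [iteratedDeriv_linear_comp hα.isOpen hα.smooth L _ t ht, hLA, hA]
    · simpa using hα.lightCone t ht
    · simpa [iteratedDeriv_one] using hα.null t ht
    · exact hα2 t ht
  have hU : ∀ z ∈ e.target, z 1 ∈ I ∧
      (x ∘ e.symm) z = model (fun t => L (α t)) (z 0) (z 1) := by
    intro z hz
    obtain ⟨h1, h2⟩ := hxe (e.symm z) (e.map_target hz)
    rw [e.right_inv hz] at h1 h2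
    refine ⟨h1, ?_⟩
    rw [Function.comp_apply, h2, ← hLA,
      model_linear_comp hα.isOpen hα.smooth L (fun v w => by rw [hLA, hLA, hA]) _ h1]
  refine ⟨e, he, hpe, fun _ => ![1, 0], fun z => ![metric (x ∘ e.symm) z 1 1 / 2, 1],
    continuousOn_const, continuousOn_pi.2 fun i => ?_, fun z hz => hβ.nullFrame_model hy hU hz⟩
  fin_cases i
  · exact (hy.contDiffOn_metric 1 1).continuousOn.div_const _
  · exact continuousOn_const

/-- The value at `p` of the normal curvature, as the determinant `frameDet` in some chart and some
null frame. -/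
def IsFrameDetAt (x : M → E52) (p : M) (k : ℝ) : Prop :=
  ∃ e ∈ IsManifold.maximalAtlas (𝓡 2) ∞ M, p ∈ e.source ∧ ∃ a b : Fin 2 → ℝ,
    IsNullFrame (x ∘ e.symm) (e p) a b ∧ frameDet (x ∘ e.symm) (e p) a b = k

lemma IsLorentzianSurface.isNullFrame_transfer (hx : IsLorentzianSurface x)
    {e e' : OpenPartialHomeomorph M Plane} (he : e ∈ IsManifold.maximalAtlas (𝓡 2) ∞ M)
    (he' : e' ∈ IsManifold.maximalAtlas (𝓡 2) ∞ M) {p : M} (hp : p ∈ e.source)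
    (hp' : p ∈ e'.source) {a b : Fin 2 → ℝ} (h : IsNullFrame (x ∘ e.symm) (e p) a b) :
    ∃ a' b', IsNullFrame (x ∘ e'.symm) (e' p) a' b' ∧
      secondFormVec (x ∘ e'.symm) (e' p) a' a' = secondFormVec (x ∘ e.symm) (e p) a a ∧
      secondFormVec (x ∘ e'.symm) (e' p) a' b' = secondFormVec (x ∘ e.symm) (e p) a b ∧
      secondFormVec (x ∘ e'.symm) (e' p) b' b' = secondFormVec (x ∘ e.symm) (e p) b b ∧
      frameDet (x ∘ e'.symm) (e' p) a' b' = frameDet (x ∘ e.symm) (e p) a b := by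
  obtain ⟨J, hJ1, hJ2⟩ := hx.exists_pushVec he he' hp hp'
  refine ⟨J a, J b, ⟨?_, ?_, ?_⟩, (hJ2 _ _).symm, (hJ2 _ _).symm, (hJ2 _ _).symm, ?_⟩
  · rw [← hJ1, h.h11]
  · rw [← hJ1, h.h22]
  · rw [← hJ1, ← hJ1, h.h12]
  · simp only [frameDet, ← hJ1, ← hJ2, Function.comp_apply, e.left_inv hp, e'.left_inv hp']

lemma IsLorentzianSurface.isFrameDetAt_unique (hx : IsLorentzianSurface x) {p : M} {k l : ℝ}
    (hk : IsFrameDetAt x p k) (hl : IsFrameDetAt x p l) : k = l := by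
  obtain ⟨e, he, hp, a, b, hab, rfl⟩ := hk
  obtain ⟨e', he', hp', a', b', hab', rfl⟩ := hl
  obtain ⟨a'', b'', h1, -, -, -, h2⟩ := hx.isNullFrame_transfer he he' hp hp' hab
  rw [← h2]
  exact hab'.frameDet_eq (hx.lorentzian e' he' p hp').ne h1

theorem IsCongruentToModel.curvatures [ConnectedSpace M]
    (hx : IsLorentzianSurface x) (h : IsCongruentToModel x) :
    IsMinimal x ∧ HasGaussCurvature x (1 / 3) ∧
      ∃ KD : ℝ, KD ≠ 0 ∧ HasNormalCurvature x KD := by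
  have transfer : ∀ e ∈ IsManifold.maximalAtlas (𝓡 2) ∞ M, ∀ p ∈ e.source, ∃ a b : Fin 2 → ℝ,
      IsNullFrame (x ∘ e.symm) (e p) a b ∧ secondFormVec (x ∘ e.symm) (e p) a b = 0 ∧
      sp (secondFormVec (x ∘ e.symm) (e p) a a) (secondFormVec (x ∘ e.symm) (e p) a a) = 0 ∧
      sp (secondFormVec (x ∘ e.symm) (e p) a a) (secondFormVec (x ∘ e.symm) (e p) b b) = 2 / 3 := by
    intro e he p hp
    obtain ⟨e₀, he₀, hp₀, a, b, -, -, hab⟩ := h.exists_nullFrame hx p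
    obtain ⟨h1, h2, h3, h4⟩ := hab _ (e₀.map_source hp₀)
    obtain ⟨a', b', k1, kaa, kab, kbb, -⟩ := hx.isNullFrame_transfer he₀ he hp₀ hp h1
    refine ⟨a', b', k1, ?_⟩
    rw [kab, kaa, kbb]
    exact ⟨h2, h3, h4⟩
  have hsq : ∀ p k, IsFrameDetAt x p k → k = 2 / 3 ∨ k = -(2 / 3) := by
    rintro p k ⟨e, he, hp, a, b, hab, rfl⟩
    obtain ⟨a', b', h1, -, h3, h4⟩ := transfer e he p hp
    have e1 := (hx.isLorentzPatch he).frameDet_sq (e.map_source hp) h1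
    rw [h3, h4, h1.frameDet_eq (hx.lorentzian e he p hp).ne hab |>.symm] at e1
    have : (frameDet (x ∘ e.symm) (e p) a b - 2 / 3)
        * (frameDet (x ∘ e.symm) (e p) a b + 2 / 3) = 0 := by linear_combination e1
    rcases mul_eq_zero.1 this with h0 | h0
    · left; linarith
    · right; linarith
  -- the set where the normal curvature has a given sign is open
  have hopen : ∀ ε : ℝ, ε ≠ 0 → IsOpen {p : M | IsFrameDetAt x p (ε * (2 / 3))} := by
    intro ε hε
    rw [isOpen_iff_mem_nhds]
    intro p hp
    obtain ⟨e, he, hpe, a, b, ha, hb, hab⟩ := h.exists_nullFrame hx p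
    have hloc : ∀ p' ∈ e.source, IsFrameDetAt x p'
        (frameDet (x ∘ e.symm) (e p') (a (e p')) (b (e p'))) := fun p' hp' =>
      ⟨e, he, hp', _, _, (hab _ (e.map_source hp')).1, rfl⟩
    have hc : ContinuousOn (fun p' => ε * frameDet (x ∘ e.symm) (e p') (a (e p')) (b (e p')))
        e.source := by
      have h1 := (hx.isLorentzPatch he).continuousOn_frameDet ha hb
      exact continuousOn_const.mul (ContinuousOn.comp
        (g := fun z => frameDet (x ∘ e.symm) z (a z) (b z)) (f := e) h1 e.continuousOn e.mapsTo)
    have hpos : 0 < ε * frameDet (x ∘ e.symm) (e p) (a (e p)) (b (e p)) := by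
      rw [hx.isFrameDetAt_unique (hloc p hpe) hp]
      have := pow_pos (abs_pos.2 hε) 2
      rw [sq_abs] at this
      nlinarith
    filter_upwards [(hc.continuousAt (e.open_source.mem_nhds hpe)).eventually (lt_mem_nhds hpos),
      e.open_source.mem_nhds hpe] with p' hp' hpe'
    have hv := hloc p' hpe'
    have hεp := hsq p _ hp
    rcases hsq p' _ hv with h1 | h1 <;> rw [h1] at hp' hv <;> rcases hεp with h2 | h2
    · rw [h2]; exact hv
    · exfalso; linarith
    · exfalso; linarith
    · rw [h2]; exact hv
  have hcover : ∀ p, IsFrameDetAt x p (1 * (2 / 3)) ∨ IsFrameDetAt x p (-1 * (2 / 3)) := by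
    intro p
    obtain ⟨e, he, hp, a, b, -, -, hab⟩ := h.exists_nullFrame hx p
    have hd : IsFrameDetAt x p (frameDet (x ∘ e.symm) (e p) (a (e p)) (b (e p))) :=
      ⟨e, he, hp, _, _, (hab _ (e.map_source hp)).1, rfl⟩
    rcases hsq p _ hd with h1 | h1 <;> rw [h1] at hd
    · left; simpa using hd
    · right; simpa using hd
  have hclopen : IsClopen {p : M | IsFrameDetAt x p (1 * (2 / 3))} := by
    refine ⟨⟨?_⟩, hopen 1 one_ne_zero⟩
    have : {p : M | IsFrameDetAt x p (1 * (2 / 3))}ᶜ =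
        {p : M | IsFrameDetAt x p (-1 * (2 / 3))} := by
      ext p
      refine ⟨fun hp => (hcover p).resolve_left hp, fun hp hp' => ?_⟩
      have := hx.isFrameDetAt_unique hp hp'
      norm_num at this
    rw [this]
    exact hopen (-1) (by norm_num)
  have hconst : ∃ k : ℝ, k ≠ 0 ∧ ∀ p, IsFrameDetAt x p k := by
    rcases isClopen_iff.1 hclopen with h0 | h0
    · refine ⟨-1 * (2 / 3), by norm_num, fun p => (hcover p).resolve_left fun hp => ?_⟩
      have : p ∈ ({p : M | IsFrameDetAt x p (1 * (2 / 3))} : Set M) := hp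
      rw [h0] at this
      exact this
    · refine ⟨1 * (2 / 3), by norm_num, fun p => ?_⟩
      have : p ∈ ({p : M | IsFrameDetAt x p (1 * (2 / 3))} : Set M) := by rw [h0]; trivial
      exact this
  obtain ⟨k, hk0, hk⟩ := hconst
  refine ⟨fun e he p hp => ?_, fun e he p hp => ?_, k, hk0, fun e he p hp a b f₃ f₄ hf => ?_⟩
  · obtain ⟨a, b, h1, h2, -⟩ := transfer e he p hp
    rw [(hx.isLorentzPatch he).meanCurvature_eq (e.map_source hp) h1, h2, neg_zero]
  · obtain ⟨a, b, h1, h2, -, h4⟩ := transfer e he p hp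
    rw [(hx.isLorentzPatch he).gaussCurvature_eq_nullFrame (e.map_source hp) h1, h2, h4,
      sp_zero_left]
    norm_num
  · rw [(hx.isLorentzPatch he).normalCurvature_eq_frameDet (e.map_source hp) hf]
    exact hx.isFrameDetAt_unique ⟨e, he, hp, a, b, ⟨hf.h11, hf.h22, hf.h12⟩, rfl⟩ (hk p)

end Converse

/-! ### The structure equations of a minimal surface in a moving null frame -/

lemma dirDeriv_neg {F : Type*} [NormedAddCommGroup F] [NormedSpace ℝ F] {X : Plane → Plane}
    {f : Plane → F} {q : Plane} : dirDeriv X (fun p => -f p) q = -dirDeriv X f q := by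
  simp [dirDeriv, fderiv_fun_neg]

lemma sp_dirDeriv_add {V : Set Plane} (hV : IsOpen V) {f g : Plane → E52}
    (hf : ContDiffOn ℝ ∞ f V) (hg : ContDiffOn ℝ ∞ g V) {c : ℝ} (h : ∀ q ∈ V, sp (f q) (g q) = c)
    (X : Plane → Plane) {q : Plane} (hq : q ∈ V) :
    sp (dirDeriv X f q) (g q) + sp (f q) (dirDeriv X g q) = 0 := by
  rw [← dirDeriv_sp (differentiableAt_of_contDiffOn hV hf hq)
    (differentiableAt_of_contDiffOn hV hg hq), dirDeriv_congr hV h hq, dirDeriv_const]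

/-- The structure equations of a minimal Lorentzian surface `y` in `𝕊⁴₂(1)`, with respect to null
vector fields `X₁`, `X₂` with scalar product `-1`. Here `P`, `Q` are the values of the second
fundamental form on `(X₁, X₁)` and `(X₂, X₂)`, while `∇ X₁ = θ X₁`, `∇ X₂ = -θ X₂` with
`θᵢ = θ(Xᵢ)`. The Gauss curvature `1 - k` and the square `k² - m` of the normal curvature are
constant, and the latter does not vanish. -/
structure IsMovingFrame (V : Set Plane) (y : Plane → E52) (X₁ X₂ : Plane → Plane)
    (P Q : Plane → E52) (θ₁ θ₂ : Plane → ℝ) (k m : ℝ) : Prop where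
  isOpen : IsOpen V
  smooth : ContDiffOn ℝ ∞ y V
  smooth₁ : ContDiffOn ℝ ∞ X₁ V
  smooth₂ : ContDiffOn ℝ ∞ X₂ V
  smoothP : ContDiffOn ℝ ∞ P V
  smoothQ : ContDiffOn ℝ ∞ Q V
  smoothθ₁ : ContDiffOn ℝ ∞ θ₁ V
  smoothθ₂ : ContDiffOn ℝ ∞ θ₂ V
  d11 : ∀ q ∈ V, dirDeriv X₁ (dirDeriv X₁ y) q = θ₁ q • dirDeriv X₁ y q + P q
  d21 : ∀ q ∈ V, dirDeriv X₂ (dirDeriv X₁ y) q = θ₂ q • dirDeriv X₁ y q + y q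
  d12 : ∀ q ∈ V, dirDeriv X₁ (dirDeriv X₂ y) q = (-θ₁ q) • dirDeriv X₂ y q + y q
  d22 : ∀ q ∈ V, dirDeriv X₂ (dirDeriv X₂ y) q = (-θ₂ q) • dirDeriv X₂ y q + Q q
  sp11 : ∀ q ∈ V, sp (dirDeriv X₁ y q) (dirDeriv X₁ y q) = 0
  sp22 : ∀ q ∈ V, sp (dirDeriv X₂ y q) (dirDeriv X₂ y q) = 0
  sp12 : ∀ q ∈ V, sp (dirDeriv X₁ y q) (dirDeriv X₂ y q) = -1
  unit : ∀ q ∈ V, sp (y q) (y q) = 1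
  sp1y : ∀ q ∈ V, sp (dirDeriv X₁ y q) (y q) = 0
  sp2y : ∀ q ∈ V, sp (dirDeriv X₂ y q) (y q) = 0
  spP1 : ∀ q ∈ V, sp (P q) (dirDeriv X₁ y q) = 0
  spP2 : ∀ q ∈ V, sp (P q) (dirDeriv X₂ y q) = 0
  spPy : ∀ q ∈ V, sp (P q) (y q) = 0
  spQ1 : ∀ q ∈ V, sp (Q q) (dirDeriv X₁ y q) = 0
  spQ2 : ∀ q ∈ V, sp (Q q) (dirDeriv X₂ y q) = 0
  spQy : ∀ q ∈ V, sp (Q q) (y q) = 0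
  spPQ : ∀ q ∈ V, sp (P q) (Q q) = k
  spPP_mul : ∀ q ∈ V, sp (P q) (P q) * sp (Q q) (Q q) = m
  ne : k ^ 2 ≠ m
  bracket : ∀ q ∈ V, VectorField.lieBracket ℝ X₁ X₂ q = (-θ₂ q) • X₁ q + (-θ₁ q) • X₂ q

namespace IsMovingFrame

variable {V : Set Plane} {y : Plane → E52} {X₁ X₂ : Plane → Plane} {P Q : Plane → E52}
  {θ₁ θ₂ : Plane → ℝ} {k m : ℝ} (h : IsMovingFrame V y X₁ X₂ P Q θ₁ θ₂ k m)
include h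

/-- The roles of the two null directions can be exchanged. -/
lemma swap : IsMovingFrame V y X₂ X₁ Q P (fun q => -θ₂ q) (fun q => -θ₁ q) k m where
  isOpen := h.isOpen
  smooth := h.smooth
  smooth₁ := h.smooth₂
  smooth₂ := h.smooth₁
  smoothP := h.smoothQ
  smoothQ := h.smoothP
  smoothθ₁ := h.smoothθ₂.neg
  smoothθ₂ := h.smoothθ₁.neg
  d11 := h.d22
  d21 := h.d12
  d12 q hq := by rw [neg_neg]; exact h.d21 q hq
  d22 q hq := by rw [neg_neg]; exact h.d11 q hq
  sp11 := h.sp22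
  sp22 := h.sp11
  sp12 q hq := by rw [sp_comm]; exact h.sp12 q hq
  unit := h.unit
  sp1y := h.sp2y
  sp2y := h.sp1y
  spP1 := h.spQ2
  spP2 := h.spQ1
  spPy := h.spQy
  spQ1 := h.spP2
  spQ2 := h.spP1
  spQy := h.spPy
  spPQ q hq := by rw [sp_comm]; exact h.spPQ q hq
  spPP_mul q hq := by rw [mul_comm]; exact h.spPP_mul q hq
  ne := h.ne
  bracket q hq := by
    rw [VectorField.lieBracket_swap, h.bracket q hq]; module

lemma mono {V' : Set Plane} (hV' : IsOpen V') (hVV' : V' ⊆ V) :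
    IsMovingFrame V' y X₁ X₂ P Q θ₁ θ₂ k m where
  isOpen := hV'
  smooth := h.smooth.mono hVV'
  smooth₁ := h.smooth₁.mono hVV'
  smooth₂ := h.smooth₂.mono hVV'
  smoothP := h.smoothP.mono hVV'
  smoothQ := h.smoothQ.mono hVV'
  smoothθ₁ := h.smoothθ₁.mono hVV'
  smoothθ₂ := h.smoothθ₂.mono hVV'
  d11 q hq := h.d11 q (hVV' hq)
  d21 q hq := h.d21 q (hVV' hq)
  d12 q hq := h.d12 q (hVV' hq)
  d22 q hq := h.d22 q (hVV' hq)
  sp11 q hq := h.sp11 q (hVV' hq)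
  sp22 q hq := h.sp22 q (hVV' hq)
  sp12 q hq := h.sp12 q (hVV' hq)
  unit q hq := h.unit q (hVV' hq)
  sp1y q hq := h.sp1y q (hVV' hq)
  sp2y q hq := h.sp2y q (hVV' hq)
  spP1 q hq := h.spP1 q (hVV' hq)
  spP2 q hq := h.spP2 q (hVV' hq)
  spPy q hq := h.spPy q (hVV' hq)
  spQ1 q hq := h.spQ1 q (hVV' hq)
  spQ2 q hq := h.spQ2 q (hVV' hq)
  spQy q hq := h.spQy q (hVV' hq)
  spPQ q hq := h.spPQ q (hVV' hq)
  spPP_mul q hq := h.spPP_mul q (hVV' hq)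
  ne := h.ne
  bracket q hq := h.bracket q (hVV' hq)

lemma comm {F : Type*} [NormedAddCommGroup F] [NormedSpace ℝ F] {f : Plane → F}
    (hf : ContDiffOn ℝ ∞ f V) {q : Plane} (hq : q ∈ V) :
    dirDeriv X₁ (dirDeriv X₂ f) q - dirDeriv X₂ (dirDeriv X₁ f) q =
      (-θ₂ q) • dirDeriv X₁ f q + (-θ₁ q) • dirDeriv X₂ f q := by
  have e := VectorField.fderiv_apply_lieBracket (𝕜 := ℝ) (hf.contDiffAt (h.isOpen.mem_nhds hq))
    (by rw [minSmoothness_of_isRCLikeNormedField]; exact WithTop.coe_le_coe.2 le_top)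
    (differentiableAt_of_contDiffOn h.isOpen h.smooth₂ hq)
    (differentiableAt_of_contDiffOn h.isOpen h.smooth₁ hq)
  rw [h.bracket q hq, map_add, map_smul, map_smul] at e
  exact e.symm

lemma smoothE₁ : ContDiffOn ℝ ∞ (dirDeriv X₁ y) V := contDiffOn_dirDeriv h.isOpen h.smooth h.smooth₁

lemma smoothE₂ : ContDiffOn ℝ ∞ (dirDeriv X₂ y) V := contDiffOn_dirDeriv h.isOpen h.smooth h.smooth₂

lemma diff {F : Type*} [NormedAddCommGroup F] [NormedSpace ℝ F] {f : Plane → F}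
    (hf : ContDiffOn ℝ ∞ f V) {q : Plane} (hq : q ∈ V) : DifferentiableAt ℝ f q :=
  differentiableAt_of_contDiffOn h.isOpen hf hq

/-- The tangential and the normal part of the integrability condition for `X₁ y`: the Gauss
equation and the Codazzi equation. -/
lemma codazzi₂ {q : Plane} (hq : q ∈ V) :
    dirDeriv X₁ θ₂ q - dirDeriv X₂ θ₁ q + 2 * θ₁ q * θ₂ q = k - 1 ∧
    dirDeriv X₂ P q = k • dirDeriv X₁ y q + (2 * θ₂ q) • P q := by
  have c := h.comm h.smoothE₁ hq
  have e1 : dirDeriv X₁ (dirDeriv X₂ (dirDeriv X₁ y)) q =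
      dirDeriv X₁ θ₂ q • dirDeriv X₁ y q + θ₂ q • (θ₁ q • dirDeriv X₁ y q + P q)
        + dirDeriv X₁ y q := by
    rw [dirDeriv_congr h.isOpen h.d21 hq, dirDeriv_add
      ((h.diff h.smoothθ₂ hq).fun_smul (h.diff h.smoothE₁ hq)) (h.diff h.smooth hq),
      dirDeriv_smul (h.diff h.smoothθ₂ hq) (h.diff h.smoothE₁ hq), h.d11 q hq]
  have e2 : dirDeriv X₂ (dirDeriv X₁ (dirDeriv X₁ y)) q =
      dirDeriv X₂ θ₁ q • dirDeriv X₁ y q + θ₁ q • (θ₂ q • dirDeriv X₁ y q + y q)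
        + dirDeriv X₂ P q := by
    rw [dirDeriv_congr h.isOpen h.d11 hq, dirDeriv_add
      ((h.diff h.smoothθ₁ hq).fun_smul (h.diff h.smoothE₁ hq)) (h.diff h.smoothP hq),
      dirDeriv_smul (h.diff h.smoothθ₁ hq) (h.diff h.smoothE₁ hq), h.d21 q hq]
  rw [e1, e2, h.d11 q hq, h.d21 q hq] at c
  have e3 : dirDeriv X₂ P q = (dirDeriv X₁ θ₂ q - dirDeriv X₂ θ₁ q + 1 + 2 * θ₁ q * θ₂ q) •
      dirDeriv X₁ y q + (2 * θ₂ q) • P q := by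
    linear_combination (norm := module) -c
  have e4 := sp_dirDeriv_add h.isOpen h.smoothP h.smoothE₂ h.spP2 X₂ hq
  rw [e3, h.d22 q hq] at e4
  simp only [sp_add_left, sp_add_right, sp_smul_left, sp_smul_right, h.sp12 q hq, h.spP2 q hq,
    h.spPQ q hq] at e4
  have e5 : dirDeriv X₁ θ₂ q - dirDeriv X₂ θ₁ q + 2 * θ₁ q * θ₂ q = k - 1 := by linarith
  refine ⟨e5, ?_⟩
  rw [e3]
  congr 2
  linarith

lemma codazzi₁ {q : Plane} (hq : q ∈ V) :
    dirDeriv X₁ Q q = k • dirDeriv X₂ y q + (-(2 * θ₁ q)) • Q q := by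
  rw [(h.swap.codazzi₂ hq).2]
  module

lemma eq_zero_of_orthogonal {q : Plane} (hq : q ∈ V) {w : E52}
    (h1 : sp w (dirDeriv X₁ y q) = 0) (h2 : sp w (dirDeriv X₂ y q) = 0) (hP : sp w (P q) = 0)
    (hQ : sp w (Q q) = 0) (hy : sp w (y q) = 0) : w = 0 := by
  have e := det_mul_det_of_adapted (h.sp11 q hq) (h.sp22 q hq) (h.sp12 q hq) (h.unit q hq)
    (h.sp1y q hq) (h.sp2y q hq) (h.spP1 q hq) (h.spP2 q hq) (h.spPy q hq) (h.spQ1 q hq)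
    (h.spQ2 q hq) (h.spQy q hq) (h.spP1 q hq) (h.spP2 q hq) (h.spPy q hq) (h.spQ1 q hq)
    (h.spQ2 q hq) (h.spQy q hq)
  rw [sp_comm (Q q) (P q), h.spPQ q hq, h.spPP_mul q hq] at e
  have hdet : (Matrix.of ![dirDeriv X₁ y q, dirDeriv X₂ y q, P q, Q q, y q]).det ≠ 0 := by
    intro h0
    rw [h0] at e
    exact h.ne (by linear_combination -e)
  refine eq_zero_of_sp_eq_zero hdet fun i => ?_
  rw [sp_comm]
  fin_cases i
  exacts [h1, h2, hP, hQ, hy]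

lemma dirDeriv_spPP {q : Plane} (hq : q ∈ V) :
    dirDeriv X₂ (fun p => sp (P p) (P p)) q = 4 * θ₂ q * sp (P q) (P q) := by
  rw [dirDeriv_sp (h.diff h.smoothP hq) (h.diff h.smoothP hq), (h.codazzi₂ hq).2]
  simp only [sp_add_left, sp_add_right, sp_smul_left, sp_smul_right, h.spP1 q hq,
    sp_comm (dirDeriv X₁ y q)]
  ring

lemma dirDeriv_spQQ {q : Plane} (hq : q ∈ V) :
    dirDeriv X₁ (fun p => sp (Q p) (Q p)) q = -(4 * θ₁ q) * sp (Q q) (Q q) := by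
  rw [h.swap.dirDeriv_spPP hq]; ring

/-- If neither `P` nor `Q` were null, the Levi-Civita connection and the normal connection would
both be flat. -/
lemma m_eq_zero (hV : V.Nonempty) : m = 0 := by
  by_contra hm
  obtain ⟨q, hq⟩ := hV
  set φ : Plane → ℝ := fun p => sp (P p) (P p) with hφ
  set ψ : Plane → ℝ := fun p => sp (Q p) (Q p) with hψ
  have sφ : ContDiffOn ℝ ∞ φ V := h.smoothP.sp h.smoothP
  have sψ : ContDiffOn ℝ ∞ ψ V := h.smoothQ.sp h.smoothQ
  have hφψ : ∀ q ∈ V, φ q * ψ q = m := h.spPP_mul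
  have hφ2 : ∀ q ∈ V, dirDeriv X₂ φ q = 4 * θ₂ q * φ q := fun q hq => h.dirDeriv_spPP hq
  have hφ1 : ∀ q ∈ V, dirDeriv X₁ φ q = 4 * θ₁ q * φ q := by
    intro q hq
    have e := dirDeriv_congr (X := X₁) h.isOpen hφψ hq
    rw [dirDeriv_mul (h.diff sφ hq) (h.diff sψ hq), dirDeriv_const, h.dirDeriv_spQQ hq] at e
    have hψ0 : ψ q ≠ 0 := by
      intro h0
      exact hm (by rw [← hφψ q hq, h0, mul_zero])
    apply mul_right_cancel₀ hψ0
    linear_combination e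
  have hφ0 : φ q ≠ 0 := by
    intro h0
    exact hm (by rw [← hφψ q hq, h0, zero_mul])
  -- integrability condition for `φ`
  have cφ := h.comm sφ hq
  have s4 : ∀ i : Plane → ℝ, ContDiffOn ℝ ∞ i V → DifferentiableAt ℝ (fun p => 4 * i p) q :=
    fun i hi => (h.diff hi hq).const_mul 4
  have d4 : ∀ (X : Plane → Plane) (i : Plane → ℝ), ContDiffOn ℝ ∞ i V →
      dirDeriv X (fun p => 4 * i p) q = 4 * dirDeriv X i q := by
    intro X i hi
    rw [dirDeriv_mul (differentiableAt_const _) (h.diff hi hq), dirDeriv_const]; ring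
  rw [dirDeriv_congr h.isOpen hφ2 hq, dirDeriv_congr h.isOpen hφ1 hq,
    dirDeriv_mul (s4 _ h.smoothθ₂) (h.diff sφ hq), dirDeriv_mul (s4 _ h.smoothθ₁) (h.diff sφ hq),
    d4 _ _ h.smoothθ₂, d4 _ _ h.smoothθ₁, hφ1 q hq, hφ2 q hq] at cφ
  have hk : dirDeriv X₁ θ₂ q - dirDeriv X₂ θ₁ q + 2 * θ₁ q * θ₂ q = 0 := by
    apply mul_right_cancel₀ hφ0
    simp only [smul_eq_mul] at cφ
    linear_combination (1 / 4) * cφ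
  -- integrability condition for `P`
  have dP1 : ∀ q ∈ V, dirDeriv X₁ P q = (2 * θ₁ q) • P q + φ q • dirDeriv X₂ y q := by
    intro q hq
    have t1 := sp_dirDeriv_add h.isOpen h.smoothP h.smoothE₁ h.spP1 X₁ hq
    have t2 := sp_dirDeriv_add h.isOpen h.smoothP h.smoothE₂ h.spP2 X₁ hq
    have ty := sp_dirDeriv_add h.isOpen h.smoothP h.smooth h.spPy X₁ hq
    have tQ := sp_dirDeriv_add h.isOpen h.smoothP h.smoothQ h.spPQ X₁ hq
    have tP := hφ1 q hq
    rw [dirDeriv_sp (h.diff h.smoothP hq) (h.diff h.smoothP hq), sp_comm (P q) _] at tP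
    rw [h.d11 q hq] at t1
    rw [h.d12 q hq] at t2
    rw [h.codazzi₁ hq] at tQ
    simp only [sp_add_right, sp_smul_right, h.spP1 q hq, h.spP2 q hq, h.spPy q hq,
      h.spPQ q hq] at t1 t2 ty tQ
    rw [← sub_eq_zero]
    refine h.eq_zero_of_orthogonal hq ?_ ?_ ?_ ?_ ?_ <;>
      simp only [sp_sub_left, sp_add_left, sp_smul_left, h.spP1 q hq, h.spP2 q hq, h.spPy q hq,
        h.sp22 q hq, h.sp2y q hq, h.spPQ q hq, sp_comm (dirDeriv X₂ y q) (dirDeriv X₁ y q),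
        h.sp12 q hq, sp_comm (dirDeriv X₂ y q) (P q), sp_comm (dirDeriv X₂ y q) (Q q),
        h.spQ2 q hq, hφ] at *
    · linear_combination t1
    · linear_combination t2
    · linear_combination (1 / 2) * tP
    · linear_combination tQ
    · linear_combination ty
  have cP := h.comm h.smoothP hq
  have dk : dirDeriv X₁ (fun _ : Plane => k) q = 0 := dirDeriv_const _ _
  have d2 : ∀ (X : Plane → Plane) (i : Plane → ℝ), ContDiffOn ℝ ∞ i V →
      dirDeriv X (fun p => 2 * i p) q = 2 * dirDeriv X i q := by
    intro X i hi
    rw [dirDeriv_mul (differentiableAt_const _) (h.diff hi hq), dirDeriv_const]; ring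
  have s2 : ∀ i : Plane → ℝ, ContDiffOn ℝ ∞ i V → DifferentiableAt ℝ (fun p => 2 * i p) q :=
    fun i hi => (h.diff hi hq).const_mul 2
  have e1 : dirDeriv X₁ (dirDeriv X₂ P) q = k • (θ₁ q • dirDeriv X₁ y q + P q)
      + ((2 * dirDeriv X₁ θ₂ q) • P q + (2 * θ₂ q) • dirDeriv X₁ P q) := by
    rw [dirDeriv_congr h.isOpen (fun q hq => (h.codazzi₂ hq).2) hq, dirDeriv_add
      ((differentiableAt_const k).fun_smul (h.diff h.smoothE₁ hq))
      ((s2 _ h.smoothθ₂).fun_smul (h.diff h.smoothP hq)),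
      dirDeriv_smul (differentiableAt_const k) (h.diff h.smoothE₁ hq), dk,
      dirDeriv_smul (s2 _ h.smoothθ₂) (h.diff h.smoothP hq), h.d11 q hq, d2 _ _ h.smoothθ₂]
    module
  have e2 : dirDeriv X₂ (dirDeriv X₁ P) q = (2 * dirDeriv X₂ θ₁ q) • P q
      + (2 * θ₁ q) • dirDeriv X₂ P q + (dirDeriv X₂ φ q • dirDeriv X₂ y q
      + φ q • ((-θ₂ q) • dirDeriv X₂ y q + Q q)) := by
    rw [dirDeriv_congr h.isOpen dP1 hq, dirDeriv_add
      ((s2 _ h.smoothθ₁).fun_smul (h.diff h.smoothP hq))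
      ((h.diff sφ hq).fun_smul (h.diff h.smoothE₂ hq)),
      dirDeriv_smul (s2 _ h.smoothθ₁) (h.diff h.smoothP hq),
      dirDeriv_smul (h.diff sφ hq) (h.diff h.smoothE₂ hq), h.d22 q hq, d2 _ _ h.smoothθ₁]
  rw [e1, e2, dP1 q hq, (h.codazzi₂ hq).2] at cP
  have cQ := congrArg (fun w => sp w (Q q)) cP
  simp only [sp_sub_left, sp_add_left, sp_smul_left, h.spPQ q hq,
    sp_comm (dirDeriv X₁ y q) (Q q), sp_comm (dirDeriv X₂ y q) (Q q), h.spQ1 q hq,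
    h.spQ2 q hq] at cQ
  apply h.ne
  have e3 : φ q * sp (Q q) (Q q) = m := hφψ q hq
  linear_combination cQ - 2 * k * hk + e3

/-- Where `Q` is null, its direction is parallel along `X₂`. -/
lemma dirDeriv_Q_of_null (hQ : ∀ q ∈ V, sp (Q q) (Q q) = 0) {q : Plane} (hq : q ∈ V) :
    dirDeriv X₂ Q q = (-(2 * θ₂ q)) • Q q := by
  have t1 := sp_dirDeriv_add h.isOpen h.smoothQ h.smoothE₁ h.spQ1 X₂ hq
  have t2 := sp_dirDeriv_add h.isOpen h.smoothQ h.smoothE₂ h.spQ2 X₂ hq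
  have ty := sp_dirDeriv_add h.isOpen h.smoothQ h.smooth h.spQy X₂ hq
  have tP := sp_dirDeriv_add h.isOpen h.smoothP h.smoothQ h.spPQ X₂ hq
  have tQ := sp_dirDeriv_add h.isOpen h.smoothQ h.smoothQ hQ X₂ hq
  rw [sp_comm (Q q) _] at tQ
  rw [h.d21 q hq] at t1
  rw [h.d22 q hq] at t2
  rw [(h.codazzi₂ hq).2] at tP
  simp only [sp_add_left, sp_add_right, sp_smul_left, sp_smul_right, h.spQ1 q hq, h.spQ2 q hq,
    h.spQy q hq, hQ q hq, h.spPQ q hq, sp_comm (dirDeriv X₁ y q) (Q q)] at t1 t2 ty tP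
  rw [← sub_eq_zero]
  refine h.eq_zero_of_orthogonal hq ?_ ?_ ?_ ?_ ?_ <;>
    simp only [sp_sub_left, sp_smul_left, h.spQ1 q hq, h.spQ2 q hq, h.spQy q hq, hQ q hq,
      sp_comm (Q q) (P q), h.spPQ q hq]
  · linear_combination t1
  · linear_combination t2
  · rw [sp_comm]; linear_combination tP
  · linear_combination (1 / 2) * tQ
  · linear_combination ty

lemma k_eq_of_null (hQ : ∀ q ∈ V, sp (Q q) (Q q) = 0) (hV : V.Nonempty) : k = 2 / 3 := by
  obtain ⟨q, hq⟩ := hV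
  have hm : m = 0 := by rw [← h.spPP_mul q hq, hQ q hq, mul_zero]
  have hk : k ≠ 0 := by
    intro h0; exact h.ne (by rw [h0, hm]; norm_num)
  have cQ := h.comm h.smoothQ hq
  have d2 : ∀ (X : Plane → Plane) (i : Plane → ℝ), ContDiffOn ℝ ∞ i V →
      dirDeriv X (fun p => -(2 * i p)) q = -(2 * dirDeriv X i q) := by
    intro X i hi
    rw [dirDeriv_neg, dirDeriv_mul (differentiableAt_const _) (h.diff hi hq), dirDeriv_const]
    ring
  have s2 : ∀ i : Plane → ℝ, ContDiffOn ℝ ∞ i V → DifferentiableAt ℝ (fun p => -(2 * i p)) q :=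
    fun i hi => ((h.diff hi hq).const_mul 2).fun_neg
  have e1 : dirDeriv X₁ (dirDeriv X₂ Q) q =
      (-(2 * dirDeriv X₁ θ₂ q)) • Q q + (-(2 * θ₂ q)) • dirDeriv X₁ Q q := by
    rw [dirDeriv_congr h.isOpen (fun q hq => h.dirDeriv_Q_of_null hQ hq) hq,
      dirDeriv_smul (s2 _ h.smoothθ₂) (h.diff h.smoothQ hq), d2 _ _ h.smoothθ₂]
  have e2 : dirDeriv X₂ (dirDeriv X₁ Q) q = k • ((-θ₂ q) • dirDeriv X₂ y q + Q q)
      + ((-(2 * dirDeriv X₂ θ₁ q)) • Q q + (-(2 * θ₁ q)) • dirDeriv X₂ Q q) := by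
    rw [dirDeriv_congr h.isOpen (fun q hq => h.codazzi₁ hq) hq, dirDeriv_add
      ((differentiableAt_const k).fun_smul (h.diff h.smoothE₂ hq))
      ((s2 _ h.smoothθ₁).fun_smul (h.diff h.smoothQ hq)),
      dirDeriv_smul (differentiableAt_const k) (h.diff h.smoothE₂ hq), dirDeriv_const,
      dirDeriv_smul (s2 _ h.smoothθ₁) (h.diff h.smoothQ hq), h.d22 q hq, d2 _ _ h.smoothθ₁]
    module
  rw [e1, e2, h.codazzi₁ hq, h.dirDeriv_Q_of_null hQ hq] at cQ
  have cP := congrArg (fun w => sp (P q) w) cQ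
  simp only [sp_sub_right, sp_add_right, sp_smul_right, h.spPQ q hq, h.spP2 q hq] at cP
  have hΩ := (h.codazzi₂ hq).1
  have : k * (3 * k - 2) = 0 := by linear_combination -cP - 2 * k * hΩ
  rcases mul_eq_zero.1 this with h0 | h0
  · exact absurd h0 hk
  · linarith

end IsMovingFrame

/-! ### Functions that satisfy linear equations along transverse directions -/

/-- Through each point near `q₀` there passes an integral curve, defined on an interval of uniform
length and with values in a given neighbourhood of `q₀`. -/
lemma exists_integralCurve {E : Type*} [NormedAddCommGroup E] [NormedSpace ℝ E] [CompleteSpace E]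
    {X : E → E} {q₀ : E} (hX : ContDiffAt ℝ 1 X q₀) {N : Set E} (hN : N ∈ nhds q₀) :
    ∃ r > (0 : ℝ), ∃ ε > (0 : ℝ), ∀ x ∈ Metric.closedBall q₀ r, ∃ γ : ℝ → E, γ 0 = x ∧
      ∀ t ∈ Ioo (-ε) ε, HasDerivAt γ (X (γ t)) t ∧ γ t ∈ N := by
  obtain ⟨ε, hε, a, r, L, K, hr, hpl⟩ := IsPicardLindelof.of_contDiffAt_one hX
  obtain ⟨α, hα, hc⟩ :=
    (hpl 0).exists_forall_mem_closedBall_eq_hasDerivWithinAt_continuousOn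
  have hr' : (0 : ℝ) < r := hr
  have hq : α (q₀, 0) = q₀ := (hα q₀ (Metric.mem_closedBall_self hr'.le)).1
  have hmem : Metric.closedBall q₀ r ×ˢ Icc (0 - ε) (0 + ε) ∈ nhds (q₀, (0 : ℝ)) :=
    prod_mem_nhds (Metric.closedBall_mem_nhds _ hr') (Icc_mem_nhds (by linarith) (by linarith))
  have hev : ∀ᶠ u in nhds (q₀, (0 : ℝ)), α u ∈ N :=
    (hc.continuousAt hmem).eventually (by rw [hq]; exact hN)
  obtain ⟨δ, hδ, hδN⟩ := Metric.eventually_nhds_iff_ball.1 hev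
  refine ⟨min r (δ / 2), lt_min hr' (by linarith), min ε δ, lt_min hε hδ, fun x hx => ?_⟩
  have hxr : x ∈ Metric.closedBall q₀ r := Metric.closedBall_subset_closedBall (min_le_left _ _) hx
  refine ⟨fun t => α (x, t), (hα x hxr).1, fun t ht => ⟨?_, hδN _ ?_⟩⟩
  · have ht' : t ∈ Ioo (0 - ε) (0 + ε) :=
      ⟨by linarith [ht.1, min_le_left ε δ], by linarith [ht.2, min_le_left ε δ]⟩
    exact ((hα x hxr).2 t (Ioo_subset_Icc_self ht')).hasDerivAt (Icc_mem_nhds ht'.1 ht'.2)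
  · rw [Metric.mem_ball, Prod.dist_eq, max_lt_iff]
    refine ⟨?_, ?_⟩
    · have h1 := (Metric.mem_closedBall.1 hx).trans (min_le_right _ _)
      change dist x q₀ < δ
      linarith
    · change dist t 0 < δ
      rw [Real.dist_eq, sub_zero, abs_lt]
      exact ⟨by linarith [ht.1, min_le_right ε δ], by linarith [ht.2, min_le_right ε δ]⟩

/-- A solution of a linear equation `X f = c f` that vanishes somewhere on an integral curve of `X`
vanishes on the whole curve. -/
lemma ne_zero_along_integralCurve {E : Type*} [NormedAddCommGroup E] [NormedSpace ℝ E]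
    {V : Set E} (hV : IsOpen V) {X : E → E} {f c : E → ℝ} (hf : ContDiffOn ℝ ∞ f V)
    (hc : ContinuousOn c V) (hfc : ∀ q ∈ V, dirDeriv X f q = c q * f q) {γ : ℝ → E} {ε : ℝ}
    (hγ : ∀ t ∈ Ioo (-ε) ε, HasDerivAt γ (X (γ t)) t ∧ γ t ∈ V) (h0 : f (γ 0) ≠ 0) :
    ∀ t ∈ Ioo (-ε) ε, f (γ t) ≠ 0 := by
  intro t ht hft
  apply h0
  -- run backwards from the zero at time `t` to time `0`
  have hmem : ∀ s ∈ Icc (0 : ℝ) 1, t * (1 - s) ∈ Ioo (-ε) ε := by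
    intro s hs
    have h1 : |t * (1 - s)| ≤ |t| := by
      rw [abs_mul]
      exact mul_le_of_le_one_right (abs_nonneg _)
        (abs_le.2 ⟨by linarith [hs.2], by linarith [hs.1]⟩)
    exact abs_lt.1 (h1.trans_lt (abs_lt.2 ht))
  have hd : ∀ s ∈ Icc (0 : ℝ) 1, HasDerivAt (fun s => f (γ (t * (1 - s))))
      (c (γ (t * (1 - s))) * f (γ (t * (1 - s))) * (-t)) s := by
    intro s hs
    obtain ⟨g1, g2⟩ := hγ _ (hmem s hs)
    have e1 : HasDerivAt (fun u => f (γ u)) (c (γ (t * (1 - s))) * f (γ (t * (1 - s))))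
        (t * (1 - s)) := by
      have := (differentiableAt_of_contDiffOn hV hf g2).hasFDerivAt.comp_hasDerivAt _ g1
      rw [← hfc _ g2]
      exact this
    have e2 : HasDerivAt (fun s : ℝ => t * (1 - s)) (-t) s := by
      have := ((hasDerivAt_id s).const_sub 1).const_mul t
      exact this.congr_deriv (by ring)
    exact e1.comp s e2
  have hcont : ContinuousOn (fun s => c (γ (t * (1 - s)))) (Icc 0 1) := by
    intro s hs
    obtain ⟨g1, g2⟩ := hγ _ (hmem s hs)
    have e1 : ContinuousAt (fun s : ℝ => γ (t * (1 - s))) s := by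
      have e2 : ContinuousAt (fun s : ℝ => t * (1 - s)) s := by fun_prop
      exact ContinuousAt.comp' (f := fun s : ℝ => t * (1 - s)) g1.continuousAt e2
    exact (ContinuousAt.comp' (f := fun s : ℝ => γ (t * (1 - s)))
      (hc.continuousAt (hV.mem_nhds g2)) e1).continuousWithinAt
  obtain ⟨K, hK⟩ := isCompact_Icc.exists_bound_of_continuousOn hcont
  have := eq_zero_of_abs_deriv_le_mul_abs_self_of_eq_zero_right (K := K * |t|) (a := 0) (b := 1)
    (f := fun s => f (γ (t * (1 - s)))) (fun s hs => (hd s hs).continuousAt.continuousWithinAt)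
    (fun s hs => (hd s (Ico_subset_Icc_self hs)).hasDerivWithinAt) (by simpa using hft)
    (fun s hs => by
      rw [norm_mul, norm_mul, norm_neg, Real.norm_eq_abs t]
      have := mul_le_mul_of_nonneg_right (hK s (Ico_subset_Icc_self hs))
        (mul_nonneg (norm_nonneg (f (γ (t * (1 - s))))) (abs_nonneg t))
      linarith) 1 (by simp)
  simpa using this

/-- Integral curves of two transverse vector fields through nearby points intersect. -/
lemma exists_integralCurves_intersect {E : Type*} [NormedAddCommGroup E] [NormedSpace ℝ E]
    [CompleteSpace E] {X₁ X₂ : E → E} {q₀ : E} (h₁ : ContDiffAt ℝ 1 X₁ q₀)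
    (h₂ : ContDiffAt ℝ 1 X₂ q₀) (L : (ℝ × ℝ) ≃L[ℝ] E)
    (hL : ∀ s t : ℝ, L (s, t) = s • X₁ q₀ - t • X₂ q₀) {N : Set E} (hN : N ∈ nhds q₀) :
    ∃ r > (0 : ℝ), ∀ x₁ ∈ Metric.closedBall q₀ r, ∀ x₂ ∈ Metric.closedBall q₀ r,
      ∃ γ₁ γ₂ : ℝ → E, ∃ ε₁ ε₂ : ℝ, ∃ s ∈ Ioo (-ε₁) ε₁, ∃ t ∈ Ioo (-ε₂) ε₂,
        γ₁ 0 = x₁ ∧ γ₂ 0 = x₂ ∧ γ₁ s = γ₂ t ∧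
        (∀ u ∈ Ioo (-ε₁) ε₁, HasDerivAt γ₁ (X₁ (γ₁ u)) u ∧ γ₁ u ∈ N) ∧
        ∀ u ∈ Ioo (-ε₂) ε₂, HasDerivAt γ₂ (X₂ (γ₂ u)) u ∧ γ₂ u ∈ N := by
  have hpos : 0 < ‖(L.symm : E →L[ℝ] ℝ × ℝ)‖ := L.norm_symm_pos
  set n := ‖(L.symm : E →L[ℝ] ℝ × ℝ)‖ with hn
  set c : ℝ := n⁻¹ / 4 with hc
  have hc0 : 0 < c := by positivity
  have hN' : N ∩ {q | ‖X₁ q - X₁ q₀‖ < c} ∩ {q | ‖X₂ q - X₂ q₀‖ < c} ∈ nhds q₀ := by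
    have h : ∀ X : E → E, ContDiffAt ℝ 1 X q₀ → {q | ‖X q - X q₀‖ < c} ∈ nhds q₀ := fun X hX =>
      ((hX.continuousAt.sub continuousAt_const).norm).eventually (gt_mem_nhds (by simpa using hc0))
    exact Filter.inter_mem (Filter.inter_mem hN (h X₁ h₁)) (h X₂ h₂)
  obtain ⟨r₁, hr₁, ε₁, hε₁, H₁⟩ := exists_integralCurve h₁ hN'
  obtain ⟨r₂, hr₂, ε₂, hε₂, H₂⟩ := exists_integralCurve h₂ hN'
  set ε := min ε₁ ε₂ / 2 with hε
  have hε0 : 0 < ε := by have := lt_min hε₁ hε₂; positivity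
  have hεε₁ : ε < ε₁ := by
    have := min_le_left ε₁ ε₂
    have := lt_min hε₁ hε₂
    linarith
  have hεε₂ : ε < ε₂ := by
    have := min_le_right ε₁ ε₂
    have := lt_min hε₁ hε₂
    linarith
  refine ⟨min (min r₁ r₂) (c * ε), lt_min (lt_min hr₁ hr₂) (by positivity), fun x₁ hx₁ x₂ hx₂ => ?_⟩
  obtain ⟨γ₁, hγ₁0, hγ₁⟩ := H₁ x₁ (Metric.closedBall_subset_closedBall
    ((min_le_left _ _).trans (min_le_left _ _)) hx₁)
  obtain ⟨γ₂, hγ₂0, hγ₂⟩ := H₂ x₂ (Metric.closedBall_subset_closedBall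
    ((min_le_left _ _).trans (min_le_right _ _)) hx₂)
  have hsub₁ : Icc (-ε) ε ⊆ Ioo (-ε₁) ε₁ := fun t ht => ⟨by linarith [ht.1], by linarith [ht.2]⟩
  have hsub₂ : Icc (-ε) ε ⊆ Ioo (-ε₂) ε₂ := fun t ht => ⟨by linarith [ht.1], by linarith [ht.2]⟩
  -- the integral curves are approximately straight
  have approx : ∀ (γ : ℝ → E) (X : E → E), (∀ t ∈ Icc (-ε) ε, HasDerivAt γ (X (γ t)) t ∧
      ‖X (γ t) - X q₀‖ ≤ c) → ∀ s ∈ Icc (-ε) ε, ∀ t ∈ Icc (-ε) ε,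
      ‖γ s - γ t - (s - t) • X q₀‖ ≤ c * ‖s - t‖ := by
    intro γ X hγ s hs t ht
    have := (convex_Icc (-ε) ε).norm_image_sub_le_of_norm_hasDerivWithin_le
      (f := fun t => γ t - t • X q₀) (f' := fun t => X (γ t) - (1 : ℝ) • X q₀) (C := c)
      (fun u hu => ((hγ u hu).1.sub ((hasDerivAt_id u).smul_const (X q₀))).hasDerivWithinAt)
      (fun u hu => by rw [one_smul]; exact (hγ u hu).2) ht hs
    convert this using 2
    module
  have a₁ := approx γ₁ X₁ fun t ht => ⟨(hγ₁ t (hsub₁ ht)).1, (hγ₁ t (hsub₁ ht)).2.1.2.le⟩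
  have a₂ := approx γ₂ X₂ fun t ht => ⟨(hγ₂ t (hsub₂ ht)).1, (hγ₂ t (hsub₂ ht)).2.2.le⟩
  set F : ℝ × ℝ → E := fun u => γ₁ u.1 - γ₂ u.2 with hF
  have hball : ∀ u ∈ Metric.closedBall (0 : ℝ × ℝ) ε, u.1 ∈ Icc (-ε) ε ∧ u.2 ∈ Icc (-ε) ε := by
    intro u hu
    rw [mem_closedBall_zero_iff, Prod.norm_def, max_le_iff] at hu
    exact ⟨abs_le.1 hu.1, abs_le.1 hu.2⟩
  have hFL : ApproximatesLinearOn F (L : (ℝ × ℝ) →L[ℝ] E) (Metric.closedBall 0 ε)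
      ⟨2 * c, by positivity⟩ := by
    intro u hu v hv
    have b₁ := a₁ u.1 (hball u hu).1 v.1 (hball v hv).1
    have b₂ := a₂ u.2 (hball u hu).2 v.2 (hball v hv).2
    have e : F u - F v - L (u - v) =
        (γ₁ u.1 - γ₁ v.1 - (u.1 - v.1) • X₁ q₀) - (γ₂ u.2 - γ₂ v.2 - (u.2 - v.2) • X₂ q₀) := by
      have : L (u - v) = (u.1 - v.1) • X₁ q₀ - (u.2 - v.2) • X₂ q₀ := hL _ _
      rw [this]
      simp only [hF]
      module
    rw [ContinuousLinearEquiv.coe_coe, e]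
    have n1 : ‖u.1 - v.1‖ ≤ ‖u - v‖ := norm_fst_le (u - v)
    have n2 : ‖u.2 - v.2‖ ≤ ‖u - v‖ := norm_snd_le (u - v)
    calc _ ≤ c * ‖u.1 - v.1‖ + c * ‖u.2 - v.2‖ := (norm_sub_le _ _).trans (add_le_add b₁ b₂)
      _ ≤ c * ‖u - v‖ + c * ‖u - v‖ := by gcongr
      _ = 2 * c * ‖u - v‖ := by ring
  have hsurj := hFL.surjOn_closedBall_of_nonlinearRightInverse L.toNonlinearRightInverse hε0.le
    subset_rfl
  have h0 : (0 : E) ∈ Metric.closedBall (F 0)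
      (((L.toNonlinearRightInverse.nnnorm : ℝ)⁻¹ - (⟨2 * c, by positivity⟩ : NNReal)) * ε) := by
    have e1 : (L.toNonlinearRightInverse.nnnorm : ℝ) = n := rfl
    rw [e1]
    change dist 0 (F 0) ≤ (n⁻¹ - 2 * c) * ε
    have e2 : n⁻¹ - 2 * c = 2 * c := by rw [hc]; ring
    rw [e2, dist_zero_left]
    have e3 : F 0 = (x₁ - q₀) - (x₂ - q₀) := by simp [hF, hγ₁0, hγ₂0]
    rw [e3]
    have d₁ := (Metric.mem_closedBall.1 hx₁).trans (min_le_right _ _)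
    have d₂ := (Metric.mem_closedBall.1 hx₂).trans (min_le_right _ _)
    rw [dist_eq_norm] at d₁ d₂
    linarith [norm_sub_le (x₁ - q₀) (x₂ - q₀)]
  obtain ⟨⟨s, t⟩, hst, hFst⟩ := hsurj h0
  obtain ⟨hs, ht⟩ := hball _ hst
  exact ⟨γ₁, γ₂, ε₁, ε₂, s, hsub₁ hs, t, hsub₂ ht, hγ₁0, hγ₂0, sub_eq_zero.1 hFst,
    fun u hu => ⟨(hγ₁ u hu).1, (hγ₁ u hu).2.1.1⟩, fun u hu => ⟨(hγ₂ u hu).1, (hγ₂ u hu).2.1.1⟩⟩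

/-- If the product of `φ` and `ψ` vanishes, and if they satisfy linear equations along transverse
vector fields, then one of them vanishes near a given point. -/
lemma exists_nhds_eq_zero_or_eq_zero {V : Set Plane} (hV : IsOpen V) {q₀ : Plane} (hq₀ : q₀ ∈ V)
    {X₁ X₂ : Plane → Plane} (h₁ : ContDiffOn ℝ ∞ X₁ V) (h₂ : ContDiffOn ℝ ∞ X₂ V)
    (hli : LinearIndependent ℝ ![X₁ q₀, X₂ q₀]) {φ ψ c d : Plane → ℝ}
    (hφ : ContDiffOn ℝ ∞ φ V) (hψ : ContDiffOn ℝ ∞ ψ V) (hc : ContinuousOn c V)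
    (hd : ContinuousOn d V) (hφc : ∀ q ∈ V, dirDeriv X₂ φ q = c q * φ q)
    (hψd : ∀ q ∈ V, dirDeriv X₁ ψ q = d q * ψ q) (hφψ : ∀ q ∈ V, φ q * ψ q = 0) :
    ∃ W ⊆ V, IsOpen W ∧ q₀ ∈ W ∧ ((∀ q ∈ W, φ q = 0) ∨ ∀ q ∈ W, ψ q = 0) := by
  rw [LinearIndependent.pair_iff] at hli
  let ℓ : ℝ × ℝ →ₗ[ℝ] Plane := (LinearMap.fst ℝ ℝ ℝ).smulRight (X₁ q₀)
    - (LinearMap.snd ℝ ℝ ℝ).smulRight (X₂ q₀)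
  have hℓ : ∀ s t : ℝ, ℓ (s, t) = s • X₁ q₀ - t • X₂ q₀ := fun s t => rfl
  have hinj : Function.Injective ℓ := by
    rw [← LinearMap.ker_eq_bot, LinearMap.ker_eq_bot']
    rintro ⟨s, t⟩ hst
    rw [hℓ, sub_eq_add_neg, ← neg_smul] at hst
    obtain ⟨h1, h2⟩ := hli _ _ hst
    exact Prod.ext h1 (neg_eq_zero.1 h2)
  have hdim : Module.finrank ℝ (ℝ × ℝ) = Module.finrank ℝ Plane := by simp
  let L : (ℝ × ℝ) ≃L[ℝ] Plane := (ℓ.linearEquivOfInjective hinj hdim).toContinuousLinearEquiv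
  have one_le : (1 : WithTop ℕ∞) ≤ ∞ := WithTop.coe_le_coe.2 le_top
  obtain ⟨r, hr, H⟩ := exists_integralCurves_intersect
    ((h₁.contDiffAt (hV.mem_nhds hq₀)).of_le one_le)
    ((h₂.contDiffAt (hV.mem_nhds hq₀)).of_le one_le) L hℓ (hV.mem_nhds hq₀)
  refine ⟨V ∩ Metric.ball q₀ r, inter_subset_left, hV.inter Metric.isOpen_ball,
    ⟨hq₀, Metric.mem_ball_self hr⟩, ?_⟩
  by_cases hφ0 : ∀ q ∈ V ∩ Metric.ball q₀ r, φ q = 0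
  · exact Or.inl hφ0
  · right
    push Not at hφ0
    obtain ⟨p₂, hp₂, hφp⟩ := hφ0
    intro p₁ hp₁
    by_contra hψp
    obtain ⟨γ₁, γ₂, ε₁, ε₂, s, hs, t, ht, e₁, e₂, hst, g₁, g₂⟩ :=
      H p₁ (Metric.ball_subset_closedBall hp₁.2) p₂ (Metric.ball_subset_closedBall hp₂.2)
    have n₁ := ne_zero_along_integralCurve hV hψ hd hψd g₁ (by rw [e₁]; exact hψp) s hs
    have n₂ := ne_zero_along_integralCurve hV hφ hc hφc g₂ (by rw [e₂]; exact hφp) t ht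
    rw [← hst] at n₂
    exact mul_ne_zero n₂ n₁ (hφψ _ (g₁ s hs).2)

/-! ### The coordinate functions and the null curve -/

/-- Functions `s`, `t` and maps `a n`, constant along `X₂`, in terms of which the surface `y` is
the surface `model` of the null curve `a 0`, with `a n` in the role of its `n`-th derivative with
respect to `t`. -/
structure IsModelData (V : Set Plane) (y : Plane → E52) (X₁ X₂ : Plane → Plane) (s t : Plane → ℝ)
    (a : ℕ → Plane → E52) : Prop where
  isOpen : IsOpen V
  linearIndependent : ∀ q ∈ V, LinearIndependent ℝ ![X₁ q, X₂ q]
  smooth_s : ContDiffOn ℝ ∞ s V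
  smooth_t : ContDiffOn ℝ ∞ t V
  smooth_a : ∀ n, ContDiffOn ℝ ∞ (a n) V
  dirDeriv_t_ne : ∀ q ∈ V, dirDeriv X₁ t q ≠ 0
  dirDeriv_t : ∀ q ∈ V, dirDeriv X₂ t q = 0
  dirDeriv_s_ne : ∀ q ∈ V, dirDeriv X₂ s q ≠ 0
  dirDeriv_a : ∀ n, ∀ q ∈ V, dirDeriv X₂ (a n) q = 0
  dirDeriv_a_succ : ∀ n, ∀ q ∈ V, dirDeriv X₁ (a n) q = dirDeriv X₁ t q • a (n + 1) q
  sp00 : ∀ q ∈ V, sp (a 0 q) (a 0 q) = 0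
  sp11 : ∀ q ∈ V, sp (a 1 q) (a 1 q) = 0
  sp22 : ∀ q ∈ V, sp (a 2 q) (a 2 q) = 4 / 9
  a1_ne : ∀ q ∈ V, a 1 q ≠ 0
  eq_model : ∀ q ∈ V, y q = (1 / 2 * s q ^ 2 + 27 / 40 * sp (a 3 q) (a 3 q)) • a 0 q
    + (3 / 2 * s q) • a 1 q + (3 / 2 : ℝ) • a 2 q

namespace IsMovingFrame

variable {V : Set Plane} {y : Plane → E52} {X₁ X₂ : Plane → Plane} {P Q : Plane → E52}
  {θ₁ θ₂ : Plane → ℝ} {k m : ℝ} (h : IsMovingFrame V y X₁ X₂ P Q θ₁ θ₂ k m)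
include h

lemma linearIndependent {q : Plane} (hq : q ∈ V) : LinearIndependent ℝ ![X₁ q, X₂ q] := by
  rw [LinearIndependent.pair_iff]
  intro a b hab
  have e : a • dirDeriv X₁ y q + b • dirDeriv X₂ y q = 0 := by
    have := congrArg (fderiv ℝ y q) hab
    rwa [map_add, map_smul, map_smul, map_zero] at this
  have e1 := congrArg (fun w => sp w (dirDeriv X₁ y q)) e
  have e2 := congrArg (fun w => sp w (dirDeriv X₂ y q)) e
  simp only [sp_add_left, sp_smul_left, sp_zero_left, h.sp11 q hq, h.sp22 q hq, h.sp12 q hq,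
    sp_comm (dirDeriv X₂ y q) (dirDeriv X₁ y q)] at e1 e2
  exact ⟨by linarith, by linarith⟩

/-- Where `Q` is null, its direction is constant along `X₂` but not along `X₁`, so that a suitable
quotient of two of its components is a function with nonvanishing gradient in the direction of
`X₂`. -/
lemma exists_dirDeriv_eq_zero (hQ : ∀ q ∈ V, sp (Q q) (Q q) = 0) {q₀ : Plane} (hq₀ : q₀ ∈ V) :
    ∃ W ⊆ V, IsOpen W ∧ q₀ ∈ W ∧ ∃ t : Plane → ℝ, ContDiffOn ℝ ∞ t W ∧
      (∀ q ∈ W, dirDeriv X₂ t q = 0) ∧ ∀ q ∈ W, dirDeriv X₁ t q ≠ 0 := by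
  have hk := h.k_eq_of_null hQ ⟨q₀, hq₀⟩
  have hQ0 : Q q₀ ≠ 0 := by
    intro h0
    have := h.spPQ q₀ hq₀
    rw [h0, sp_zero_right, hk] at this
    norm_num at this
  obtain ⟨l, hl⟩ := Function.ne_iff.1 hQ0
  have sQ : ∀ j, ContDiffOn ℝ ∞ (fun q => Q q j) V := contDiffOn_pi.1 h.smoothQ
  have dcomp : ∀ (X : Plane → Plane) (q : Plane) (j : Fin 5), q ∈ V →
      dirDeriv X (fun p => Q p j) q = dirDeriv X Q q j := by
    intro X q j hq
    rw [dirDeriv, dirDeriv, fderiv_pi fun i => h.diff (sQ i) hq]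
    rfl
  set W₁ : Set Plane := V ∩ (fun q => Q q l) ⁻¹' {0}ᶜ with hW₁
  have hW₁o : IsOpen W₁ := (sQ l).continuousOn.isOpen_inter_preimage h.isOpen isOpen_compl_singleton
  have hW₁V : W₁ ⊆ V := inter_subset_left
  have ht : ∀ j, ContDiffOn ℝ ∞ (fun q => Q q j / Q q l) W₁ := fun j =>
    ((sQ j).mono hW₁V).div ((sQ l).mono hW₁V) fun q hq => hq.2
  have hmul : ∀ (X : Plane → Plane) (j : Fin 5), ∀ q ∈ W₁,
      dirDeriv X (fun q => Q q j / Q q l) q * Q q l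
        + Q q j / Q q l * dirDeriv X Q q l = dirDeriv X Q q j := by
    intro X j q hq
    rw [← dcomp X q l (hW₁V hq), ← dcomp X q j (hW₁V hq),
      ← dirDeriv_mul (differentiableAt_of_contDiffOn hW₁o (ht j) hq) (h.diff (sQ l) (hW₁V hq))]
    exact dirDeriv_congr hW₁o (fun q hq => div_mul_cancel₀ _ hq.2) hq
  have hX2 : ∀ j, ∀ q ∈ W₁, dirDeriv X₂ (fun q => Q q j / Q q l) q = 0 := by
    intro j q hq
    have e := hmul X₂ j q hq
    have hne : Q q l ≠ 0 := hq.2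
    rw [h.dirDeriv_Q_of_null hQ (hW₁V hq)] at e
    simp only [Pi.smul_apply, smul_eq_mul] at e
    apply mul_right_cancel₀ hne
    rw [zero_mul]
    have e2 : Q q j / Q q l * (-(2 * θ₂ q) * Q q l) = -(2 * θ₂ q) * Q q j := by field_simp
    linarith
  have hX1 : ∃ j, dirDeriv X₁ (fun q => Q q j / Q q l) q₀ ≠ 0 := by
    by_contra hcon
    push Not at hcon
    -- otherwise `X₂ y` would be a multiple of the normal vector `Q`
    have e : dirDeriv X₂ y q₀ = (dirDeriv X₂ y q₀ l / Q q₀ l) • Q q₀ := by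
      ext j
      have e := hmul X₁ j q₀ ⟨hq₀, hl⟩
      have hne : Q q₀ l ≠ 0 := hl
      rw [hcon j, h.codazzi₁ hq₀, hk] at e
      simp only [Pi.smul_apply, Pi.add_apply, smul_eq_mul] at e ⊢
      field_simp at e ⊢
      linarith
    have e1 := h.sp12 q₀ hq₀
    rw [e, sp_smul_right, sp_comm, h.spQ1 q₀ hq₀] at e1
    norm_num at e1
  obtain ⟨j, hj⟩ := hX1
  have sX1 := contDiffOn_dirDeriv hW₁o (ht j) (h.smooth₁.mono hW₁V)
  refine ⟨W₁ ∩ (dirDeriv X₁ fun q => Q q j / Q q l) ⁻¹' {0}ᶜ, inter_subset_left.trans hW₁V,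
    sX1.continuousOn.isOpen_inter_preimage hW₁o isOpen_compl_singleton, ⟨⟨hq₀, hl⟩, hj⟩,
    fun q => Q q j / Q q l, (ht j).mono inter_subset_left, fun q hq => hX2 j q hq.1,
    fun q hq => hq.2⟩

/-- The curve is `τ² Q` with `τ = X₁ t`, the value of the second fundamental form on the gradient
of `t`; the coordinate `s` is read off from the expansion of `τ X₂ y` in the curve and its
derivative. -/
lemma exists_isModelData (hQ : ∀ q ∈ V, sp (Q q) (Q q) = 0) {t : Plane → ℝ}
    (ht : ContDiffOn ℝ ∞ t V) (ht2 : ∀ q ∈ V, dirDeriv X₂ t q = 0)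
    (ht1 : ∀ q ∈ V, dirDeriv X₁ t q ≠ 0) (hV : V.Nonempty) :
    ∃ s a, IsModelData V y X₁ X₂ s t a := by
  have hk := h.k_eq_of_null hQ hV
  set τ : Plane → ℝ := dirDeriv X₁ t with hτ
  have sτ : ContDiffOn ℝ ∞ τ V := contDiffOn_dirDeriv h.isOpen ht h.smooth₁
  have sτi : ContDiffOn ℝ ∞ (fun q => (τ q)⁻¹) V := sτ.inv ht1
  have dτ : ∀ q ∈ V, dirDeriv X₂ τ q = θ₂ q * τ q := by
    intro q hq
    have e := h.comm ht hq
    rw [dirDeriv_congr h.isOpen ht2 hq, dirDeriv_const, ht2 q hq] at e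
    simp only [smul_eq_mul] at e
    linear_combination -e
  have dτi : ∀ q ∈ V, dirDeriv X₂ (fun q => (τ q)⁻¹) q = -(θ₂ q) * (τ q)⁻¹ := by
    intro q hq
    have e := dirDeriv_congr (X := X₂) h.isOpen (fun q hq => mul_inv_cancel₀ (ht1 q hq)) hq
    rw [dirDeriv_const, dirDeriv_mul (h.diff sτ hq) (h.diff sτi hq), dτ q hq] at e
    have := ht1 q hq
    apply mul_left_cancel₀ this
    linear_combination e
  -- differentiation with respect to `t` of the functions that are constant along `X₂`
  let δ : (Plane → E52) → Plane → E52 := fun f q => (τ q)⁻¹ • dirDeriv X₁ f q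
  have sδ : ∀ f, ContDiffOn ℝ ∞ f V → ContDiffOn ℝ ∞ (δ f) V := fun f hf =>
    sτi.smul (contDiffOn_dirDeriv h.isOpen hf h.smooth₁)
  have dδ : ∀ f, ContDiffOn ℝ ∞ f V → (∀ q ∈ V, dirDeriv X₂ f q = 0) →
      ∀ q ∈ V, dirDeriv X₂ (δ f) q = 0 := by
    intro f hf hf2 q hq
    have e := h.comm hf hq
    rw [dirDeriv_congr h.isOpen hf2 hq, dirDeriv_const, hf2 q hq] at e
    rw [dirDeriv_smul (h.diff sτi hq)
      (h.diff (contDiffOn_dirDeriv h.isOpen hf h.smooth₁) hq), dτi q hq]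
    linear_combination (norm := module) (-(τ q)⁻¹) • e
  set a : ℕ → Plane → E52 := fun n => δ^[n] (fun q => (τ q) ^ 2 • Q q) with ha
  have a_succ : ∀ n, a (n + 1) = δ (a n) := fun n => Function.iterate_succ_apply' _ _ _
  have sa : ∀ n, ContDiffOn ℝ ∞ (a n) V := by
    intro n
    induction n with
    | zero => exact (sτ.pow 2).smul h.smoothQ
    | succ n ih => rw [a_succ]; exact sδ _ ih
  have da : ∀ n, ∀ q ∈ V, dirDeriv X₂ (a n) q = 0 := by
    intro n
    induction n with
    | zero =>
      intro q hq
      have e : dirDeriv X₂ (fun q => τ q * τ q) q = 2 * θ₂ q * τ q ^ 2 := by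
        rw [dirDeriv_mul (h.diff sτ hq) (h.diff sτ hq), dτ q hq]; ring
      have e' : a 0 = fun q => (τ q * τ q) • Q q := by
        ext q; simp [ha, sq]
      rw [e', dirDeriv_smul (h.diff (sτ.mul sτ) hq) (h.diff h.smoothQ hq), e,
        h.dirDeriv_Q_of_null hQ hq]
      module
    | succ n ih => rw [a_succ]; exact dδ _ (sa n) ih
  have da1 : ∀ n, ∀ q ∈ V, dirDeriv X₁ (a n) q = τ q • a (n + 1) q := by
    intro n q hq
    rw [a_succ]
    simp only [δ]
    rw [smul_smul, mul_inv_cancel₀ (ht1 q hq), one_smul]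
  have a0 : ∀ q, a 0 q = τ q ^ 2 • Q q := fun q => rfl
  have a1 : ∀ q ∈ V, a 1 q = (2 / 3 * τ q) • dirDeriv X₂ y q
      + (2 * (dirDeriv X₁ τ q - θ₁ q * τ q)) • Q q := by
    intro q hq
    have e := da1 0 q hq
    have e' : a 0 = fun q => (τ q * τ q) • Q q := by
      ext q; simp [ha, sq]
    rw [e', dirDeriv_smul (h.diff (sτ.mul sτ) hq) (h.diff h.smoothQ hq),
      dirDeriv_mul (h.diff sτ hq) (h.diff sτ hq), h.codazzi₁ hq, hk] at e
    rw [zero_add] at e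
    have e2 : a 1 q = (τ q)⁻¹ • τ q • a 1 q := by
      rw [smul_smul, inv_mul_cancel₀ (ht1 q hq), one_smul]
    rw [e2, ← e]
    have := ht1 q hq
    simp only [smul_add, smul_smul]
    match_scalars <;> field_simp
    ring
  set s : Plane → ℝ := fun q => -3 * (dirDeriv X₁ τ q - θ₁ q * τ q) * ((τ q)⁻¹ * (τ q)⁻¹) with hs
  have ss : ContDiffOn ℝ ∞ s V := (contDiffOn_const.mul ((contDiffOn_dirDeriv h.isOpen sτ
    h.smooth₁).sub (h.smoothθ₁.mul sτ))).mul (sτi.mul sτi)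
  have hsτ : ∀ q ∈ V, dirDeriv X₁ τ q - θ₁ q * τ q = -(1 / 3) * s q * τ q ^ 2 := by
    intro q hq
    have := ht1 q hq
    simp only [hs]
    field_simp
  have rel1 : ∀ q ∈ V, τ q • dirDeriv X₂ y q = s q • a 0 q + (3 / 2 : ℝ) • a 1 q := by
    intro q hq
    rw [a1 q hq, hsτ q hq, a0]
    module
  have hQne : ∀ q ∈ V, Q q ≠ 0 := by
    intro q hq h0
    have := h.spPQ q hq
    rw [h0, sp_zero_right, hk] at this
    norm_num at this
  have d3 : ∀ q, DifferentiableAt ℝ (fun _ : Plane => (3 / 2 : ℝ)) q := fun q =>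
    differentiableAt_const _
  have ds : ∀ q ∈ V, dirDeriv X₂ s q = (τ q)⁻¹ := by
    intro q hq
    have e := dirDeriv_congr (X := X₂) h.isOpen rel1 hq
    rw [dirDeriv_smul (h.diff sτ hq) (h.diff h.smoothE₂ hq), dτ q hq, h.d22 q hq, dirDeriv_add
      ((h.diff ss hq).fun_smul (h.diff (sa 0) hq)) ((d3 q).fun_smul (h.diff (sa 1) hq)),
      dirDeriv_smul (h.diff ss hq) (h.diff (sa 0) hq), dirDeriv_smul (d3 q) (h.diff (sa 1) hq),
      dirDeriv_const, da 0 q hq, da 1 q hq, a0] at e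
    have e2 : (τ q - dirDeriv X₂ s q * τ q ^ 2) • Q q = 0 := by
      linear_combination (norm := module) e
    have e3 := (smul_eq_zero.1 e2).resolve_right (hQne q hq)
    have := ht1 q hq
    field_simp
    apply mul_left_cancel₀ this
    linear_combination -e3
  set b : Plane → ℝ := fun q => (τ q)⁻¹ * dirDeriv X₁ s q + 1 / 3 * (s q * s q) with hb
  have sb : ContDiffOn ℝ ∞ b V := (sτi.mul (contDiffOn_dirDeriv h.isOpen ss h.smooth₁)).add
    (contDiffOn_const.mul (ss.mul ss))
  have hbs : ∀ q ∈ V, dirDeriv X₁ s q = τ q * (b q - 1 / 3 * s q ^ 2) := by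
    intro q hq
    have := ht1 q hq
    simp only [hb]
    field_simp
    ring
  have rel2 : ∀ q ∈ V, y q = (b q • a 0 q + (3 / 2 : ℝ) • (s q • a 1 q)) + (3 / 2 : ℝ) • a 2 q := by
    intro q hq
    have e := dirDeriv_congr (X := X₁) h.isOpen rel1 hq
    rw [dirDeriv_smul (h.diff sτ hq) (h.diff h.smoothE₂ hq), h.d12 q hq, dirDeriv_add
      ((h.diff ss hq).fun_smul (h.diff (sa 0) hq)) ((d3 q).fun_smul (h.diff (sa 1) hq)),
      dirDeriv_smul (h.diff ss hq) (h.diff (sa 0) hq), dirDeriv_smul (d3 q) (h.diff (sa 1) hq),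
      dirDeriv_const, da1 0 q hq, da1 1 q hq, hbs q hq] at e
    rw [← sub_eq_zero]
    refine (smul_eq_zero.1 (?_ : τ q • (y q - ((b q • a 0 q + (3 / 2 : ℝ) • (s q • a 1 q))
      + (3 / 2 : ℝ) • a 2 q)) = 0)).resolve_left (ht1 q hq)
    have e1 := rel1 q hq
    have e2 : dirDeriv X₁ τ q = θ₁ q * τ q + -(1 / 3) * s q * τ q ^ 2 := by
      linear_combination hsτ q hq
    rw [e2] at e
    simp only [zero_add, Nat.reduceAdd] at e
    linear_combination (norm := module) e + (1 / 3 * s q * τ q) • e1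
  -- scalar products
  have sp_add : ∀ (i j : ℕ) {c : ℝ}, (∀ q ∈ V, sp (a i q) (a j q) = c) → ∀ q ∈ V,
      sp (a (i + 1) q) (a j q) + sp (a i q) (a (j + 1) q) = 0 := by
    intro i j c hc q hq
    have e := sp_dirDeriv_add h.isOpen (sa i) (sa j) hc X₁ hq
    rw [da1 i q hq, da1 j q hq, sp_smul_left, sp_smul_right] at e
    apply mul_left_cancel₀ (ht1 q hq)
    linear_combination e
  have s00 : ∀ q ∈ V, sp (a 0 q) (a 0 q) = 0 := fun q hq => by
    rw [a0, sp_smul_left, sp_smul_right, hQ q hq]; ring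
  have s01 : ∀ q ∈ V, sp (a 0 q) (a 1 q) = 0 := fun q hq => by
    rw [a0, a1 q hq, sp_smul_left, sp_add_right, sp_smul_right, sp_smul_right, hQ q hq, h.spQ2 q hq]
    ring
  have s11 : ∀ q ∈ V, sp (a 1 q) (a 1 q) = 0 := fun q hq => by
    simp only [a1 q hq, sp_add_left, sp_smul_left, sp_add_right, sp_smul_right, hQ q hq,
      h.spQ2 q hq, sp_comm _ (Q q), h.sp22 q hq]
    ring
  have s0y : ∀ q ∈ V, sp (a 0 q) (y q) = 0 := fun q hq => by
    rw [a0, sp_smul_left, h.spQy q hq]; ring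
  have s1y : ∀ q ∈ V, sp (a 1 q) (y q) = 0 := fun q hq => by
    rw [a1 q hq, sp_add_left, sp_smul_left, sp_smul_left, h.spQy q hq, h.sp2y q hq]; ring
  have s02 : ∀ q ∈ V, sp (a 0 q) (a 2 q) = 0 := fun q hq => by
    have e := sp_add 0 1 s01 q hq
    rw [zero_add, s11 q hq, zero_add] at e
    exact e
  have s12 : ∀ q ∈ V, sp (a 1 q) (a 2 q) = 0 := fun q hq => by
    have e := sp_add 1 1 s11 q hq
    rw [sp_comm (a (1 + 1) q)] at e
    simp only [Nat.reduceAdd] at e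
    linarith
  have s22 : ∀ q ∈ V, sp (a 2 q) (a 2 q) = 4 / 9 := fun q hq => by
    have e := h.unit q hq
    rw [rel2 q hq] at e
    simp only [sp_add_left, sp_add_right, sp_smul_left, sp_smul_right, s00 q hq, s01 q hq,
      s02 q hq, s11 q hq, s12 q hq, sp_comm (a 1 q) (a 0 q), sp_comm (a 2 q) (a 0 q),
      sp_comm (a 2 q) (a 1 q)] at e
    linear_combination (4 / 9) * e
  have s13 : ∀ q ∈ V, sp (a 1 q) (a 3 q) = -(4 / 9) := fun q hq => by
    have e := sp_add 1 2 s12 q hq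
    simp only [Nat.reduceAdd] at e
    rw [s22 q hq] at e
    linarith
  have s03 : ∀ q ∈ V, sp (a 0 q) (a 3 q) = 0 := fun q hq => by
    have e := sp_add 0 2 s02 q hq
    simp only [Nat.reduceAdd, zero_add] at e
    rw [s12 q hq] at e
    linarith
  have s23 : ∀ q ∈ V, sp (a 2 q) (a 3 q) = 0 := fun q hq => by
    have e := sp_add 2 2 s22 q hq
    rw [sp_comm (a (2 + 1) q)] at e
    simp only [Nat.reduceAdd] at e
    linarith
  have hbval : ∀ q ∈ V, b q = 1 / 2 * s q ^ 2 + 27 / 40 * sp (a 3 q) (a 3 q) := by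
    intro q hq
    have e := dirDeriv_congr (X := X₁) h.isOpen rel2 hq
    rw [dirDeriv_add (((h.diff sb hq).fun_smul (h.diff (sa 0) hq)).fun_add
        ((d3 q).fun_smul ((h.diff ss hq).fun_smul (h.diff (sa 1) hq))))
        ((d3 q).fun_smul (h.diff (sa 2) hq)),
      dirDeriv_add ((h.diff sb hq).fun_smul (h.diff (sa 0) hq))
        ((d3 q).fun_smul ((h.diff ss hq).fun_smul (h.diff (sa 1) hq))),
      dirDeriv_smul (h.diff sb hq) (h.diff (sa 0) hq),
      dirDeriv_smul (d3 q) ((h.diff ss hq).fun_smul (h.diff (sa 1) hq)),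
      dirDeriv_smul (h.diff ss hq) (h.diff (sa 1) hq), dirDeriv_smul (d3 q) (h.diff (sa 2) hq),
      dirDeriv_const, da1 0 q hq, da1 1 q hq, da1 2 q hq, hbs q hq] at e
    have e1 := h.sp11 q hq
    rw [e] at e1
    simp only [Nat.reduceAdd, zero_add, zero_smul, sp_add_left, sp_add_right, sp_smul_left,
      sp_smul_right, s00 q hq, s01 q hq,
      s02 q hq, s03 q hq, s11 q hq, s12 q hq, s13 q hq, s22 q hq, s23 q hq,
      sp_comm (a 1 q) (a 0 q), sp_comm (a 2 q) (a 0 q), sp_comm (a 3 q) (a 0 q),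
      sp_comm (a 2 q) (a 1 q), sp_comm (a 3 q) (a 1 q), sp_comm (a 3 q) (a 2 q)] at e1
    have hτ0 := ht1 q hq
    apply mul_left_cancel₀ (pow_ne_zero 2 hτ0)
    linear_combination (-3 / 10) * e1
  have ha1 : ∀ q ∈ V, a 1 q ≠ 0 := by
    intro q hq h0
    have e := congrArg (fun w => sp w (dirDeriv X₁ y q)) (rel1 q hq)
    rw [h0, a0] at e
    simp only [sp_add_left, sp_smul_left, sp_zero_left, h.spQ1 q hq,
      sp_comm (dirDeriv X₂ y q) (dirDeriv X₁ y q), h.sp12 q hq] at e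
    exact ht1 q hq (by linarith)
  refine ⟨s, a, h.isOpen, fun q hq => h.linearIndependent hq, ss, ht, sa, ht1, ht2, fun q hq => ?_,
    da, da1, s00, s11, s22, ha1, fun q hq => ?_⟩
  · rw [ds q hq]; exact inv_ne_zero (ht1 q hq)
  · rw [rel2 q hq, hbval q hq, smul_smul]

end IsMovingFrame

/-! ### The coordinates `(s, t)` -/

lemma exists_eq_smul_add_smul {X Y : Plane} (h : LinearIndependent ℝ ![X, Y]) (v : Plane) :
    ∃ a b : ℝ, v = a • X + b • Y := by
  have hs := h.span_eq_top_of_card_eq_finrank (by simp)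
  have hv : v ∈ Submodule.span ℝ (range ![X, Y]) := hs ▸ Submodule.mem_top
  rw [Matrix.range_cons, Matrix.range_cons, Matrix.range_empty, union_empty, singleton_union,
    Submodule.mem_span_pair] at hv
  obtain ⟨a, b, e⟩ := hv
  exact ⟨a, b, e.symm⟩

namespace IsModelData

variable {V : Set Plane} {y : Plane → E52} {X₁ X₂ : Plane → Plane} {s t : Plane → ℝ}
  {a : ℕ → Plane → E52} (h : IsModelData V y X₁ X₂ s t a)
include h

lemma eq_smul_of_fderiv_eq_zero {q v : Plane} (hq : q ∈ V) (hv : fderiv ℝ t q v = 0) :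
    ∃ b : ℝ, v = b • X₂ q := by
  obtain ⟨c, b, rfl⟩ := exists_eq_smul_add_smul (h.linearIndependent q hq) v
  rw [map_add, map_smul, map_smul] at hv
  change c • dirDeriv X₁ t q + b • dirDeriv X₂ t q = 0 at hv
  rw [h.dirDeriv_t q hq, smul_zero, add_zero, smul_eq_mul] at hv
  exact ⟨b, by rw [(mul_eq_zero.1 hv).resolve_right (h.dirDeriv_t_ne q hq), zero_smul, zero_add]⟩

/-- The functions `s`, `t` are local coordinates. -/
lemma exists_coordinates {q₀ : Plane} (hq₀ : q₀ ∈ V) :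
    ∃ e : OpenPartialHomeomorph Plane Plane, q₀ ∈ e.source ∧ e.source ⊆ V ∧
      (∀ q, e q 0 = s q) ∧ (∀ q, e q 1 = t q) ∧ ContDiffOn ℝ ∞ e e.source ∧
      ContDiffOn ℝ ∞ e.symm e.target := by
  set Φ : Plane → Plane := fun q => !₂[s q, t q] with hΦ
  have sΦ : ContDiffOn ℝ ∞ Φ V := by
    rw [contDiffOn_euclidean]
    intro i
    fin_cases i
    · exact h.smooth_s
    · exact h.smooth_t
  have cΦ : ∀ q ∈ V, ContDiffAt ℝ ∞ Φ q := fun q hq => sΦ.contDiffAt (h.isOpen.mem_nhds hq)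
  have dΦ : ∀ q ∈ V, DifferentiableAt ℝ Φ q := fun q hq => (cΦ q hq).differentiableAt (by simp)
  have comp : ∀ q ∈ V, ∀ v i, fderiv ℝ Φ q v i = fderiv ℝ (fun p => Φ p i) q v := by
    intro q hq v i
    have := (EuclideanSpace.proj (𝕜 := ℝ) i).hasFDerivAt.comp q (dΦ q hq).hasFDerivAt
    rw [show (fun p => Φ p i) = EuclideanSpace.proj (𝕜 := ℝ) i ∘ Φ from rfl, this.fderiv]
    rfl
  have inj : ∀ q ∈ V, Function.Injective (fderiv ℝ Φ q) := by
    intro q hq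
    rw [injective_iff_map_eq_zero]
    intro v hv
    have e0 : fderiv ℝ s q v = 0 := by rw [← show _ = fderiv ℝ s q v from comp q hq v 0, hv]; rfl
    have e1 : fderiv ℝ t q v = 0 := by rw [← show _ = fderiv ℝ t q v from comp q hq v 1, hv]; rfl
    obtain ⟨b, rfl⟩ := h.eq_smul_of_fderiv_eq_zero hq e1
    rw [map_smul] at e0
    rw [(smul_eq_zero.1 e0).resolve_right (h.dirDeriv_s_ne q hq), zero_smul]
  have equiv : ∀ q ∈ V, ∃ L : Plane ≃L[ℝ] Plane, HasFDerivAt Φ (L : Plane →L[ℝ] Plane) q := by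
    intro q hq
    refine ⟨(LinearEquiv.ofInjectiveEndo (fderiv ℝ Φ q : Plane →ₗ[ℝ] Plane)
      (inj q hq)).toContinuousLinearEquiv, ?_⟩
    convert (dΦ q hq).hasFDerivAt using 1
    ext1 v
    rfl
  obtain ⟨L, hL⟩ := equiv q₀ hq₀
  set e := ((cΦ q₀ hq₀).toOpenPartialHomeomorph Φ hL (by simp)).restrOpen V h.isOpen with he
  have heV : e.source ⊆ V := fun q hq => hq.2
  refine ⟨e, ⟨(cΦ q₀ hq₀).mem_toOpenPartialHomeomorph_source hL (by simp), hq₀⟩, heV,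
    fun q => rfl, fun q => rfl, sΦ.mono heV, fun z hz => ?_⟩
  obtain ⟨L', hL'⟩ := equiv _ (heV (e.map_target hz))
  exact (e.contDiffAt_symm hz hL' (cΦ _ (heV (e.map_target hz)))).contDiffWithinAt

/-- In the coordinates `(s, t)` the vector field `X₂` is a multiple of `∂/∂s`. Hence the maps `a n`
depend only on `t`, and `a (n + 1)` is the derivative of `a n`. -/
lemma exists_chart {q₀ : Plane} (hq₀ : q₀ ∈ V) :
    ∃ e : OpenPartialHomeomorph Plane Plane, q₀ ∈ e.source ∧ ContDiffOn ℝ ∞ e e.source ∧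
      ContDiffOn ℝ ∞ e.symm e.target ∧ ∃ (I : Set ℝ) (α : ℝ → E52), IsNullCurveInLightCone I α ∧
      (∀ u ∈ I, sp (iteratedDeriv 2 α u) (iteratedDeriv 2 α u) = 4 / 9) ∧
      e.source ⊆ V ∧ ∀ q ∈ e.source, e q 1 ∈ I ∧ y q = model α (e q 0) (e q 1) := by
  obtain ⟨e, hq₀e, heV, es, et, se, se'⟩ := h.exists_coordinates hq₀
  have mk : ContDiff ℝ ∞ fun p : ℝ × ℝ => (!₂[p.1, p.2] : Plane) := by
    rw [contDiff_euclidean]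
    intro i
    fin_cases i
    · exact contDiff_fst
    · exact contDiff_snd
  have eta : ∀ z : Plane, (!₂[z 0, z 1] : Plane) = z := fun z => by
    ext i; fin_cases i <;> rfl
  -- a box in the range of the coordinates
  obtain ⟨ε, hε, hB⟩ := Metric.isOpen_iff.1 (e.open_target.preimage mk.continuous) (s q₀, t q₀) (by
    change !₂[s q₀, t q₀] ∈ e.target
    rw [← es, ← et, eta]
    exact e.map_source hq₀e)
  rw [← ball_prod_same] at hB
  set J := Metric.ball (s q₀) ε with hJ
  set I := Metric.ball (t q₀) ε with hI
  have s₀J : s q₀ ∈ J := Metric.mem_ball_self hε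
  have mem : ∀ {x u}, x ∈ J → u ∈ I → !₂[x, u] ∈ e.target := fun {x u} hx hu =>
    hB (show (x, u) ∈ J ×ˢ I from ⟨hx, hu⟩)
  have memV : ∀ {x u}, x ∈ J → u ∈ I → e.symm !₂[x, u] ∈ V := fun hx hu =>
    heV (e.map_target (mem hx hu))
  -- functions constant along `X₂` do not depend on the first coordinate
  have const : ∀ f : Plane → E52, ContDiffOn ℝ ∞ f V → (∀ q ∈ V, dirDeriv X₂ f q = 0) →
      ∀ x ∈ J, ∀ u ∈ I, f (e.symm !₂[x, u]) = f (e.symm !₂[s q₀, u]) := by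
    intro f hf hf2 x hx u hu
    have key : ∀ x ∈ J, HasDerivAt (fun x => f (e.symm !₂[x, u])) 0 x := by
      intro x hx
      have hp := memV hx hu
      have d1 : HasDerivAt (fun x : ℝ => (!₂[x, u] : Plane)) (EuclideanSpace.single 0 1) x := by
        have e1 : (fun x : ℝ => (!₂[x, u] : Plane)) =
            fun x => x • EuclideanSpace.single 0 (1 : ℝ) + !₂[0, u] := by
          ext x i; fin_cases i <;> simp
        rw [e1]
        simpa using ((hasDerivAt_id x).smul_const
          (EuclideanSpace.single (0 : Fin 2) (1 : ℝ))).add_const (!₂[0, u] : Plane)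
      have d2 := (differentiableAt_of_contDiffOn e.open_target se' (mem hx hu)).hasFDerivAt
      have d21 := d2.comp_hasDerivAt x d1
      have d3 := (differentiableAt_of_contDiffOn h.isOpen hf hp).hasFDerivAt
      have dt := (differentiableAt_of_contDiffOn h.isOpen h.smooth_t hp).hasFDerivAt
      have e1 := dt.comp_hasDerivAt x d21
      have e2 : HasDerivAt (t ∘ (e.symm ∘ fun x => (!₂[x, u] : Plane))) 0 x := by
        refine (hasDerivAt_const x u).congr_of_eventuallyEq ?_
        filter_upwards [Metric.isOpen_ball.mem_nhds hx] with x' hx'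
        simp only [Function.comp_apply]
        rw [← et, e.right_inv (mem hx' hu)]
        rfl
      obtain ⟨b, hb⟩ := h.eq_smul_of_fderiv_eq_zero hp (e1.unique e2)
      have e3 := d3.comp_hasDerivAt x d21
      rw [hb, map_smul, show fderiv ℝ f (e.symm !₂[x, u]) (X₂ (e.symm !₂[x, u])) = 0 from
        hf2 _ hp, smul_zero] at e3
      exact e3
    exact Metric.isOpen_ball.is_const_of_deriv_eq_zero (convex_ball _ _).isPreconnected
      (fun x hx => (key x hx).differentiableAt.differentiableWithinAt)
      (fun x hx => (key x hx).deriv) hx s₀J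
  set p : ℝ → Plane := fun u => e.symm !₂[s q₀, u] with hp
  have pV : ∀ u ∈ I, p u ∈ V := fun u hu => memV s₀J hu
  have smooth_p : ContDiffOn ℝ ∞ p I := se'.comp (f := fun u => (!₂[s q₀, u] : Plane)) (g := e.symm)
    (mk.comp (contDiff_const.prodMk contDiff_id)).contDiffOn fun u hu => mem s₀J hu
  have t_p : ∀ u ∈ I, t (p u) = u := fun u hu => by
    rw [← et, hp, e.right_inv (mem s₀J hu)]; rfl
  have s_p : ∀ u ∈ I, s (p u) = s q₀ := fun u hu => by
    rw [← es, hp, e.right_inv (mem s₀J hu)]; rfl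
  set W : Set Plane := e.source ∩ e ⁻¹' {z | z 0 ∈ J ∧ z 1 ∈ I} with hW
  have hBo : IsOpen {z : Plane | z 0 ∈ J ∧ z 1 ∈ I} :=
    (Metric.isOpen_ball.preimage (EuclideanSpace.proj (𝕜 := ℝ) (0 : Fin 2)).continuous).inter
      (Metric.isOpen_ball.preimage (EuclideanSpace.proj (𝕜 := ℝ) (1 : Fin 2)).continuous)
  have hWo : IsOpen W := e.isOpen_inter_preimage hBo
  have memW : ∀ q ∈ e.source, s q ∈ J → t q ∈ I → q ∈ W := fun q hq h1 h2 =>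
    ⟨hq, by rw [mem_preimage]; exact ⟨by rwa [es], by rwa [et]⟩⟩
  have hWs : ∀ q ∈ W, s q ∈ J := fun q hq => by rw [← es]; exact hq.2.1
  have hWt : ∀ q ∈ W, t q ∈ I := fun q hq => by rw [← et]; exact hq.2.2
  have pW : ∀ u ∈ I, p u ∈ W := fun u hu => memW _ (e.map_target (mem s₀J hu))
    (by rw [s_p u hu]; exact s₀J) (by rw [t_p u hu]; exact hu)
  have a_eq : ∀ n, ∀ q ∈ W, a n q = a n (p (t q)) := by
    intro n q hq
    have := const (a n) (h.smooth_a n) (h.dirDeriv_a n) (s q) (hWs q hq) (t q) (hWt q hq)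
    rw [← this, ← es, ← et, eta, e.left_inv hq.1]
  have sα : ∀ n, ContDiffOn ℝ ∞ (fun u => a n (p u)) I := fun n =>
    (h.smooth_a n).comp (f := p) (g := a n) smooth_p pV
  have dα : ∀ n, ∀ u ∈ I, deriv (fun u => a n (p u)) u = a (n + 1) (p u) := by
    intro n u hu
    have e1 := h.dirDeriv_a_succ n (p u) (pV u hu)
    rw [dirDeriv_congr hWo (a_eq n) (pW u hu), dirDeriv] at e1
    have e2 := fderiv_comp (p u) (g := fun u => a n (p u)) (f := t)
      (differentiableAt_of_contDiffOn Metric.isOpen_ball (sα n) (by rw [t_p u hu]; exact hu))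
      (differentiableAt_of_contDiffOn h.isOpen h.smooth_t (pV u hu))
    change fderiv ℝ (fun q => a n (p (t q))) (p u) = _ at e2
    rw [e2, ContinuousLinearMap.comp_apply, fderiv_eq_smul_deriv, t_p u hu] at e1
    exact smul_right_injective _ (h.dirDeriv_t_ne _ (pV u hu)) e1
  have itα : ∀ n, ∀ u ∈ I, iteratedDeriv n (fun u => a 0 (p u)) u = a n (p u) := by
    intro n
    induction n with
    | zero => intro u hu; simp
    | succ n ih =>
      intro u hu
      rw [iteratedDeriv_succ, ← dα n u hu]
      exact (Filter.eventuallyEq_of_mem (Metric.isOpen_ball.mem_nhds hu) ih).deriv_eq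
  refine ⟨e.restrOpen W hWo, ⟨hq₀e, memW q₀ hq₀e s₀J (Metric.mem_ball_self hε)⟩,
    se.mono inter_subset_left, se'.mono inter_subset_left, I, fun u => a 0 (p u),
    ⟨Metric.isOpen_ball, ?_, sα 0, fun u hu => h.sp00 _ (pV u hu), fun u hu => ?_, fun u hu => ?_⟩,
    fun u hu => ?_, fun q hq => heV hq.1, fun q hq => ?_⟩
  · rw [hI, Real.ball_eq_Ioo]; exact ordConnected_Ioo
  · rw [dα 0 u hu]; exact h.a1_ne _ (pV u hu)
  · rw [dα 0 u hu]; exact h.sp11 _ (pV u hu)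
  · rw [itα 2 u hu]; exact h.sp22 _ (pV u hu)
  · have hqW : q ∈ W := hq.2
    have ht := hWt q hqW
    simp only [OpenPartialHomeomorph.coe_restrOpen, es, et]
    refine ⟨ht, ?_⟩
    rw [model, dα 0 _ ht, itα 3 _ ht, itα 2 _ ht, h.eq_model q (heV hq.1), ← a_eq 3 q hqW,
      ← a_eq 0 q hqW, ← a_eq 2 q hqW, ← a_eq 1 q hqW]

end IsModelData

/-! ### Moving null frames of minimal surfaces -/

lemma dirDeriv_eq_tangentVec (X : Plane → Plane) (y : Plane → E52) (q : Plane) :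
    dirDeriv X y q = tangentVec y q (X q).ofLp := (tangentVec_eq_fderiv y q (X q)).symm

namespace IsLorentzPatch

variable {U : Set Plane} {y : Plane → E52} (hy : IsLorentzPatch U y)
include hy

/-- The Gauss formula for vector fields. -/
lemma exists_dirDeriv_dirDeriv_eq {V : Set Plane} (hV : IsOpen V) (hVU : V ⊆ U)
    (X : Plane → Plane) {Y : Plane → Plane} (hY : ContDiffOn ℝ ∞ Y V) {q : Plane} (hq : q ∈ V) :
    ∃ c, dirDeriv X (dirDeriv Y y) q = secondFormVec y q (X q).ofLp (Y q).ofLp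
      - sp (dirDeriv X y q) (dirDeriv Y y q) • y q + tangentVec y q c := by
  have hqU := hVU hq
  have sY : ∀ j, DifferentiableAt ℝ (fun q => Y q j) q := fun j =>
    differentiableAt_of_contDiffOn hV (contDiffOn_euclidean.1 hY j) hq
  have e : dirDeriv X (dirDeriv Y y) q
      = dirDeriv X (fun q => Y q 0 • pd 0 y q + Y q 1 • pd 1 y q) q :=
    dirDeriv_congr (F := E52) hV (fun q _ => fderiv_eq_sum_pd y q (Y q)) hq
  rw [e, dirDeriv_add ((sY 0).fun_smul (hy.differentiableAt_pd 0 hqU))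
    ((sY 1).fun_smul (hy.differentiableAt_pd 1 hqU)),
    dirDeriv_smul (sY 0) (hy.differentiableAt_pd 0 hqU),
    dirDeriv_smul (sY 1) (hy.differentiableAt_pd 1 hqU)]
  have e2 : ∀ j, dirDeriv X (pd j y) q = X q 0 • pd 0 (pd j y) q + X q 1 • pd 1 (pd j y) q :=
    fun j => fderiv_eq_sum_pd (pd j y) q (X q)
  refine ⟨fun k => dirDeriv X (fun q => Y q k) q
    + ∑ i, ∑ j, X q i * Y q j * christoffel y k i j q, ?_⟩
  rw [e2, e2]
  rw [dirDeriv_eq_tangentVec X y, dirDeriv_eq_tangentVec Y y, sp_tangentVec]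
  simp only [secondFormVec, tangentVec, Fin.sum_univ_two, pd_pd_eq y _ _ q]
  module

/-- A Lorentzian surface has a smooth null frame near each point. -/
lemma exists_nullFrame {q₀ : Plane} (hq₀ : q₀ ∈ U) :
    ∃ V ⊆ U, IsOpen V ∧ q₀ ∈ V ∧ ∃ X₁ X₂ : Plane → Plane, ContDiffOn ℝ ∞ X₁ V ∧
      ContDiffOn ℝ ∞ X₂ V ∧ ∀ q ∈ V, IsNullFrame y q (X₁ q).ofLp (X₂ q).ofLp := by
  have hdet : ∀ q ∈ U, metric y q 0 0 * metric y q 1 1 - metric y q 0 1 ^ 2 < 0 := by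
    intro q hq
    have := hy.lorentz q hq
    rwa [Matrix.det_fin_two, metric_symm y q 1 0, ← sq] at this
  obtain ⟨ε, hε, hε'⟩ := exists_root (hdet q₀ hq₀)
  have s00 := hy.contDiffOn_metric 0 0
  have s01 := hy.contDiffOn_metric 0 1
  have s11 := hy.contDiffOn_metric 1 1
  set δ : Plane → ℝ := fun q =>
    ε * √(metric y q 0 1 ^ 2 - metric y q 0 0 * metric y q 1 1) with hδ
  have sδ : ContDiffOn ℝ ∞ δ U := contDiffOn_const.mul
    (((s01.pow 2).sub (s00.mul s11)).sqrt fun q hq => by linarith [hdet q hq])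
  have hδ2 : ∀ q ∈ U, δ q ^ 2 = metric y q 0 1 ^ 2 - metric y q 0 0 * metric y q 1 1 := by
    intro q hq
    simp only [hδ]
    rw [mul_pow, hε, Real.sq_sqrt (by linarith [hdet q hq]), one_mul]
  have hδ0 : ∀ q ∈ U, δ q ≠ 0 := by
    intro q hq h0
    have := hδ2 q hq
    rw [h0] at this
    linarith [hdet q hq]
  set V : Set Plane := U ∩ (fun q => δ q - metric y q 0 1) ⁻¹' {0}ᶜ with hV
  have hVU : V ⊆ U := inter_subset_left
  have hd : ∀ q ∈ V, 2 * (δ q - metric y q 0 1) * δ q ^ 2 ≠ 0 := fun q hq =>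
    mul_ne_zero (mul_ne_zero two_ne_zero hq.2) (pow_ne_zero 2 (hδ0 q hq.1))
  have sa := (sδ.sub s01).mono hVU
  have sd : ContDiffOn ℝ ∞ (fun q => 2 * (δ q - metric y q 0 1) * δ q ^ 2) V :=
    (contDiffOn_const.mul sa).mul ((sδ.pow 2).mono hVU)
  refine ⟨V, hVU, (sδ.sub s01).continuousOn.isOpen_inter_preimage hy.isOpen isOpen_compl_singleton,
    ⟨hq₀, hε'⟩, fun q => !₂[δ q - metric y q 0 1, metric y q 0 0],
    fun q => !₂[metric y q 1 1 / (2 * (δ q - metric y q 0 1) * δ q ^ 2),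
      (δ q - metric y q 0 1) / (2 * (δ q - metric y q 0 1) * δ q ^ 2)], ?_, ?_, fun q hq => ?_⟩
  · rw [contDiffOn_euclidean]
    intro i
    fin_cases i
    · exact sa
    · exact s00.mono hVU
  · rw [contDiffOn_euclidean]
    intro i
    fin_cases i
    · exact (s11.mono hVU).div sd hd
    · exact sa.div sd hd
  · obtain ⟨i1, i2, i3⟩ := nullPair_identities (hδ2 q hq.1) (hδ0 q hq.1) hq.2
    constructor <;> rw [sp_tangentVec, metric_symm y q 1 0]
    · simp only [Matrix.cons_val_zero, Matrix.cons_val_one]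
      linear_combination i1
    · simp only [Matrix.cons_val_zero, Matrix.cons_val_one]
      linear_combination i2
    · simp only [Matrix.cons_val_zero, Matrix.cons_val_one]
      linear_combination i3

/-- A minimal surface with constant curvatures satisfies the structure equations in any smooth null
frame; the form `θ` is determined by the derivatives of the scalar products of the frame. -/
lemma exists_isMovingFrame {K KD : ℝ} (hmin : ∀ q ∈ U, meanCurvature y q = 0)
    (hK : ∀ q ∈ U, gaussCurvature y q = K) (hKD : KD ≠ 0)
    (hD : ∀ q ∈ U, ∀ a b f₃ f₄, IsFrame y q a b f₃ f₄ → normalCurvature y q a b f₃ f₄ = KD)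
    {q₀ : Plane} (hq₀ : q₀ ∈ U) :
    ∃ V ⊆ U, q₀ ∈ V ∧ ∃ X₁ X₂ P Q θ₁ θ₂,
      IsMovingFrame V y X₁ X₂ P Q θ₁ θ₂ (1 - K) ((1 - K) ^ 2 - KD ^ 2) := by
  obtain ⟨V, hVU, hV, hq₀V, X₁, X₂, sX₁, sX₂, hn⟩ := hy.exists_nullFrame hq₀
  have sy := hy.smooth.mono hVU
  have sE₁ := contDiffOn_dirDeriv hV sy sX₁
  have sE₂ := contDiffOn_dirDeriv hV sy sX₂
  have h12 : ∀ q ∈ V, secondFormVec y q (X₁ q).ofLp (X₂ q).ofLp = 0 := fun q hq => by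
    have := hy.meanCurvature_eq (hVU hq) (hn q hq)
    rwa [hmin q (hVU hq), eq_comm, neg_eq_zero] at this
  have h21 : ∀ q ∈ V, secondFormVec y q (X₂ q).ofLp (X₁ q).ofLp = 0 := fun q hq => by
    have := hy.meanCurvature_eq (hVU hq) (hn q hq).swap
    rwa [hmin q (hVU hq), eq_comm, neg_eq_zero] at this
  have sh : ∀ {Y : Plane → Plane}, ContDiffOn ℝ ∞ Y V →
      ContDiffOn ℝ ∞ (fun q => secondFormVec y q (Y q).ofLp (Y q).ofLp) V := by
    intro Y hY
    have := contDiffOn_euclidean.1 hY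
    exact ContDiffOn.sum fun i _ => ContDiffOn.sum fun j _ =>
      ((this i).mul (this j)).smul ((hy.contDiffOn_secondForm i j).mono hVU)
  have sp11 : ∀ q ∈ V, sp (dirDeriv X₁ y q) (dirDeriv X₁ y q) = 0 := fun q hq => by
    rw [dirDeriv_eq_tangentVec]; exact (hn q hq).h11
  have sp22 : ∀ q ∈ V, sp (dirDeriv X₂ y q) (dirDeriv X₂ y q) = 0 := fun q hq => by
    rw [dirDeriv_eq_tangentVec]; exact (hn q hq).h22
  have sp12 : ∀ q ∈ V, sp (dirDeriv X₁ y q) (dirDeriv X₂ y q) = -1 := fun q hq => by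
    rw [dirDeriv_eq_tangentVec, dirDeriv_eq_tangentVec]; exact (hn q hq).h12
  have sp21 : ∀ q ∈ V, sp (dirDeriv X₂ y q) (dirDeriv X₁ y q) = -1 := fun q hq => by
    rw [sp_comm, sp12 q hq]
  have spT : ∀ q ∈ V, ∀ X : Plane → Plane, sp (dirDeriv X y q) (y q) = 0 := fun q hq X => by
    rw [dirDeriv_eq_tangentVec]; exact hy.sp_tangentVec_self (hVU hq) _
  have sphT : ∀ q ∈ V, ∀ a b (X : Plane → Plane), sp (secondFormVec y q a b) (dirDeriv X y q) = 0 :=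
    fun q hq a b X => by
      rw [dirDeriv_eq_tangentVec]; exact hy.sp_secondFormVec_tangentVec (hVU hq) _ _ _
  -- the derivative of a tangent field, its tangential part expanded in the null frame
  have gauss : ∀ (X : Plane → Plane) {Y : Plane → Plane}, ContDiffOn ℝ ∞ Y V → ∀ q ∈ V,
      dirDeriv X (dirDeriv Y y) q = secondFormVec y q (X q).ofLp (Y q).ofLp
      - sp (dirDeriv X y q) (dirDeriv Y y q) • y q
      + (-sp (dirDeriv X (dirDeriv Y y) q) (dirDeriv X₂ y q)) • dirDeriv X₁ y q
      + (-sp (dirDeriv X (dirDeriv Y y) q) (dirDeriv X₁ y q)) • dirDeriv X₂ y q := by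
    intro X Y hY q hq
    obtain ⟨c, hc⟩ := hy.exists_dirDeriv_dirDeriv_eq hV hVU X hY hq
    have hc' : tangentVec y q c = (-sp (tangentVec y q c) (dirDeriv X₂ y q)) • dirDeriv X₁ y q
        + (-sp (tangentVec y q c) (dirDeriv X₁ y q)) • dirDeriv X₂ y q := by
      simp only [dirDeriv_eq_tangentVec]
      rw [← tangentVec_smul_add_smul, ← (hn q hq).eq_add (hy.lorentz q (hVU hq)).ne]
    have e : ∀ Z : Plane → Plane, sp (dirDeriv X (dirDeriv Y y) q) (dirDeriv Z y q)
        = sp (tangentVec y q c) (dirDeriv Z y q) := by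
      intro Z
      rw [hc, sp_add_left, sp_sub_left, sp_smul_left, sphT q hq, sp_comm (y q), spT q hq]
      ring
    rw [e, e, add_assoc, ← hc']
    exact hc
  have z11 : ∀ X : Plane → Plane, ∀ q ∈ V,
      sp (dirDeriv X (dirDeriv X₁ y) q) (dirDeriv X₁ y q) = 0 := by
    intro X q hq
    have := sp_dirDeriv_add hV sE₁ sE₁ sp11 X hq
    rw [sp_comm (dirDeriv X₁ y q)] at this
    linarith
  have z22 : ∀ X : Plane → Plane, ∀ q ∈ V,
      sp (dirDeriv X (dirDeriv X₂ y) q) (dirDeriv X₂ y q) = 0 := by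
    intro X q hq
    have := sp_dirDeriv_add hV sE₂ sE₂ sp22 X hq
    rw [sp_comm (dirDeriv X₂ y q)] at this
    linarith
  have z21 : ∀ X : Plane → Plane, ∀ q ∈ V,
      sp (dirDeriv X (dirDeriv X₂ y) q) (dirDeriv X₁ y q)
        = -sp (dirDeriv X (dirDeriv X₁ y) q) (dirDeriv X₂ y q) := by
    intro X q hq
    have := sp_dirDeriv_add hV sE₁ sE₂ sp12 X hq
    rw [sp_comm (dirDeriv X₁ y q)] at this
    linarith
  have d11 : ∀ q ∈ V, dirDeriv X₁ (dirDeriv X₁ y) q =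
      (-sp (dirDeriv X₁ (dirDeriv X₁ y) q) (dirDeriv X₂ y q)) • dirDeriv X₁ y q
        + secondFormVec y q (X₁ q).ofLp (X₁ q).ofLp := fun q hq => by
    conv_lhs => rw [gauss X₁ sX₁ q hq, z11 X₁ q hq, sp11 q hq]
    module
  have d21 : ∀ q ∈ V, dirDeriv X₂ (dirDeriv X₁ y) q =
      (-sp (dirDeriv X₂ (dirDeriv X₁ y) q) (dirDeriv X₂ y q)) • dirDeriv X₁ y q
        + y q := fun q hq => by
    conv_lhs => rw [gauss X₂ sX₁ q hq, z11 X₂ q hq, sp21 q hq, h21 q hq]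
    module
  have d12 : ∀ q ∈ V, dirDeriv X₁ (dirDeriv X₂ y) q =
      (- -sp (dirDeriv X₁ (dirDeriv X₁ y) q) (dirDeriv X₂ y q)) • dirDeriv X₂ y q
        + y q := fun q hq => by
    conv_lhs => rw [gauss X₁ sX₂ q hq, z22 X₁ q hq, z21 X₁ q hq, sp12 q hq, h12 q hq]
    module
  have d22 : ∀ q ∈ V, dirDeriv X₂ (dirDeriv X₂ y) q =
      (- -sp (dirDeriv X₂ (dirDeriv X₁ y) q) (dirDeriv X₂ y q)) • dirDeriv X₂ y q
        + secondFormVec y q (X₂ q).ofLp (X₂ q).ofLp := fun q hq => by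
    conv_lhs => rw [gauss X₂ sX₂ q hq, z22 X₂ q hq, z21 X₂ q hq, sp22 q hq]
    module
  have spPQ : ∀ q ∈ V, sp (secondFormVec y q (X₁ q).ofLp (X₁ q).ofLp)
      (secondFormVec y q (X₂ q).ofLp (X₂ q).ofLp) = 1 - K := fun q hq => by
    have := hy.gaussCurvature_eq_nullFrame (hVU hq) (hn q hq)
    rw [hK q (hVU hq), h12 q hq, sp_zero_left] at this
    linarith
  refine ⟨V, hVU, hq₀V, X₁, X₂, fun q => secondFormVec y q (X₁ q).ofLp (X₁ q).ofLp,
    fun q => secondFormVec y q (X₂ q).ofLp (X₂ q).ofLp,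
    fun q => -sp (dirDeriv X₁ (dirDeriv X₁ y) q) (dirDeriv X₂ y q),
    fun q => -sp (dirDeriv X₂ (dirDeriv X₁ y) q) (dirDeriv X₂ y q),
    hV, sy, sX₁, sX₂, sh sX₁, sh sX₂, ((contDiffOn_dirDeriv hV sE₁ sX₁).sp sE₂).neg,
    ((contDiffOn_dirDeriv hV sE₁ sX₂).sp sE₂).neg, d11, d21, d12, d22, sp11, sp22, sp12,
    fun q hq => hy.unit q (hVU hq), fun q hq => spT q hq _, fun q hq => spT q hq _,
    fun q hq => sphT q hq _ _ _, fun q hq => sphT q hq _ _ _,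
    fun q hq => hy.sp_secondFormVec_self (hVU hq) _ _,
    fun q hq => sphT q hq _ _ _, fun q hq => sphT q hq _ _ _,
    fun q hq => hy.sp_secondFormVec_self (hVU hq) _ _, spPQ, fun q hq => ?_, fun h0 => ?_,
    fun q hq => ?_⟩
  · obtain ⟨f₃, f₄, hf⟩ := hy.exists_isFrame (hVU hq) (hn q hq)
    have e := hy.frameDet_sq (hVU hq) (hn q hq)
    rw [← hy.normalCurvature_eq_frameDet (hVU hq) hf, hD q (hVU hq) _ _ _ _ hf, spPQ q hq] at e
    linarith
  · exact hKD (pow_eq_zero_iff two_ne_zero |>.1 (by linarith))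
  · have inj : ∀ v w : Plane, fderiv ℝ y q v = fderiv ℝ y q w → v = w := by
      intro v w hvw
      rw [← tangentVec_eq_fderiv, ← tangentVec_eq_fderiv] at hvw
      have hg := (hy.lorentz q (hVU hq)).ne
      ext1
      rw [(hn q hq).eq_add hg v.ofLp, (hn q hq).eq_add hg w.ofLp, hvw]
    apply inj
    rw [VectorField.fderiv_apply_lieBracket (𝕜 := ℝ) (sy.contDiffAt (hV.mem_nhds hq))
      (by rw [minSmoothness_of_isRCLikeNormedField]; exact WithTop.coe_le_coe.2 le_top)
      (differentiableAt_of_contDiffOn hV sX₂ hq) (differentiableAt_of_contDiffOn hV sX₁ hq)]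
    change dirDeriv X₁ (dirDeriv X₂ y) q - dirDeriv X₂ (dirDeriv X₁ y) q = _
    rw [map_add, map_smul, map_smul]
    change _ = _ • dirDeriv X₁ y q + _ • dirDeriv X₂ y q
    linear_combination (norm := module) d12 q hq - d21 q hq

end IsLorentzPatch

/-! ### The local form of a minimal surface -/

/-- Where `Q` is null the surface is a surface `model α`, in suitable coordinates. -/
lemma IsMovingFrame.exists_chart {V : Set Plane} {y : Plane → E52} {X₁ X₂ : Plane → Plane}
    {P Q : Plane → E52} {θ₁ θ₂ : Plane → ℝ} {k m : ℝ}
    (h : IsMovingFrame V y X₁ X₂ P Q θ₁ θ₂ k m) (hQ : ∀ q ∈ V, sp (Q q) (Q q) = 0)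
    {q₀ : Plane} (hq₀ : q₀ ∈ V) :
    ∃ e : OpenPartialHomeomorph Plane Plane, q₀ ∈ e.source ∧ ContDiffOn ℝ ∞ e e.source ∧
      ContDiffOn ℝ ∞ e.symm e.target ∧ ∃ (I : Set ℝ) (α : ℝ → E52), IsNullCurveInLightCone I α ∧
      (∀ u ∈ I, sp (iteratedDeriv 2 α u) (iteratedDeriv 2 α u) = 4 / 9) ∧
      e.source ⊆ V ∧ ∀ q ∈ e.source, e q 1 ∈ I ∧ y q = model α (e q 0) (e q 1) := by
  obtain ⟨W, hWV, hW, hq₀W, t, st, t2, t1⟩ := h.exists_dirDeriv_eq_zero hQ hq₀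
  obtain ⟨s, a, hd⟩ := (h.mono hW hWV).exists_isModelData (fun q hq => hQ q (hWV hq)) st t2 t1
    ⟨q₀, hq₀W⟩
  obtain ⟨e, h1, h2, h3, I, α, h4, h5, h6, h7⟩ := hd.exists_chart hq₀W
  exact ⟨e, h1, h2, h3, I, α, h4, h5, h6.trans hWV, h7⟩

section Manifold

variable {M : Type*} [TopologicalSpace M] [ChartedSpace Plane M] [IsManifold (𝓡 2) ∞ M]

lemma trans_mem_maximalAtlas {e : OpenPartialHomeomorph M Plane}
    (he : e ∈ IsManifold.maximalAtlas (𝓡 2) ∞ M) {f : OpenPartialHomeomorph Plane Plane}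
    (hf : ContDiffOn ℝ ∞ f f.source) (hf' : ContDiffOn ℝ ∞ f.symm f.target) :
    e.trans f ∈ IsManifold.maximalAtlas (𝓡 2) ∞ M := by
  apply OpenPartialHomeomorph.mem_maximalAtlas_of_contMDiffOn
  · exact hf.contMDiffOn.comp ((contMDiffOn_of_mem_maximalAtlas he).mono inter_subset_left)
      fun p hp => hp.2
  · exact (contMDiffOn_symm_of_mem_maximalAtlas he).comp (hf'.contMDiffOn.mono inter_subset_left)
      fun p hp => hp.2

theorem IsLorentzianSurface.isCongruentToModel {x : M → E52} (hx : IsLorentzianSurface x)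
    {K KD : ℝ} (hmin : IsMinimal x) (hK : HasGaussCurvature x K) (hKD : KD ≠ 0)
    (hD : HasNormalCurvature x KD) : IsCongruentToModel x := by
  intro p
  set e := chartAt Plane p with he
  have hea : e ∈ IsManifold.maximalAtlas (𝓡 2) ∞ M := IsManifold.chart_mem_maximalAtlas p
  have hpe : p ∈ e.source := mem_chart_source Plane p
  have on_target : ∀ {R : Plane → Prop}, (∀ p ∈ e.source, R (e p)) → ∀ q ∈ e.target, R q :=
    fun hR q hq => e.right_inv hq ▸ hR _ (e.map_target hq)
  obtain ⟨V, hV, hpV, X₁, X₂, P, Q, θ₁, θ₂, h⟩ := (hx.isLorentzPatch hea).exists_isMovingFrame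
    (on_target (hmin e hea)) (on_target (hK e hea)) hKD
    (on_target (R := fun q => ∀ a b f₃ f₄, IsFrame (x ∘ e.symm) q a b f₃ f₄ →
      normalCurvature (x ∘ e.symm) q a b f₃ f₄ = KD) (hD e hea)) (e.map_source hpe)
  obtain ⟨W, hWV, hW, hpW, h0⟩ := exists_nhds_eq_zero_or_eq_zero h.isOpen hpV h.smooth₁ h.smooth₂
    (h.linearIndependent hpV) (h.smoothP.sp h.smoothP) (h.smoothQ.sp h.smoothQ)
    (continuousOn_const.mul h.smoothθ₂.continuousOn)
    (continuousOn_const.mul h.smoothθ₁.continuousOn).neg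
    (fun q hq => h.dirDeriv_spPP hq) (fun q hq => h.dirDeriv_spQQ hq)
    (fun q hq => by rw [h.spPP_mul q hq, h.m_eq_zero ⟨_, hpV⟩])
  have chart : ∃ f : OpenPartialHomeomorph Plane Plane, e p ∈ f.source ∧
      ContDiffOn ℝ ∞ f f.source ∧ ContDiffOn ℝ ∞ f.symm f.target ∧ ∃ (I : Set ℝ) (α : ℝ → E52),
      IsNullCurveInLightCone I α ∧
      (∀ u ∈ I, sp (iteratedDeriv 2 α u) (iteratedDeriv 2 α u) = 4 / 9) ∧
      f.source ⊆ W ∧ ∀ q ∈ f.source, f q 1 ∈ I ∧ (x ∘ e.symm) q = model α (f q 0) (f q 1) := by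
    have hW' := h.mono hW hWV
    exact h0.elim (fun h0 => hW'.swap.exists_chart h0 hpW) fun h0 => hW'.exists_chart h0 hpW
  obtain ⟨f, hpf, sf, sf', I, α, hα, hα2, -, hf⟩ := chart
  refine ⟨I, α, hα, hα2, LinearEquiv.refl ℝ E52, fun v w => rfl, e.trans f,
    trans_mem_maximalAtlas hea sf sf', ⟨hpe, hpf⟩, fun q hq =>
      ⟨(hf (e q) hq.2).1, ?_⟩⟩
  have := (hf (e q) hq.2).2
  rwa [Function.comp_apply, e.left_inv hq.1] at this

end Manifold

end LorentzSurface

end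

theorem theorem3p5 {M : Type*} [TopologicalSpace M] [ChartedSpace Plane M]
    [IsManifold (𝓡 2) ∞ M] [ConnectedSpace M] (x : M → E52)
    (hx : IsLorentzianSurface x) (hfull : LiesFully x) :
    (IsMinimal x ∧ (∃ K : ℝ, HasGaussCurvature x K) ∧
        ∃ KD : ℝ, KD ≠ 0 ∧ HasNormalCurvature x KD) ↔
      IsCongruentToModel x := by
  constructor
  · rintro ⟨hmin, ⟨K, hK⟩, KD, hKD, hD⟩
    exact hx.isCongruentToModel hmin hK hKD hD
  · intro h
    obtain ⟨hmin, hK, hD⟩ := h.curvatures hx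
    exact ⟨hmin, ⟨1 / 3, hK⟩, hD⟩
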